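/- Let $k$ be a field of characteristic zero. All objects are bigraded $k$-vector spaces with finite-dimensional components (cohomological degree $p$, internal degree $q$), with Koszul signs given by the parity of $p+q$; duals are degreewise, $\overline V^{\,p,q}=(V^{-p,-q})^*$, and $V[n]^{p,q}=V^{p+n,q}$. Let $\mathfrak t=\mathfrak t_1\oplus\mathfrak t_2$ be a finite-dimensional graded Lie superalgebra in cohomological degree $0$ and internal degrees $1$ (odd) and $2$ (even), with bases $Q_\alpha$, $P_a$ and $[Q_\alpha,Q_\beta]=\sum_a\gamma^a_{\alpha\beta}P_a$. Let $R=k[\lambda^\alpha]$ (with $\lambda^\alpha$ in bidegree $(1,-1)$) and $S=R/\langle\sum_{\alpha,\beta}\gamma^a_{\alpha\beta}\lambda^\alpha\lambda^\beta\rangle_a$. Let $$A^\bullet(S)=\Big(k[x^a,\theta^\alpha]\otimes S,\ \mathcal D=\sum_\alpha\lambda^\alpha\big(\tfrac{\partial}{\partial\theta^\alpha}+\tfrac12\sum_{a,\beta}\gamma^a_{\alpha\beta}\theta^\beta\tfrac{\partial}{\partial x^a}\big)\Big)$$ be the canonical multiplet with polynomial coefficients, where $\theta^\alpha$ is odd of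 bidegree $(0,-1)$ and $x^a$ is even of bidegree $(0,-2)$, and let the multiplet $M$ be its cohomology modulo the constants $k\cdot 1$. An $L_\infty$ algebra $\mathfrak a$ in positive internal degrees is encoded by its Chevalley--Eilenberg cochains $C^\bullet(\mathfrak a)$, the free graded commutative algebra on $\overline{\mathfrak a}[-1]$ with a differential of bidegree $(1,0)$; isomorphisms of $L_\infty$ algebras are isomorphisms of these bigraded dg algebras. $H^\bullet(\mathfrak a)$ is the cohomology of $C^\bullet(\mathfrak a)$, and $H^{(1)}(\mathfrak a)\subseteq H^\bullet(\mathfrak a)$ is the subspace of classes with a representative linear in $\overline{\mathfrak a}[-1]$. Let $\mathfrak t^{(\infty)}$ be the $L_\infty$ algebra whose cochains are a minimal Tate resolution of $S$ over $R$: stage $0$ is $R$, stage $1$ is $C^\bullet(\mathfrak t)$, and for $s\ge1$ stage $s+1$ adjoins generators of total degree $-(s+1)$ whose differentials represent a minimal homogeneous generating set of the $R$-module $H^{-s}$ (total degree) of stage $s$. Let $\mathfrak n\subseteq\mathfrak t^{(\infty)}$ be the subalgebra of internal degrees $\ge3$. If $M$ and $H^{(1)}(\mathfrak n)$ are isomorphic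 as bigraded vector spaces (that is, $\overline M[-1]\cong\overline{H^{(1)}(\mathfrak n)}[-1]$, which is a minimal generating set of $\mathfrak n$), then $\mathfrak n$ is isomorphic, as an $L_\infty$ algebra, to the free (strict, bigraded) Lie algebra $F[\overline M[-1]]$. In particular, $\mathfrak t^{(\infty)}$ is freely generated from internal degree $3$: its part in internal degrees $\ge3$ is isomorphic to a free strict Lie algebra. -/

import Mathlib

open scoped TensorProduct

universe u v w

noncomputable section

/-- The Koszul sign `(-1)^n`. -/
def ksign (k : Type u) [Field k] (n : ℤ) : k := ((n.negOnePow : ℤˣ) : ℤ)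

/-! ### Bigraded vector spaces and bigraded Lie superalgebras -/

/-- A bigraded vector space, given by a homogeneous basis `e i` in cohomological degree `coh i`
and internal degree `int i`.  The underlying vector space is `ι →₀ k`. -/
structure BiBasis where
  ι : Type v
  coh : ι → ℤ
  int : ι → ℤ

namespace BiBasis

/-- The consistent (totalised) degree of `e i`; it determines the parity. -/
def tot (B : BiBasis.{v}) (i : B.ι) : ℤ := B.coh i + B.int i

/-- The component of bidegree `(c, n)`. -/
def component (k : Type u) [Field k] (B : BiBasis.{v}) (c n : ℤ) : Submodule k (B.ι →₀ k) :=
  Finsupp.supported k k {i | B.coh i = c ∧ B.int i = n}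

/-- The basis vector `e i`. -/
def e (k : Type u) [Field k] (B : BiBasis.{v}) (i : B.ι) : B.ι →₀ k := Finsupp.single i 1

end BiBasis

/-- The structure of a bigraded (strict) Lie algebra with zero differential, with the Koszul signs
determined by the consistent degree, on the bigraded vector space `B` (over a field of
characteristic zero). -/
structure BiLie (k : Type u) [Field k] (B : BiBasis.{v}) where
  br : (B.ι →₀ k) →ₗ[k] (B.ι →₀ k) →ₗ[k] (B.ι →₀ k)
  br_mem : ∀ i j, br (B.e k i) (B.e k j) ∈
    B.component k (B.coh i + B.coh j) (B.int i + B.int j)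
  antisymm : ∀ i j, br (B.e k i) (B.e k j) =
    -(ksign k (B.tot i * B.tot j) • br (B.e k j) (B.e k i))
  jacobi : ∀ i j l, br (B.e k i) (br (B.e k j) (B.e k l)) =
    br (br (B.e k i) (B.e k j)) (B.e k l) +
      ksign k (B.tot i * B.tot j) • br (B.e k j) (br (B.e k i) (B.e k l))

/-- Homomorphisms of bigraded Lie algebras: linear, preserving the bidegree and the bracket. -/
structure BiLie.IsHom {k : Type u} [Field k] {B B' : BiBasis.{v}} (L : BiLie k B) (L' : BiLie k B')
    (φ : (B.ι →₀ k) →ₗ[k] (B'.ι →₀ k)) : Prop where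
  map_component : ∀ c n, ∀ a ∈ B.component k c n, φ a ∈ B'.component k c n
  map_br : ∀ a b, φ (L.br a b) = L'.br (φ a) (φ b)

/-- `L`, together with the bidegree preserving map `j : V → L`, is the free bigraded Lie algebra
`F[V]` on the bigraded vector space `V`: every bidegree preserving linear map from `V` to a bigraded
Lie algebra extends uniquely to a homomorphism. -/
structure BiLie.IsFreeOn {k : Type u} [Field k] {B : BiBasis.{v}} (L : BiLie k B)
    (V : ℤ → ℤ → Type w) [∀ c n, AddCommGroup (V c n)] [∀ c n, Module k (V c n)]
    (j : ∀ c n, V c n →ₗ[k] (B.ι →₀ k)) : Prop where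
  j_mem : ∀ c n a, j c n a ∈ B.component k c n
  existsUnique_lift : ∀ (B' : BiBasis.{v}) (L' : BiLie k B')
    (f : ∀ c n, V c n →ₗ[k] (B'.ι →₀ k)), (∀ c n a, f c n a ∈ B'.component k c n) →
      ∃! φ : (B.ι →₀ k) →ₗ[k] (B'.ι →₀ k), L.IsHom L' φ ∧ ∀ c n a, φ (j c n a) = f c n a

/-! ### The free graded commutative algebra on the shifted dual -/

section Cochains

variable (k : Type u) [Field k] (B : BiBasis.{v})

/-- Graded commutativity of the generators `x i`.  The generator `x i` is dual to `e i`, shifted by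
one, so that it has bidegree `(1 - coh i, - int i)` and total degree `1 - tot i`.  In characteristic
zero the relation for `i = j` says that odd generators square to zero. -/
inductive CochainRel : FreeAlgebra k B.ι → FreeAlgebra k B.ι → Prop
  | comm (i j : B.ι) : CochainRel (FreeAlgebra.ι k i * FreeAlgebra.ι k j)
      (ksign k ((1 - B.tot i) * (1 - B.tot j)) • (FreeAlgebra.ι k j * FreeAlgebra.ι k i))

/-- The free graded commutative algebra on the shifted (degreewise) dual of the bigraded vector
space `B`. -/
def Cochain : Type (max u v) := RingQuot (CochainRel k B)

instance : Ring (Cochain k B) := inferInstanceAs (Ring (RingQuot (CochainRel k B)))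

instance : Algebra k (Cochain k B) := inferInstanceAs (Algebra k (RingQuot (CochainRel k B)))

namespace Cochain

/-- The generator dual to `e i`. -/
def x (i : B.ι) : Cochain k B := RingQuot.mkAlgHom k (CochainRel k B) (FreeAlgebra.ι k i)

/-- The monomial given by a word in the generators. -/
def word (l : List B.ι) : Cochain k B := (l.map (x k B)).prod

/-- The component of bidegree `(p, q)`. -/
def piece (p q : ℤ) : Submodule k (Cochain k B) :=
  Submodule.span k {y | ∃ l : List B.ι, (l.map fun i => 1 - B.coh i).sum = p ∧
    (l.map fun i => -B.int i).sum = q ∧ y = word k B l}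

/-- The space of linear cochains. -/
def linear : Submodule k (Cochain k B) := Submodule.span k (Set.range (x k B))

variable {k B}

theorem x_comm (i j : B.ι) : x k B i * x k B j =
    ksign k ((1 - B.tot i) * (1 - B.tot j)) • (x k B j * x k B i) := by
  have h := RingQuot.mkAlgHom_rel k (CochainRel.comm (k := k) (B := B) i j)
  rw [map_mul, map_smul, map_mul] at h
  exact h

/-- The universal property of the free graded commutative algebra. -/
def lift {A : Type w} [Ring A] [Algebra k A] (f : B.ι → A)
    (hf : ∀ i j, f i * f j = ksign k ((1 - B.tot i) * (1 - B.tot j)) • (f j * f i)) :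
    Cochain k B →ₐ[k] A :=
  RingQuot.liftAlgHom k ⟨FreeAlgebra.lift k f, by
    rintro _ _ ⟨i, j⟩
    simpa using hf i j⟩

theorem lift_x {A : Type w} [Ring A] [Algebra k A] (f : B.ι → A)
    (hf : ∀ i j, f i * f j = ksign k ((1 - B.tot i) * (1 - B.tot j)) • (f j * f i)) (i : B.ι) :
    lift f hf (x k B i) = f i := by
  unfold lift x
  erw [RingQuot.liftAlgHom_mkAlgHom_apply]
  simp

theorem word_cons (i : B.ι) (l : List B.ι) : word k B (i :: l) = x k B i * word k B l := by
  simp [word]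

theorem x_mem_piece (i : B.ι) : x k B i ∈ piece k B (1 - B.coh i) (-B.int i) :=
  Submodule.subset_span ⟨[i], by simp, by simp, by simp [word]⟩

theorem span_words : Submodule.span k (Set.range (word k B)) = ⊤ := by
  rw [eq_top_iff]
  rintro a -
  obtain ⟨b, rfl⟩ := RingQuot.mkAlgHom_surjective k (CochainRel k B) a
  induction b using FreeAlgebra.induction with
  | grade0 r =>
    rw [AlgHom.commutes, Algebra.algebraMap_eq_smul_one]
    exact Submodule.smul_mem _ _ (Submodule.subset_span ⟨[], by simp [word]; rfl⟩)
  | grade1 i => exact Submodule.subset_span ⟨[i], by rw [word, List.map_singleton, List.prod_singleton, x]⟩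
  | mul a b ha hb =>
    rw [map_mul]
    have h := Submodule.mul_mem_mul ha hb
    rw [Submodule.span_mul_span] at h
    refine Submodule.span_mono ?_ h
    rintro _ ⟨_, ⟨l, rfl⟩, _, ⟨l', rfl⟩, rfl⟩
    exact ⟨l ++ l', by simp [word]⟩
  | add a b ha hb => rw [map_add]; exact Submodule.add_mem _ ha hb

end Cochain

end Cochains

/-! ### L-infinity algebras -/

/-- An `L_∞` algebra in positive internal degrees, with finite-dimensional homogeneous components:
a bigraded vector space (with basis) together with its Chevalley–Eilenberg differential, that is,
a derivation of bidegree `(1, 0)` and square zero of the free graded commutative algebra on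
its shifted dual.  The brackets are the duals of the homogeneous components of the differential on
generators.  Because internal degrees are positive, every homogeneous component of the cochains
is finite-dimensional and no completion is needed. -/
structure LInf (k : Type u) [Field k] extends BiBasis.{v} where
  int_pos : ∀ i, 0 < int i
  finite_le : ∀ n, {i | int i ≤ n}.Finite
  d : Cochain k toBiBasis →ₗ[k] Cochain k toBiBasis
  d_piece : ∀ p q, ∀ a ∈ Cochain.piece k toBiBasis p q, d a ∈ Cochain.piece k toBiBasis (p + 1) q
  d_mul : ∀ p q, ∀ a ∈ Cochain.piece k toBiBasis p q, ∀ b,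
    d (a * b) = d a * b + ksign k (p + q) • (a * d b)
  d_d : ∀ a, d (d a) = 0

/-- The cohomology in bidegree `(p, q)` of a complex `X` with components `P p q` and
differential `d` of bidegree `(1, 0)`, modulo (the classes of the cocycles in) a subspace `N`; the
cohomology itself is the case `N = ⊥`. -/
abbrev BiCohomology {k : Type u} [Field k] {X : Type w} [AddCommGroup X] [Module k X]
    (P : ℤ → ℤ → Submodule k X) (d : X →ₗ[k] X) (N : Submodule k X) (p q : ℤ) : Type w :=
  ↥(LinearMap.ker d ⊓ P p q) ⧸
    ((P (p - 1) q).map d ⊔ N).comap (LinearMap.ker d ⊓ P p q).subtype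

namespace LInf

variable {k : Type u} [Field k]

/-- The cochain dual to `e i`. -/
abbrev x (A : LInf.{u, v} k) (i : A.ι) : Cochain k A.toBiBasis := Cochain.x k A.toBiBasis i

/-- The Lie algebra cohomology `H^{p,q}` of an `L_∞` algebra. -/
abbrev H (A : LInf.{u, v} k) (p q : ℤ) : Type (max u v) :=
  BiCohomology (Cochain.piece k A.toBiBasis) A.d ⊥ p q

/-- `H^{(1)}`: the classes in `H^{p,q}` that have a representative which is linear in the
generators. -/
def H1 (A : LInf.{u, v} k) (p q : ℤ) : Submodule k (A.H p q) :=
  ((Cochain.linear k A.toBiBasis).comap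
    (LinearMap.ker A.d ⊓ Cochain.piece k A.toBiBasis p q).subtype).map (Submodule.mkQ _)

/-- An isomorphism of `L_∞` algebras, as an isomorphism of the bigraded commutative dg algebras of
cochains. -/
def Isomorphic (A A' : LInf.{u, v} k) : Prop :=
  ∃ Φ : Cochain k A'.toBiBasis ≃ₐ[k] Cochain k A.toBiBasis,
    (∀ p q, (Cochain.piece k A'.toBiBasis p q).map Φ.toLinearMap =
      Cochain.piece k A.toBiBasis p q) ∧
    ∀ a, Φ (A'.d a) = A.d (Φ a)

/-- The `L_∞` algebra `A` is the strict Lie algebra `L`: with `[e i, e j] = ∑ c_{ij}^l e l`, the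
differential is given by `d x^l = -1/2 ∑ (-1)^{|i| (|j| + 1)} c_{ij}^l x^i x^j`, that is,
`dξ = -1/2 [ξ, ξ]` for the universal element `ξ = ∑ x^i e i`.  In particular all brackets other than
the 2-bracket vanish. -/
def IsStrict (A : LInf.{u, v} k) (L : BiLie k A.toBiBasis) : Prop :=
  ∀ l, A.d (A.x l) = -((2 : k)⁻¹ •
    ∑ i ∈ (A.finite_le (A.int l)).toFinset, ∑ j ∈ (A.finite_le (A.int l)).toFinset,
      (ksign k (A.tot i * (A.tot j + 1)) * L.br (A.e k i) (A.e k j) l) • (A.x i * A.x j))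

/-- The `L_∞` algebra `A` is (isomorphic to) the free strict Lie algebra `F[V]` on the bigraded
vector space `V`. -/
def IsFreeLie (A : LInf.{u, v} k) (V : ℤ → ℤ → Type w) [∀ c n, AddCommGroup (V c n)]
    [∀ c n, Module k (V c n)] : Prop :=
  ∃ (F : LInf.{u, v} k) (L : BiLie k F.toBiBasis) (j : ∀ c n, V c n →ₗ[k] (F.ι →₀ k)),
    F.IsStrict L ∧ L.IsFreeOn V j ∧ A.Isomorphic F

section Trunc

variable (A : LInf.{u, v} k) (m : ℤ)

/-- The part of internal degree at least `m`. -/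
abbrev truncBasis : BiBasis.{v} where
  ι := {i : A.ι // m ≤ A.int i}
  coh i := A.coh i
  int i := A.int i

open Classical in
/-- Restriction of cochains to the part of internal degree at least `m`. -/
def truncRes : Cochain k A.toBiBasis →ₐ[k] Cochain k (A.truncBasis m) :=
  Cochain.lift (fun i => if h : m ≤ A.int i then Cochain.x k (A.truncBasis m) ⟨i, h⟩ else 0) (by
    intro i j
    by_cases hi : m ≤ A.int i <;> by_cases hj : m ≤ A.int j <;> simp only [hi, hj, dite_true,
      dite_false, zero_mul, mul_zero, smul_zero]
    exact Cochain.x_comm (B := A.truncBasis m) ⟨i, hi⟩ ⟨j, hj⟩)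

/-- Extension of cochains by zero on basis vectors of internal degree less than `m`. -/
def truncExt : Cochain k (A.truncBasis m) →ₐ[k] Cochain k A.toBiBasis :=
  Cochain.lift (fun i => A.x i.1) (fun i j => Cochain.x_comm (B := A.toBiBasis) i.1 j.1)

variable {A m}

theorem truncRes_x_of_le {i : A.ι} (h : m ≤ A.int i) :
    A.truncRes m (A.x i) = Cochain.x k (A.truncBasis m) ⟨i, h⟩ := by
  simp [truncRes, Cochain.lift_x, h]

theorem truncRes_x_of_lt {i : A.ι} (h : A.int i < m) : A.truncRes m (A.x i) = 0 := by
  simp [truncRes, Cochain.lift_x, not_le.2 h]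

theorem truncExt_x (i : (A.truncBasis m).ι) :
    A.truncExt m (Cochain.x k (A.truncBasis m) i) = A.x i.1 :=
  Cochain.lift_x (B := A.truncBasis m) (fun i => A.x i.1) _ i

theorem truncRes_truncExt (a : Cochain k (A.truncBasis m)) :
    A.truncRes m (A.truncExt m a) = a := by
  have ha : a ∈ Submodule.span k (Set.range (Cochain.word k (A.truncBasis m))) := by
    rw [Cochain.span_words]; trivial
  induction ha using Submodule.span_induction with
  | mem a h =>
    obtain ⟨l, rfl⟩ := h
    induction l with
    | nil => simp [Cochain.word]
    | cons i l ih =>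
      rw [Cochain.word_cons, map_mul, map_mul, ih, truncExt_x, truncRes_x_of_le i.2]
  | zero => simp
  | add a b _ _ ha hb => rw [map_add, map_add, ha, hb]
  | smul r a _ ha => rw [map_smul, map_smul, ha]

theorem truncExt_word (l : List (A.truncBasis m).ι) :
    A.truncExt m (Cochain.word k (A.truncBasis m) l) =
      Cochain.word k A.toBiBasis (l.map Subtype.val) := by
  induction l with
  | nil => simp [Cochain.word]
  | cons i l ih => rw [Cochain.word_cons, map_mul, ih, truncExt_x, List.map_cons, Cochain.word_cons]

theorem truncExt_piece {p q : ℤ} {a : Cochain k (A.truncBasis m)}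
    (ha : a ∈ Cochain.piece k (A.truncBasis m) p q) :
    A.truncExt m a ∈ Cochain.piece k A.toBiBasis p q := by
  induction ha using Submodule.span_induction with
  | mem a h =>
    obtain ⟨l, hp, hq, rfl⟩ := h
    refine Submodule.subset_span ⟨l.map Subtype.val, ?_, ?_, truncExt_word l⟩
    · rw [← hp, List.map_map]; rfl
    · rw [← hq, List.map_map]; rfl
  | zero => simp
  | add a b _ _ ha hb => rw [map_add]; exact Submodule.add_mem _ ha hb
  | smul r a _ ha => rw [map_smul]; exact Submodule.smul_mem _ _ ha

theorem truncRes_word (l : List A.ι) : A.truncRes m (Cochain.word k A.toBiBasis l) = 0 ∨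
    ∃ l' : List (A.truncBasis m).ι, l'.map Subtype.val = l ∧
      A.truncRes m (Cochain.word k A.toBiBasis l) = Cochain.word k (A.truncBasis m) l' := by
  induction l with
  | nil => exact Or.inr ⟨[], by simp [Cochain.word]⟩
  | cons i l ih =>
    rw [Cochain.word_cons, map_mul]
    rcases ih with h | ⟨l', hl, h⟩
    · left; rw [h, mul_zero]
    · by_cases hi : m ≤ A.int i
      · right
        refine ⟨⟨i, hi⟩ :: l', by rw [List.map_cons, hl], ?_⟩
        rw [h, truncRes_x_of_le hi, Cochain.word_cons]
      · left
        rw [truncRes_x_of_lt (not_le.1 hi), zero_mul]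

theorem truncRes_piece {p q : ℤ} {a : Cochain k A.toBiBasis}
    (ha : a ∈ Cochain.piece k A.toBiBasis p q) :
    A.truncRes m a ∈ Cochain.piece k (A.truncBasis m) p q := by
  induction ha using Submodule.span_induction with
  | mem a h =>
    obtain ⟨l, hp, hq, rfl⟩ := h
    rcases truncRes_word (m := m) l with h | ⟨l', rfl, h⟩
    · rw [h]; exact Submodule.zero_mem _
    · rw [h]
      refine Submodule.subset_span ⟨l', ?_, ?_, rfl⟩
      · rw [← hp, List.map_map]; rfl
      · rw [← hq, List.map_map]; rfl
  | zero => simp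
  | add a b _ _ ha hb => rw [map_add]; exact Submodule.add_mem _ ha hb
  | smul r a _ ha => rw [map_smul]; exact Submodule.smul_mem _ _ ha

theorem truncRes_word_of_lt (l : List A.ι) (hl : l ≠ [])
    (h : -(l.map fun i => -A.int i).sum < m) :
    A.truncRes m (Cochain.word k A.toBiBasis l) = 0 := by
  rcases truncRes_word (m := m) l with h0 | ⟨l', rfl, -⟩
  · exact h0
  · exfalso
    have key : ∀ l : List (A.truncBasis m).ι,
        0 ≤ -((l.map Subtype.val).map fun i => -A.int i).sum := by
      intro l
      induction l with
      | nil => simp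
      | cons i l ih =>
        have := A.int_pos i.1
        simp only [List.map_cons, List.sum_cons] at ih ⊢
        omega
    cases l' with
    | nil => simp at hl
    | cons i l' =>
      have h1 := key l'
      have h2 : m ≤ A.int i.1 := i.2
      simp only [List.map_cons, List.sum_cons] at h h1
      omega

theorem truncRes_d_x {i : A.ι} (hi : A.int i < m) : A.truncRes m (A.d (A.x i)) = 0 := by
  have h := A.d_piece _ _ _ (Cochain.x_mem_piece (k := k) (B := A.toBiBasis) i)
  generalize A.d (Cochain.x k A.toBiBasis i) = y at h ⊢
  induction h using Submodule.span_induction with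
  | mem a h =>
    obtain ⟨l, -, hq, rfl⟩ := h
    have := A.int_pos i
    refine truncRes_word_of_lt l ?_ (by omega)
    rintro rfl
    simp at hq
    omega
  | zero => simp
  | add a b _ _ ha hb => rw [map_add, ha, hb, add_zero]
  | smul r a _ ha => rw [map_smul, ha, smul_zero]

theorem d_one (A : LInf.{u, v} k) : A.d 1 = 0 := by
  have h1 : (1 : Cochain k A.toBiBasis) ∈ Cochain.piece k A.toBiBasis 0 0 :=
    Submodule.subset_span ⟨[], by simp [Cochain.word]⟩
  have h := A.d_mul 0 0 1 h1 1
  simpa [ksign] using h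

/-- Restriction is compatible with the differentials. -/
theorem truncRes_d (a : Cochain k A.toBiBasis) :
    A.truncRes m (A.d a) = A.truncRes m (A.d (A.truncExt m (A.truncRes m a))) := by
  have ha : a ∈ Submodule.span k (Set.range (Cochain.word k A.toBiBasis)) := by
    rw [Cochain.span_words]; trivial
  induction ha using Submodule.span_induction with
  | mem a h =>
    obtain ⟨l, rfl⟩ := h
    induction l with
    | nil => simp [Cochain.word]
    | cons i l ih =>
      have hx := Cochain.x_mem_piece (k := k) (B := A.toBiBasis) i
      rw [Cochain.word_cons, A.d_mul _ _ _ hx, map_add, map_mul, map_smul, map_mul, map_mul]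
      by_cases hi : m ≤ A.int i
      · rw [map_mul (A.truncExt m), truncRes_x_of_le hi, truncExt_x, A.d_mul _ _ _ hx, map_add,
          map_mul, map_smul, map_mul, truncRes_truncExt, ← ih, truncRes_x_of_le hi]
      · have hi := not_le.1 hi
        rw [truncRes_x_of_lt hi, truncRes_d_x hi]
        simp
  | zero => simp
  | add a b _ _ ha hb => simp only [map_add]; rw [ha, hb]
  | smul r a _ ha => simp only [map_smul]; rw [ha]

end Trunc

/-- The sub-`L_∞` algebra of internal degree at least `m`.  Its cochains are the quotient of the
cochains of `A` by the ideal generated by the generators dual to internal degree less than `m`. -/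
def trunc (A : LInf.{u, v} k) (m : ℤ) : LInf.{u, v} k where
  toBiBasis := A.truncBasis m
  int_pos i := A.int_pos i.1
  finite_le n := (A.finite_le n).preimage (f := Subtype.val) Subtype.val_injective.injOn
  d := (A.truncRes m).toLinearMap ∘ₗ A.d ∘ₗ (A.truncExt m).toLinearMap
  d_piece p q a ha := truncRes_piece (A.d_piece p q _ (truncExt_piece ha))
  d_mul p q a ha b := by
    simp only [LinearMap.comp_apply, AlgHom.toLinearMap_apply, map_mul]
    rw [A.d_mul p q _ (truncExt_piece ha), map_add, map_mul, map_smul, map_mul, truncRes_truncExt,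
      truncRes_truncExt]
  d_d a := by
    simp only [LinearMap.comp_apply, AlgHom.toLinearMap_apply]
    rw [← truncRes_d, A.d_d, map_zero]

/-- `A` is freely generated from internal degree `m`: its part of internal degree at least `m` is
the free strict Lie algebra on some bigraded vector space. -/
def IsFreelyGeneratedFrom (A : LInf.{u, v} k) (m : ℤ) : Prop :=
  ∃ W : BiBasis.{v}, (A.trunc m).IsFreeLie (fun c n => W.component k c n)

end LInf

/-! ### Supertranslation algebras and canonical multiplets -/

/-- A (generalised) supertranslation algebra `𝔱 = 𝔱₁ ⊕ 𝔱₂`, supported in cohomological degree zero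
and internal degrees one and two, with basis `Q α` of the odd part `𝔱₁`, basis `P a` of the even
part `𝔱₂`, and brackets `[Q α, Q β] = ∑ a, γ a α β • P a`.  (The Jacobi identity is void.) -/
structure Supertranslation (k : Type u) [Field k] where
  dim₁ : ℕ
  dim₂ : ℕ
  γ : Fin dim₂ → Fin dim₁ → Fin dim₁ → k
  symm : ∀ a α β, γ a α β = γ a β α

namespace Supertranslation

variable {k : Type u} [Field k] (t : Supertranslation k)

/-- The ring `R = k[λ]` of polynomial functions on `𝔱₁`. -/
abbrev R : Type u := MvPolynomial (Fin t.dim₁) k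

/-- The ideal `⟨λ²⟩` generated by the quadratic Maurer–Cartan equations. -/
def quadrics : Ideal t.R :=
  Ideal.span (Set.range fun a => ∑ α, ∑ β,
    t.γ a α β • (MvPolynomial.X α * MvPolynomial.X β : t.R))

/-- The ring `S = R/⟨λ²⟩`. -/
abbrev S : Type u := t.R ⧸ t.quadrics

/-- The algebra of (polynomial) functions of the odd coordinates `θ` of superspace. -/
abbrev Odd : Type u := ExteriorAlgebra k (Fin t.dim₁ → k)

/-- The algebra of polynomial functions of the even coordinates `x` of superspace. -/
abbrev Even : Type u := MvPolynomial (Fin t.dim₂) k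

/-- The odd coordinate `θ^α`. -/
def θ (α : Fin t.dim₁) : t.Odd := ExteriorAlgebra.ι k (Pi.single α 1)

/-- The odd derivation `∂/∂θ^α`. -/
def dθ (α : Fin t.dim₁) : t.Odd →ₗ[k] t.Odd :=
  CliffordAlgebra.contractLeft (Q := (0 : QuadraticForm k (Fin t.dim₁ → k))) (LinearMap.proj α)

/-- Multiplication by the class of `λ^α` in `S`. -/
def mulLam (α : Fin t.dim₁) : t.S →ₗ[k] t.S :=
  LinearMap.mulLeft k (Ideal.Quotient.mk t.quadrics (MvPolynomial.X α))

/-- The cochains of the canonical multiplet `A(S) = O(T) ⊗ S`, where `O(T)` is the algebra of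
polynomial functions on superspace. -/
abbrev A : Type u := (t.Odd ⊗[k] t.Even) ⊗[k] t.S

/-- The covariant derivative `D_α = ∂/∂θ^α + 1/2 ∑ γ^a_{αβ} θ^β ∂/∂x^a` on superspace; these
satisfy `D_α D_β + D_β D_α = ∑ γ^a_{αβ} ∂/∂x^a`. -/
def covD (α : Fin t.dim₁) : t.Odd ⊗[k] t.Even →ₗ[k] t.Odd ⊗[k] t.Even :=
  TensorProduct.map (t.dθ α) LinearMap.id +
    (2 : k)⁻¹ • ∑ a, ∑ β, t.γ a α β •
      TensorProduct.map (LinearMap.mulLeft k (t.θ β)) (MvPolynomial.pderiv a).toLinearMap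

/-- The pure spinor differential `𝒟 = λ^α D_α`. -/
def D : t.A →ₗ[k] t.A := ∑ α, TensorProduct.map (t.covD α) (t.mulLam α)

/-- The component of bidegree `(p, q)` of `A(S)`: the generators `λ`, `θ` and `x` have bidegrees
`(1, -1)`, `(0, -1)` and `(0, -2)`. -/
def piece (p q : ℤ) : Submodule k t.A :=
  Submodule.span k {y | ∃ (r b l : ℕ) (ω : t.Odd) (f : t.Even) (g : t.R),
    ω ∈ ⋀[k]^r (Fin t.dim₁ → k) ∧ f.IsHomogeneous b ∧ g.IsHomogeneous l ∧
    p = l ∧ q = -(r + 2 * b + l) ∧ y = (ω ⊗ₜ[k] f) ⊗ₜ[k] Ideal.Quotient.mk t.quadrics g}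

/-- The multiplet `M`: the cohomology of the canonical multiplet `(A(S), 𝒟)` modulo the constants
`k`, in bidegree `(p, q)`. -/
abbrev Multiplet (p q : ℤ) : Type u :=
  BiCohomology t.piece t.D (Submodule.span k {(1 : t.A)}) p q

end Supertranslation

/-- The shifted dual `V̄[-1]` of a bigraded vector space: `V̄[-1]^{c,n} = (V^{1-c,-n})^*`. -/
abbrev ShiftedDual (k : Type u) [Field k] (V : ℤ → ℤ → Type w) [∀ p q, AddCommGroup (V p q)]
    [∀ p q, Module k (V p q)] (c n : ℤ) : Type (max u w) :=
  Module.Dual k (V (1 - c) (-n))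

/-! ### The Tate resolution -/

namespace LInf

variable {k : Type u} [Field k] (A : LInf.{u, v} k)

/-- The stage of the generator `x i` in the Tate resolution: minus its consistent degree. -/
def stage (i : A.ι) : ℤ := A.tot i - 1

/-- The part of consistent degree `-n` of the subalgebra of cochains generated by the generators of
stage at most `s`. -/
def stagePart (s n : ℤ) : Submodule k (Cochain k A.toBiBasis) :=
  Submodule.span k {y | ∃ l : List A.ι, (∀ i ∈ l, A.stage i ≤ s) ∧ (l.map A.stage).sum = n ∧
    y = Cochain.word k A.toBiBasis l}

/-- The `R`-linear combinations of the differentials of the generators `x i`, `i ∈ I`, where `R` is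
the subalgebra generated by the generators of stage zero. -/
def dSpan (I : Set A.ι) : Submodule k (Cochain k A.toBiBasis) :=
  Submodule.span k {y | ∃ r ∈ A.stagePart 0 0, ∃ i ∈ I, y = r * A.d (A.x i)}

end LInf

/-- The `L_∞` algebra `𝔱^(∞)` whose cochains are the (minimal) Tate resolution of `S`.
Stage zero is `R = k[λ]`, stage one is the Koszul complex `C(𝔱)`, and for every `s ≥ 1` the
differentials of the generators of stage `s + 1` represent a minimal set of generators of
the `R`-module `H^{-s}` (consistent degree) of the cdga generated by the generators of stage
at most `s`. -/
structure TateResolution {k : Type u} [Field k] (t : Supertranslation k) extends LInf.{u, v} k where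
  stage_nonneg : ∀ i, 0 ≤ toLInf.stage i
  lam : Fin t.dim₁ ≃ {i : ι // toLInf.stage i = 0}
  lam_deg : ∀ α, coh (lam α).1 = 0 ∧ int (lam α).1 = 1
  d_lam : ∀ α, d (toLInf.x (lam α).1) = 0
  vv : Fin t.dim₂ ≃ {i : ι // toLInf.stage i = 1}
  vv_deg : ∀ a, coh (vv a).1 = 0 ∧ int (vv a).1 = 2
  d_vv : ∀ a, d (toLInf.x (vv a).1) = -((2 : k)⁻¹ • ∑ α, ∑ β,
    t.γ a α β • (toLInf.x (lam α).1 * toLInf.x (lam β).1))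
  generate : ∀ s : ℤ, 1 ≤ s → ∀ z ∈ toLInf.stagePart s s, d z = 0 →
    z ∈ toLInf.dSpan {i | toLInf.stage i = s + 1} ⊔ (toLInf.stagePart s (s + 1)).map d
  minimal : ∀ s : ℤ, 1 ≤ s → ∀ i, toLInf.stage i = s + 1 →
    d (toLInf.x i) ∉ toLInf.dSpan {j | toLInf.stage j = s + 1 ∧ j ≠ i} ⊔
      (toLInf.stagePart s (s + 1)).map d

/-- The subalgebra `𝔫` of `𝔱^(∞)` in internal degrees at least three. -/
abbrev TateResolution.n {k : Type u} [Field k] {t : Supertranslation k}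
    (T : TateResolution.{u, v} t) : LInf.{u, v} k := T.toLInf.trunc 3

end

noncomputable section

/-! ### Koszul signs -/

/-! The argument has two halves. The first compares the multiplet with the cohomology of `𝔫` and
concludes that every class of negative internal degree in `H(𝔫)` has a linear representative. The
second shows that a minimal `L_∞` algebra with this property is a free Lie algebra.

Comparison. Let `E` be the functions on superspace with values in the cochains of `𝔱^(∞)`, with the
total differential `totD` that combines `d` with the action of `𝔱` on superspace. It maps to both
sides. Applying the augmentation to `S` gives `toA : E → A(S)`; since the Tate construction is a
resolution of `S` (`TateResolution.exists_d_eq`), a perturbation argument makes the kernel of `toA`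
acyclic (`exists_totD_eq_of_toA_eq_zero`). Evaluating at the origin and killing `λ` and `v` gives
`toN : E → C(𝔫)`. The homotopy `θ ∂/∂λ + x ∂/∂v` has a Laplacian that counts the letters `θ`, `x`,
`λ`, `v`, up to terms raising the weight in `θ` and `x`; it is invertible where some such letter is
present, so cocycles of `𝔫` lift to `E` (`exists_lift`). The resulting correspondence yields `dim
H(𝔫) ≤ dim M` in each bidegree with `q < 0` (`finrank_H_le`). As `M ≅ H^(1)(𝔫) ⊆ H(𝔫)` and the
components are finite-dimensional, `H^(1) = H` there (`H1_eq_top`).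

Minimality of `𝔫`. Since `𝔫` starts in internal degree three, the hypothesis forces `M` to vanish in
bidegree `(0, -2)`. A linear relation between the quadrics would make a linear function of `x`
closed, so the quadrics are independent (`linearIndependent_quadric`). Then the generators of stage
at least two are exactly those of internal degree at least three, and minimality of the Tate
resolution says that the differential of `𝔫` has no linear part (`isMinimal_n`). A decomposable
cocycle now has a linear representative which is itself decomposable, hence zero: decomposable
cocycles are exact (`IsMinimal.decomposableExact`).

Straightening. Let `d₂` be the quadratic part of the differential. Coordinates `y` with `d y i =
y^*(d₂ x i)` are built by recursion on internal degree. The obstruction at each step is a cocycle of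
length at least three, and it must be the differential of something decomposable, so that the change
of coordinates is unipotent. This is `exists_decomposable_primitive`: pass to the exact one-form of
the cocycle, solve for one-forms coefficient by coefficient, and contract the solution with the
Euler vector field. So `𝔫` is isomorphic to a strict Lie algebra (`exists_quadratic`).

Freeness. For a quadratic differential, the linear cocycles are dual to the quotient of the Lie
algebra by brackets, and exactness of quadratic cocycles says that the only linear relations between
brackets are those that antisymmetry and the Jacobi identity impose. Hence a map prescribed on
generators extends, one internal degree at a time, to a unique homomorphism
(`IsPartialHom.exists_succ`, `IsPartialHom.eqOn`, `IsQuadratic.isFreeOn`). The space of generators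
is identified with the shifted dual of `M` through the linear cocycles. -/

theorem ksign_eq (k : Type u) [Field k] (n : ℤ) : ksign k n = if Even n then 1 else -1 := by
  unfold ksign
  split_ifs with h
  · rw [Int.negOnePow_even n h]; simp
  · rw [Int.negOnePow_odd n (Int.not_even_iff_odd.1 h)]; simp

theorem ksign_add (k : Type u) [Field k] (m n : ℤ) : ksign k (m + n) = ksign k m * ksign k n := by
  unfold ksign
  rw [Int.negOnePow_add]
  push_cast
  rfl

theorem ksign_zero (k : Type u) [Field k] : ksign k 0 = 1 := by simp [ksign_eq]

theorem ksign_mul_self (k : Type u) [Field k] (n : ℤ) : ksign k n * ksign k n = 1 := by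
  rw [ksign_eq]; split_ifs <;> simp

theorem ksign_ne_zero (k : Type u) [Field k] (n : ℤ) : ksign k n ≠ 0 := by
  rw [ksign_eq]; split_ifs <;> simp

theorem ksign_congr (k : Type u) [Field k] {m n : ℤ} (h : Even (m - n)) : ksign k m = ksign k n := by
  rw [ksign_eq, ksign_eq]
  have : Even m ↔ Even n := by rw [Int.even_sub] at h; exact h
  simp [this]

namespace Cochain

variable {k : Type u} [Field k] {B : BiBasis.{v}}

/-! ### Words and projections -/

theorem word_append (l l' : List B.ι) : word k B (l ++ l') = word k B l * word k B l' := by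
  simp [word]

theorem word_nil : word k B [] = 1 := by simp [word]

theorem word_singleton (i : B.ι) : word k B [i] = x k B i := by simp [word]

theorem ext_word {N : Type w} [AddCommGroup N] [Module k N] {f g : Cochain k B →ₗ[k] N}
    (h : ∀ l, f (word k B l) = g (word k B l)) : f = g :=
  LinearMap.ext_on_range (v := word k B) span_words h

/-- The algebra homomorphism multiplying every generator by itself as a formal exponent. -/
def multidegree : Cochain k B →ₐ[k] AddMonoidAlgebra (Cochain k B) (Multiset B.ι) :=
  lift (fun i => AddMonoidAlgebra.single {i} (x k B i)) (by
    intro i j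
    rw [AddMonoidAlgebra.single_mul_single, AddMonoidAlgebra.single_mul_single, x_comm i j,
      AddMonoidAlgebra.smul_single, add_comm])

/-- Words span the cochains but are not a basis: reordering letters changes signs, and a repeated
odd letter gives zero. The grading by the multiset of letters is compatible with the relations, and
it makes the projections `cproj` well defined; all later comparisons of coefficients go through
them. -/
theorem multidegree_word (l : List B.ι) :
    multidegree (word k B l) = AddMonoidAlgebra.single (l : Multiset B.ι) (word k B l) := by
  induction l with
  | nil => rw [word_nil, map_one]; rfl
  | cons i l ih =>
    rw [word_cons, map_mul, ih, multidegree, lift_x, AddMonoidAlgebra.single_mul_single]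
    rfl

open Classical in
/-- The projection to the span of the words with letters in `S`. -/
def cproj (S : Set (Multiset B.ι)) : Cochain k B →ₗ[k] Cochain k B :=
  (Finsupp.lsum k fun m => if m ∈ S then LinearMap.id else 0) ∘ₗ
    (AddMonoidAlgebra.coeffLinearEquiv k).toLinearMap ∘ₗ
    multidegree.toLinearMap

open Classical in
theorem cproj_word (S : Set (Multiset B.ι)) (l : List B.ι) :
    cproj S (word k B l) = if (l : Multiset B.ι) ∈ S then word k B l else 0 := by
  simp only [cproj, LinearMap.comp_apply, AlgHom.toLinearMap_apply, multidegree_word]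
  simp only [LinearEquiv.coe_coe, AddMonoidAlgebra.coeffLinearEquiv_apply,
    AddMonoidAlgebra.coeff_single, Finsupp.lsum_single]
  split_ifs <;> rfl

/-- The span of the words with letters in `S`. -/
def cspan (k : Type u) [Field k] {B : BiBasis.{v}} (S : Set (Multiset B.ι)) :
    Submodule k (Cochain k B) :=
  Submodule.span k {y | ∃ l : List B.ι, (l : Multiset B.ι) ∈ S ∧ y = word k B l}

theorem word_mem_cspan {S : Set (Multiset B.ι)} {l : List B.ι} (h : (l : Multiset B.ι) ∈ S) :
    word k B l ∈ cspan k S := Submodule.subset_span ⟨l, h, rfl⟩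

theorem cspan_le {S : Set (Multiset B.ι)} {N : Submodule k (Cochain k B)} :
    cspan k S ≤ N ↔ ∀ l : List B.ι, (l : Multiset B.ι) ∈ S → word k B l ∈ N := by
  refine ⟨fun h l hl => h (word_mem_cspan hl), fun h => Submodule.span_le.2 ?_⟩
  rintro _ ⟨l, hl, rfl⟩
  exact h l hl

theorem cspan_mono {S T : Set (Multiset B.ι)} (h : S ⊆ T) : cspan k S ≤ cspan k T :=
  cspan_le.2 fun _ hl => word_mem_cspan (h hl)

theorem mem_comap_of_word {N : Type w} [AddCommGroup N] [Module k N] {S : Set (Multiset B.ι)}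
    (f : Cochain k B →ₗ[k] N) (N' : Submodule k N)
    (h : ∀ l : List B.ι, (l : Multiset B.ι) ∈ S → f (word k B l) ∈ N') :
    ∀ a ∈ cspan k S, f a ∈ N' :=
  fun _ ha => (cspan_le (N := N'.comap f)).2 h ha

theorem eqOn_cspan {N : Type w} [AddCommGroup N] [Module k N] {S : Set (Multiset B.ι)}
    {f g : Cochain k B →ₗ[k] N}
    (h : ∀ l : List B.ι, (l : Multiset B.ι) ∈ S → f (word k B l) = g (word k B l)) :
    ∀ a ∈ cspan k S, f a = g a := by
  intro a ha
  have := mem_comap_of_word (f - g) ⊥ (fun l hl => by simp [h l hl]) a ha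
  simpa [sub_eq_zero] using this

theorem cspan_univ : cspan k (Set.univ : Set (Multiset B.ι)) = ⊤ := by
  rw [eq_top_iff, ← span_words, Submodule.span_le]
  rintro _ ⟨l, rfl⟩
  exact word_mem_cspan trivial

theorem cspan_empty : cspan k (∅ : Set (Multiset B.ι)) = ⊥ :=
  le_bot_iff.1 (cspan_le.2 fun _ hl => hl.elim)

theorem cproj_mem (S : Set (Multiset B.ι)) (a : Cochain k B) : cproj S a ∈ cspan k S := by
  refine mem_comap_of_word (S := Set.univ) (cproj S) _ (fun l _ => ?_) a (by rw [cspan_univ]; trivial)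
  rw [cproj_word]
  split_ifs with h
  · exact word_mem_cspan h
  · exact Submodule.zero_mem _

theorem cproj_of_mem {S : Set (Multiset B.ι)} {a : Cochain k B} (h : a ∈ cspan k S) :
    cproj S a = a :=
  eqOn_cspan (g := LinearMap.id) (fun l hl => by rw [cproj_word, if_pos hl]; rfl) a h

theorem cproj_cproj (S T : Set (Multiset B.ι)) (a : Cochain k B) :
    cproj S (cproj T a) = cproj (S ∩ T) a := by
  classical
  refine LinearMap.congr_fun (f := cproj S ∘ₗ cproj T) (ext_word fun l => ?_) a
  simp only [LinearMap.comp_apply, cproj_word, Set.mem_inter_iff]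
  split_ifs <;> simp_all [cproj_word]

theorem cproj_add_compl (S : Set (Multiset B.ι)) (a : Cochain k B) :
    cproj S a + cproj Sᶜ a = a := by
  classical
  refine LinearMap.congr_fun (f := cproj S + cproj Sᶜ) (g := LinearMap.id) (ext_word fun l => ?_) a
  simp only [LinearMap.add_apply, cproj_word, Set.mem_compl_iff, LinearMap.id_apply]
  split_ifs <;> simp

theorem cproj_empty (a : Cochain k B) : cproj (∅ : Set (Multiset B.ι)) a = 0 := by
  simpa [cspan_empty] using cproj_mem ∅ a

theorem cproj_eq_zero {S T : Set (Multiset B.ι)} (h : Disjoint S T) {a : Cochain k B}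
    (ha : a ∈ cspan k T) : cproj S a = 0 := by
  rw [← cproj_of_mem ha, cproj_cproj, h.inter_eq, cproj_empty]

/-- The form in which degree arguments are used: an element lying in two incompatible multidegrees
is killed by a projection that also fixes it. -/
theorem eq_zero_of_mem_disjoint {S T : Set (Multiset B.ι)} (h : Disjoint S T) {a : Cochain k B}
    (ha : a ∈ cspan k S) (hb : a ∈ cspan k T) : a = 0 := by
  rw [← cproj_of_mem ha, cproj_eq_zero h hb]

theorem mem_cspan_inter {S T : Set (Multiset B.ι)} {a : Cochain k B}
    (ha : a ∈ cspan k S) (hb : a ∈ cspan k T) : a ∈ cspan k (S ∩ T) := by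
  rw [← cproj_of_mem ha, ← cproj_of_mem hb, cproj_cproj]
  exact cproj_mem _ _

theorem cproj_mem_of_mem {S T : Set (Multiset B.ι)} {a : Cochain k B}
    (ha : a ∈ cspan k T) : cproj S a ∈ cspan k T := by
  rw [← cproj_of_mem ha, cproj_cproj]
  exact cspan_mono Set.inter_subset_right (cproj_mem _ _)

theorem mul_mem_cspan {S T U : Set (Multiset B.ι)} (h : ∀ s ∈ S, ∀ t ∈ T, s + t ∈ U)
    {a b : Cochain k B} (ha : a ∈ cspan k S) (hb : b ∈ cspan k T) : a * b ∈ cspan k U := by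
  have := Submodule.mul_mem_mul ha hb
  rw [cspan, cspan, Submodule.span_mul_span] at this
  refine Submodule.span_mono ?_ this
  rintro _ ⟨_, ⟨l, hl, rfl⟩, _, ⟨l', hl', rfl⟩, rfl⟩
  exact ⟨l ++ l', by simpa using h _ hl _ hl', by simp [word_append]⟩

/-! ### Degrees -/

/-- The words of bidegree `(p, q)`. -/
def biSet (B : BiBasis.{v}) (p q : ℤ) : Set (Multiset B.ι) :=
  {s | (s.map fun i => 1 - B.coh i).sum = p ∧ (s.map fun i => -B.int i).sum = q}

/-- The words of internal degree `-n`. -/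
def intSet (B : BiBasis.{v}) (n : ℤ) : Set (Multiset B.ι) := {s | (s.map B.int).sum = n}

/-- The words of total degree `n`. -/
def totSet (B : BiBasis.{v}) (n : ℤ) : Set (Multiset B.ι) := {s | (s.map fun i => 1 - B.tot i).sum = n}

/-- The words of length at least `m`. -/
def lenSet (B : BiBasis.{v}) (m : ℕ) : Set (Multiset B.ι) := {s | m ≤ s.card}

/-- The words of length `m`. -/
def lenEq (B : BiBasis.{v}) (m : ℕ) : Set (Multiset B.ι) := {s | s.card = m}

theorem piece_eq (p q : ℤ) : piece k B p q = cspan k (biSet B p q) := by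
  unfold piece cspan biSet
  congr 1
  ext y
  simp only [Set.mem_ofPred_eq, Multiset.map_coe, Multiset.sum_coe, and_assoc]

theorem biSet_subset_totSet (p q : ℤ) : biSet B p q ⊆ totSet B (p + q) := by
  rintro s ⟨h1, h2⟩
  have : (fun i => 1 - B.tot i) = fun i => (1 - B.coh i) + -B.int i := by
    ext i; simp [BiBasis.tot]; ring
  simp only [totSet, Set.mem_ofPred_eq, this, Multiset.sum_map_add, h1, h2]

theorem biSet_subset_intSet (p q : ℤ) : biSet B p q ⊆ intSet B (-q) := by
  rintro s ⟨-, h2⟩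
  simp [intSet, ← h2]

theorem one_mem_totSet : (1 : Cochain k B) ∈ cspan k (totSet B 0) := by
  rw [← word_nil]; exact word_mem_cspan (by simp [totSet])

theorem x_mem_totSet (i : B.ι) : x k B i ∈ cspan k (totSet B (1 - B.tot i)) := by
  rw [← word_singleton]; exact word_mem_cspan (by simp [totSet])

theorem x_mem_biSet (i : B.ι) : x k B i ∈ cspan k (biSet B (1 - B.coh i) (- B.int i)) := by
  rw [← word_singleton]; exact word_mem_cspan (by simp [biSet])

theorem x_mem_intSet (i : B.ι) : x k B i ∈ cspan k (intSet B (B.int i)) := by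
  rw [← word_singleton]; exact word_mem_cspan (by simp [intSet])

theorem x_mem_lenSet (i : B.ι) : x k B i ∈ cspan k (lenSet B 1) := by
  rw [← word_singleton]; exact word_mem_cspan (by simp [lenSet])

theorem x_mem_lenEq (i : B.ι) : x k B i ∈ cspan k (lenEq B 1) := by
  rw [← word_singleton]; exact word_mem_cspan (by simp [lenEq])

theorem lenSet_anti {m n : ℕ} (h : m ≤ n) : cspan k (lenSet B n) ≤ cspan k (lenSet B m) :=
  cspan_mono fun _ hs => le_trans h hs

theorem mul_mem_totSet {m n : ℤ} {a b : Cochain k B} (ha : a ∈ cspan k (totSet B m))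
    (hb : b ∈ cspan k (totSet B n)) : a * b ∈ cspan k (totSet B (m + n)) :=
  mul_mem_cspan (fun s hs t ht => by simp only [totSet, Set.mem_ofPred_eq, Multiset.map_add, Multiset.sum_add] at *; omega) ha hb

theorem mul_mem_biSet {p q p' q' : ℤ} {a b : Cochain k B} (ha : a ∈ cspan k (biSet B p q))
    (hb : b ∈ cspan k (biSet B p' q')) : a * b ∈ cspan k (biSet B (p + p') (q + q')) :=
  mul_mem_cspan (fun s hs t ht => by simp only [biSet, Set.mem_ofPred_eq, Multiset.map_add, Multiset.sum_add] at *; omega) ha hb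

theorem mul_mem_intSet {m n : ℤ} {a b : Cochain k B} (ha : a ∈ cspan k (intSet B m))
    (hb : b ∈ cspan k (intSet B n)) : a * b ∈ cspan k (intSet B (m + n)) :=
  mul_mem_cspan (fun s hs t ht => by simp only [intSet, Set.mem_ofPred_eq, Multiset.map_add, Multiset.sum_add] at *; omega) ha hb

theorem mul_mem_lenSet {m n : ℕ} {a b : Cochain k B} (ha : a ∈ cspan k (lenSet B m))
    (hb : b ∈ cspan k (lenSet B n)) : a * b ∈ cspan k (lenSet B (m + n)) :=
  mul_mem_cspan (fun s hs t ht => by simp_all [lenSet]; omega) ha hb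

theorem mul_mem_lenEq {m n : ℕ} {a b : Cochain k B} (ha : a ∈ cspan k (lenEq B m))
    (hb : b ∈ cspan k (lenEq B n)) : a * b ∈ cspan k (lenEq B (m + n)) :=
  mul_mem_cspan (fun s hs t ht => by simp_all [lenEq]) ha hb

theorem x_mul_comm (i : B.ι) {n : ℤ} {a : Cochain k B} (ha : a ∈ cspan k (totSet B n)) :
    x k B i * a = ksign k ((1 - B.tot i) * n) • (a * x k B i) := by
  refine eqOn_cspan (f := LinearMap.mulLeft k (x k B i))
    (g := ksign k ((1 - B.tot i) * n) • LinearMap.mulRight k (x k B i)) (fun l hl => ?_) a ha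
  simp only [LinearMap.mulLeft_apply, LinearMap.smul_apply, LinearMap.mulRight_apply]
  simp only [totSet, Set.mem_ofPred_eq, Multiset.map_coe, Multiset.sum_coe] at hl
  clear ha
  induction l generalizing n with
  | nil => simp at hl; subst hl; simp [word_nil, ksign_zero]
  | cons j l ih =>
    simp only [List.map_cons, List.sum_cons] at hl
    have h2 := ih (n := n - (1 - B.tot j)) (by linarith)
    rw [word_cons, ← mul_assoc, x_comm i j, smul_mul_assoc, mul_assoc, h2, mul_smul_comm, smul_smul,
      mul_assoc]
    congr 1
    rw [← ksign_add]
    congr 1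
    ring

theorem graded_comm {m n : ℤ} {a b : Cochain k B} (ha : a ∈ cspan k (totSet B m))
    (hb : b ∈ cspan k (totSet B n)) : a * b = ksign k (m * n) • (b * a) := by
  refine eqOn_cspan (f := LinearMap.mulRight k b)
    (g := ksign k (m * n) • LinearMap.mulLeft k b) (fun l hl => ?_) a ha
  simp only [LinearMap.mulLeft_apply, LinearMap.smul_apply, LinearMap.mulRight_apply]
  simp only [totSet, Set.mem_ofPred_eq, Multiset.map_coe, Multiset.sum_coe] at hl
  clear ha
  induction l generalizing m with
  | nil => simp at hl; subst hl; simp [word_nil, ksign_zero]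
  | cons j l ih =>
    simp only [List.map_cons, List.sum_cons] at hl
    have h2 := ih (m := m - (1 - B.tot j)) (by linarith)
    rw [word_cons, mul_assoc, h2, mul_smul_comm, ← mul_assoc, x_mul_comm j hb, smul_mul_assoc,
      smul_smul, mul_assoc]
    congr 1
    rw [← ksign_add]
    congr 1
    ring

/-! ### Derivations -/

/-- The automorphism multiplying elements of total degree `n` by `(-1)^(g n)`. -/
def twist (g : ℤ) : Cochain k B →ₐ[k] Cochain k B :=
  lift (fun i => ksign k (g * (1 - B.tot i)) • x k B i) (by
    intro i j
    simp only [smul_mul_smul_comm, x_comm i j, smul_smul]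
    congr 1
    ring)

theorem twist_x (g : ℤ) (i : B.ι) :
    twist g (x k B i) = ksign k (g * (1 - B.tot i)) • x k B i := lift_x _ _ _

theorem twist_of_mem (g : ℤ) {n : ℤ} {a : Cochain k B} (ha : a ∈ cspan k (totSet B n)) :
    twist g a = ksign k (g * n) • a := by
  refine eqOn_cspan (f := (twist g).toLinearMap) (g := ksign k (g * n) • LinearMap.id)
    (fun l hl => ?_) a ha
  simp only [AlgHom.toLinearMap_apply, LinearMap.smul_apply, LinearMap.id_apply]
  simp only [totSet, Set.mem_ofPred_eq, Multiset.map_coe, Multiset.sum_coe] at hl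
  clear ha
  induction l generalizing n with
  | nil => simp at hl; subst hl; simp [word_nil, ksign_zero]
  | cons j l ih =>
    simp only [List.map_cons, List.sum_cons] at hl
    have h2 := ih (n := n - (1 - B.tot j)) (by linarith)
    rw [word_cons, map_mul, h2, twist_x, smul_mul_smul_comm]
    congr 1
    rw [← ksign_add]
    congr 1
    ring

/-- The algebra homomorphism `a ↦ !![twist a, D a; 0, a]` encoding a derivation `D`. -/
def derMatrix (g : ℤ) (f : B.ι → Cochain k B) (hf : ∀ i, f i ∈ cspan k (totSet B (1 - B.tot i + g))) :
    Cochain k B →ₐ[k] Matrix (Fin 2) (Fin 2) (Cochain k B) :=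
  lift (fun i => !![twist g (x k B i), f i; 0, x k B i]) (by
    intro i j
    have h1 : f i * x k B j = ksign k ((1 - B.tot i + g) * (1 - B.tot j)) • (x k B j * f i) :=
      graded_comm (hf i) (x_mem_totSet j)
    have h2 : x k B i * f j = ksign k ((1 - B.tot i) * (1 - B.tot j + g)) • (f j * x k B i) :=
      graded_comm (x_mem_totSet i) (hf j)
    rw [Matrix.mul_fin_two, Matrix.mul_fin_two, Matrix.smul_of]
    simp only [twist_x, zero_mul, mul_zero, add_zero, zero_add, Matrix.smul_cons,
      Matrix.smul_empty, smul_zero, smul_mul_assoc, mul_smul_comm, h1, h2, x_comm i j, smul_add,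
      smul_smul]
    -- The corner entry of the product is the Leibniz rule applied to `x i * x j`. The two summands
    -- for `(i, j)` are swapped with those for `(j, i)`, and `g (1 - tot i)` occurs twice, so it
    -- drops out modulo two.
    have e1 : ksign k (g * (1 - B.tot i)) * ksign k ((1 - B.tot i) * (1 - B.tot j + g)) =
        ksign k ((1 - B.tot i) * (1 - B.tot j)) := by
      rw [← ksign_add]; apply ksign_congr; ring_nf
      exact ⟨g - g * B.tot i, by ring⟩
    have e2 : ksign k ((1 - B.tot i + g) * (1 - B.tot j)) =
        ksign k ((1 - B.tot i) * (1 - B.tot j)) * ksign k (g * (1 - B.tot j)) := by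
      rw [← ksign_add]; congr 1; ring
    rw [e1, e2, add_comm]
    rw [mul_left_comm, ← mul_assoc (ksign k (g * (1 - B.tot i))),
      mul_comm (ksign k (g * (1 - B.tot i)) * _)])

/-- The derivation of degree `g` with given values on generators. -/
def der (g : ℤ) (f : B.ι → Cochain k B) (hf : ∀ i, f i ∈ cspan k (totSet B (1 - B.tot i + g))) :
    Cochain k B →ₗ[k] Cochain k B where
  toFun a := derMatrix g f hf a 0 1
  map_add' a b := by simp
  map_smul' r a := by simp

section der

variable {g : ℤ} {f : B.ι → Cochain k B} {hf : ∀ i, f i ∈ cspan k (totSet B (1 - B.tot i + g))}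

theorem derMatrix_aux (a : Cochain k B) : derMatrix g f hf a 0 0 = twist g a ∧
    derMatrix g f hf a 1 0 = 0 ∧ derMatrix g f hf a 1 1 = a := by
  have ha : a ∈ Submodule.span k (Set.range (word k B)) := by rw [span_words]; trivial
  induction ha using Submodule.span_induction with
  | mem a h =>
    obtain ⟨l, rfl⟩ := h
    induction l with
    | nil => simp [word_nil]
    | cons i l ih =>
      obtain ⟨h1, h2, h3⟩ := ih
      rw [word_cons, map_mul, show derMatrix g f hf (x k B i) = _ from lift_x _ _ _]
      simp [Matrix.mul_apply, Fin.sum_univ_two, h1, h2, h3]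
  | zero => simp
  | add a b _ _ ha hb => simp [ha, hb]
  | smul r a _ ha => simp [ha]

theorem der_x (i : B.ι) : der g f hf (x k B i) = f i := by
  simp [der, derMatrix, lift_x]

theorem der_mul' (a b : Cochain k B) :
    der g f hf (a * b) = der g f hf a * b + twist g a * der g f hf b := by
  simp [der, Matrix.mul_apply, Fin.sum_univ_two, derMatrix_aux, add_comm]

theorem der_mul {n : ℤ} {a : Cochain k B} (ha : a ∈ cspan k (totSet B n)) (b : Cochain k B) :
    der g f hf (a * b) = der g f hf a * b + ksign k (g * n) • (a * der g f hf b) := by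
  rw [der_mul', twist_of_mem g ha, smul_mul_assoc]

theorem der_one : der g f hf 1 = 0 := by
  simp [der]

end der

open Classical in
/-- The derivation `∂/∂x^j`. -/
def pd (j : B.ι) : Cochain k B →ₗ[k] Cochain k B :=
  der (B.tot j - 1) (fun i => if i = j then 1 else 0) (by
    intro i
    split_ifs with h
    · subst h
      convert one_mem_totSet (k := k) using 3
      ring
    · exact Submodule.zero_mem _)

open Classical in
theorem pd_x (i j : B.ι) : pd j (x k B i) = if i = j then 1 else 0 := der_x i

theorem pd_one (j : B.ι) : pd j (1 : Cochain k B) = 0 := der_one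

theorem pd_mul (j : B.ι) {n : ℤ} {a : Cochain k B} (ha : a ∈ cspan k (totSet B n))
    (b : Cochain k B) :
    pd j (a * b) = pd j a * b + ksign k ((B.tot j - 1) * n) • (a * pd j b) := der_mul ha b

open Classical in
theorem pd_x_mul (i j : B.ι) (b : Cochain k B) : pd j (x k B i * b) =
    (if i = j then b else 0) + ksign k ((B.tot j - 1) * (1 - B.tot i)) • (x k B i * pd j b) := by
  rw [pd_mul j (x_mem_totSet i), pd_x]
  split_ifs <;> simp

/-- `∂/∂x^j` removes one letter `j`. -/
theorem pd_mem {S T : Set (Multiset B.ι)} {j : B.ι} (h : ∀ s, j ::ₘ s ∈ S → s ∈ T) :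
    ∀ a ∈ cspan k S, pd j a ∈ cspan k T := by
  refine mem_comap_of_word (pd j) _ fun l hl => ?_
  replace h : ∀ s, j ::ₘ s = (l : Multiset B.ι) → s ∈ T := fun s hs => h s (hs ▸ hl)
  clear hl S
  induction l generalizing T with
  | nil => rw [word_nil, pd_one]; exact Submodule.zero_mem _
  | cons i l ih =>
    classical
    rw [word_cons, pd_x_mul]
    refine Submodule.add_mem _ ?_ (Submodule.smul_mem _ _ ?_)
    · split_ifs with hij
      · subst hij
        exact word_mem_cspan (h _ rfl)
      · exact Submodule.zero_mem _
    · have := ih (T := {s | i ::ₘ s ∈ T}) (fun s hs => h _ (by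
        rw [Multiset.cons_swap, hs]; rfl))
      rw [← word_singleton]
      refine mul_mem_cspan (S := {{i}}) (fun s hs t ht => ?_) (word_mem_cspan rfl) this
      rw [Set.mem_singleton_iff.1 hs]; exact ht

theorem pd_mem_totSet (j : B.ι) {n : ℤ} {a : Cochain k B} (ha : a ∈ cspan k (totSet B n)) :
    pd j a ∈ cspan k (totSet B (n + (B.tot j - 1))) :=
  pd_mem (fun s hs => by simp [totSet] at hs ⊢; linarith) a ha

theorem pd_eq_zero {S : Set (Multiset B.ι)} {j : B.ι} (h : ∀ s, j ::ₘ s ∉ S) {a : Cochain k B}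
    (ha : a ∈ cspan k S) : pd j a = 0 := by
  have := pd_mem (T := ∅) (fun s hs => h s hs) a ha
  simpa [cspan_empty] using this

/-- Euler's identity, for words with letters of nonzero weight in the finite set `s`. -/
theorem euler_word (s : Finset B.ι) (c : B.ι → k) (l : List B.ι) (hl : ∀ i ∈ l, i ∈ s ∨ c i = 0) :
    ∑ j ∈ s, c j • (x k B j * pd j (word k B l)) = (l.map c).sum • word k B l := by
  classical
  induction l with
  | nil => simp [word_nil, pd_one]
  | cons i l ih =>
    have hi := hl i (by simp)
    have ih := ih fun j hj => hl j (by simp [hj])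
    simp only [word_cons, pd_x_mul, mul_add, smul_add, Finset.sum_add_distrib]
    -- The sign from moving `∂/∂x^j` past `x i` cancels the one from moving `x j` past `x i`, so
    -- `x^j ∂/∂x^j` is an even derivation.
    have e1 : ∀ j, x k B j * ksign k ((B.tot j - 1) * (1 - B.tot i)) • (x k B i * pd j (word k B l)) =
        x k B i * (x k B j * pd j (word k B l)) := by
      intro j
      rw [mul_smul_comm, ← mul_assoc, x_comm j i, smul_mul_assoc, smul_smul, mul_assoc]
      have : ksign k ((B.tot j - 1) * (1 - B.tot i)) * ksign k ((1 - B.tot j) * (1 - B.tot i)) = 1 := by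
        rw [← ksign_add]
        have : (B.tot j - 1) * (1 - B.tot i) + (1 - B.tot j) * (1 - B.tot i) = 0 := by ring
        rw [this, ksign_zero]
      rw [this, one_smul]
    simp only [e1]
    have e2 : ∑ j ∈ s, c j • (x k B i * (x k B j * pd j (word k B l))) =
        x k B i * ∑ j ∈ s, c j • (x k B j * pd j (word k B l)) := by
      rw [Finset.mul_sum]
      simp only [mul_smul_comm]
    rw [e2, ih]
    simp only [mul_ite, mul_zero, smul_ite, smul_zero, Finset.sum_ite_eq, List.map_cons,
      List.sum_cons, add_smul, mul_smul_comm]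
    congr 1
    split_ifs with h
    · rfl
    · rw [hi.resolve_left h, zero_smul]

/-! ### Coefficients -/

/-- The augmentation. -/
def aug : Cochain k B →ₐ[k] k := lift (fun _ => 0) (by simp)

theorem aug_x (i : B.ι) : aug (x k B i) = 0 := lift_x _ _ _

theorem aug_word_cons (i : B.ι) (l : List B.ι) : aug (word k B (i :: l)) = 0 := by
  rw [word_cons, map_mul, aug_x, zero_mul]

/-- The coefficient of `x j`. -/
def coef (j : B.ι) : Cochain k B →ₗ[k] k := aug.toLinearMap ∘ₗ pd j

open Classical in
theorem coef_x (i j : B.ι) : coef j (x k B i) = if i = j then 1 else 0 := by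
  simp only [coef, LinearMap.comp_apply, AlgHom.toLinearMap_apply, pd_x]
  split_ifs <;> simp

theorem aug_of_mem {S : Set (Multiset B.ι)} (hS : 0 ∉ S) : ∀ a ∈ cspan k S, aug a = 0 := by
  intro a ha
  refine eqOn_cspan (f := (aug (k := k) (B := B)).toLinearMap) (g := 0) (fun l hl => ?_) a ha
  cases l with
  | nil => exact (hS hl).elim
  | cons i l => exact aug_word_cons i l

theorem coef_of_mem {S : Set (Multiset B.ι)} {j : B.ι} (hS : {j} ∉ S) :
    ∀ a ∈ cspan k S, coef j a = 0 := by
  intro a ha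
  exact aug_of_mem (S := {s | j ::ₘ s ∈ S}) hS _ (pd_mem (fun s hs => hs) a ha)

theorem pd_mem_intSet {n : ℤ} (j : B.ι) {a : Cochain k B} (ha : a ∈ cspan k (intSet B n)) :
    pd j a ∈ cspan k (intSet B (n - B.int j)) :=
  pd_mem (fun s hs => by simp [intSet] at hs ⊢; linarith) a ha

theorem pd_mem_lenSet {m : ℕ} (j : B.ι) {a : Cochain k B} (ha : a ∈ cspan k (lenSet B (m + 1))) :
    pd j a ∈ cspan k (lenSet B m) :=
  pd_mem (fun s hs => by simpa [lenSet] using hs) a ha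

theorem linear_eq : linear k B = cspan k (lenEq B 1) := by
  apply le_antisymm
  · rw [linear, Submodule.span_le]
    rintro _ ⟨i, rfl⟩
    rw [← word_singleton]
    exact word_mem_cspan (by simp [lenEq])
  · rw [cspan_le]
    intro l hl
    obtain ⟨i, rfl⟩ := List.length_eq_one_iff.1 (by simpa [lenEq] using hl)
    rw [word_singleton]
    exact Submodule.subset_span ⟨i, rfl⟩

/-- Only words of length zero and one stand in the way: `0 ∉ S` excludes constants, and the
coefficients `coef j` detect the linear part completely. -/
theorem mem_lenSet_two {S : Set (Multiset B.ι)} (hS : 0 ∉ S) {a : Cochain k B} (ha : a ∈ cspan k S)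
    (h : ∀ j, coef j a = 0) : a ∈ cspan k (lenSet B 2) := by
  suffices h1 : cproj (lenEq B 1) a = 0 by
    have h2 := cproj_add_compl (lenEq B 1) a
    rw [h1, zero_add] at h2
    have h3 := mem_cspan_inter ha (h2 ▸ cproj_mem (k := k) (lenEq B 1)ᶜ a)
    refine cspan_mono ?_ h3
    rintro s ⟨hs, hs'⟩
    have : s ≠ 0 := by rintro rfl; exact hS hs
    have := Multiset.card_pos.2 this
    simp only [lenEq, Set.mem_compl_iff, Set.mem_ofPred_eq] at hs'
    simp only [lenSet, Set.mem_ofPred_eq]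
    omega
  have h1 : ∀ j, coef j (cproj (lenEq B 1) a) = 0 := by
    intro j
    have e := cproj_add_compl (lenEq B 1) a
    have e' := congrArg (coef j) e
    rw [map_add, h j, coef_of_mem (S := (lenEq B 1)ᶜ) (by simp [lenEq]) _ (cproj_mem _ _), add_zero]
      at e'
    exact e'
  have h2 := cproj_mem (k := k) (lenEq B 1) a
  generalize cproj (lenEq B 1) a = b at h1 h2
  rw [← linear_eq, linear, Finsupp.mem_span_range_iff_exists_finsupp] at h2
  obtain ⟨c, rfl⟩ := h2
  have : c = 0 := by
    classical
    ext j
    have := h1 j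
    rw [Finsupp.sum, map_sum] at this
    simpa [coef_x] using this
  simp [this]

end Cochain

/-! ### Cohomology of L-infinity algebras -/

namespace LInf

open Cochain

variable {k : Type u} [Field k] (A : LInf.{u, v} k)

/-! ### Generalities on the differential -/

theorem d_mem_biSet {p q : ℤ} {a : Cochain k A.toBiBasis} (ha : a ∈ cspan k (biSet A.toBiBasis p q)) :
    A.d a ∈ cspan k (biSet A.toBiBasis (p + 1) q) := by
  rw [← piece_eq] at *
  exact A.d_piece p q a ha

theorem word_mem_biSet (l : List A.ι) : word k A.toBiBasis l ∈ cspan k (biSet A.toBiBasis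
    (((l : Multiset A.ι).map fun i => 1 - A.coh i).sum)
    (((l : Multiset A.ι).map fun i => - A.int i).sum)) := word_mem_cspan ⟨rfl, rfl⟩

theorem d_mem_totSet {n : ℤ} {a : Cochain k A.toBiBasis} (ha : a ∈ cspan k (totSet A.toBiBasis n)) :
    A.d a ∈ cspan k (totSet A.toBiBasis (n + 1)) := by
  refine mem_comap_of_word A.d _ (fun l hl => ?_) a ha
  refine cspan_mono ?_ (A.d_mem_biSet (A.word_mem_biSet l))
  convert! biSet_subset_totSet _ _ using 2
  have h2 := biSet_subset_totSet (B := A.toBiBasis) _ _ (show (l : Multiset A.ι) ∈ biSet _ _ _ from ⟨rfl, rfl⟩)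
  simp only [totSet, Set.mem_ofPred_eq] at hl h2
  rw [← hl, h2]
  ring

theorem d_mem_intSet {n : ℤ} {a : Cochain k A.toBiBasis} (ha : a ∈ cspan k (intSet A.toBiBasis n)) :
    A.d a ∈ cspan k (intSet A.toBiBasis n) := by
  refine mem_comap_of_word A.d _ (fun l hl => ?_) a ha
  refine cspan_mono ?_ (A.d_mem_biSet (A.word_mem_biSet l))
  convert! biSet_subset_intSet _ _ using 2
  have h2 := biSet_subset_intSet (B := A.toBiBasis) _ _ (show (l : Multiset A.ι) ∈ biSet _ _ _ from ⟨rfl, rfl⟩)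
  simp only [intSet, Set.mem_ofPred_eq] at hl h2
  rw [← hl, h2]

/-- The Leibniz sign depends on the total degree alone, so homogeneity in total degree suffices and
the bidegree need not be fixed. -/
theorem d_mul_of_mem {n : ℤ} {a : Cochain k A.toBiBasis} (ha : a ∈ cspan k (totSet A.toBiBasis n))
    (b : Cochain k A.toBiBasis) : A.d (a * b) = A.d a * b + ksign k n • (a * A.d b) := by
  refine eqOn_cspan (f := A.d ∘ₗ LinearMap.mulRight k b)
    (g := LinearMap.mulRight k b ∘ₗ A.d + ksign k n • LinearMap.mulRight k (A.d b))
    (fun l hl => ?_) a ha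
  have h := A.word_mem_biSet l
  have h2 := biSet_subset_totSet (B := A.toBiBasis) _ _ (show (l : Multiset A.ι) ∈ biSet _ _ _ from ⟨rfl, rfl⟩)
  simp only [totSet, Set.mem_ofPred_eq] at hl h2
  rw [← piece_eq] at h
  have := A.d_mul _ _ _ h b
  rw [← h2, hl] at this
  simpa using this

theorem d_x_mul (i : A.ι) (b : Cochain k A.toBiBasis) :
    A.d (A.x i * b) = A.d (A.x i) * b + ksign k (1 - A.tot i) • (A.x i * A.d b) :=
  A.d_mul_of_mem (x_mem_totSet i) b

/-- Serves to replace a primitive of a bihomogeneous cocycle by a bihomogeneous one. -/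
theorem d_cproj_biSet (p q : ℤ) (a : Cochain k A.toBiBasis) :
    A.d (cproj (biSet A.toBiBasis p q) a) = cproj (biSet A.toBiBasis (p + 1) q) (A.d a) := by
  classical
  refine LinearMap.congr_fun (f := A.d ∘ₗ cproj _) (g := cproj _ ∘ₗ A.d) (ext_word fun l => ?_) a
  simp only [LinearMap.comp_apply, cproj_word]
  have h := A.d_mem_biSet (A.word_mem_biSet l)
  split_ifs with hl
  · rw [cproj_of_mem]
    exact A.d_mem_biSet (word_mem_cspan hl)
  · rw [map_zero, cproj_eq_zero _ h]
    rw [Set.disjoint_left]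
    rintro s ⟨h1, h2⟩ ⟨h3, h4⟩
    apply hl
    constructor
    · linarith
    · linarith

theorem d_cproj_intSet (n : ℤ) (a : Cochain k A.toBiBasis) :
    A.d (cproj (intSet A.toBiBasis n) a) = cproj (intSet A.toBiBasis n) (A.d a) := by
  classical
  refine LinearMap.congr_fun (f := A.d ∘ₗ cproj _) (g := cproj _ ∘ₗ A.d) (ext_word fun l => ?_) a
  simp only [LinearMap.comp_apply, cproj_word]
  have h := A.d_mem_intSet (word_mem_cspan (k := k)
    (show (l : Multiset A.ι) ∈ intSet A.toBiBasis _ from rfl))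
  split_ifs with hl
  · rw [cproj_of_mem]
    exact A.d_mem_intSet (word_mem_cspan hl)
  · rw [map_zero, cproj_eq_zero _ h]
    rw [Set.disjoint_left]
    intro s h1 h2
    apply hl
    simp only [intSet, Set.mem_ofPred_eq] at *
    linarith

theorem sum_int_nonneg (s : Multiset A.ι) : 0 ≤ (s.map A.int).sum :=
  Multiset.sum_nonneg fun n hn => by
    obtain ⟨i, -, rfl⟩ := Multiset.mem_map.1 hn
    exact (A.int_pos i).le

theorem card_le_sum_int (s : Multiset A.ι) : (s.card : ℤ) ≤ (s.map A.int).sum := by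
  induction s using Multiset.induction_on with
  | empty => simp
  | cons i s ih =>
    have := A.int_pos i
    simp only [Multiset.card_cons, Multiset.map_cons, Multiset.sum_cons]
    push_cast
    linarith

theorem int_le_of_mem {s : Multiset A.ι} {i : A.ι} (hi : i ∈ s) : A.int i ≤ (s.map A.int).sum := by
  obtain ⟨t, rfl⟩ := Multiset.exists_cons_of_mem hi
  have := A.sum_int_nonneg t
  simp only [Multiset.map_cons, Multiset.sum_cons]
  linarith

theorem intSet_subset_lenSet {n : ℤ} (hn : n ≠ 0) : intSet A.toBiBasis n ⊆ lenSet A.toBiBasis 1 := by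
  intro s hs
  simp only [intSet, lenSet, Set.mem_ofPred_eq] at *
  rw [Nat.one_le_iff_ne_zero]
  intro h
  rw [Multiset.card_eq_zero.1 h] at hs
  simp at hs
  omega

/-- All internal degrees of generators are positive, so a nonempty word has positive weight. -/
theorem eq_zero_of_int_nonpos {n : ℤ} (hn : n ≤ 0) {a : Cochain k A.toBiBasis}
    (ha : a ∈ cspan k (intSet A.toBiBasis n)) (hb : a ∈ cspan k (lenSet A.toBiBasis 1)) : a = 0 := by
  refine eq_zero_of_mem_disjoint (Set.disjoint_left.2 fun s h1 h2 => ?_) ha hb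
  have := A.card_le_sum_int s
  simp only [intSet, lenSet, Set.mem_ofPred_eq] at *
  omega

theorem finite_intSet_words (n : ℤ) : {l : List A.ι | (l : Multiset A.ι) ∈ intSet A.toBiBasis n}.Finite := by
  have : Finite {i : A.ι // A.int i ≤ n} := A.finite_le n
  refine ((List.finite_length_le {i : A.ι // A.int i ≤ n} n.toNat).image
    (List.map Subtype.val)).subset ?_
  intro l hl
  have hl' : ((l : Multiset A.ι).map A.int).sum = n := hl
  have h : ∀ i ∈ l, A.int i ≤ n := fun i hi => hl' ▸ A.int_le_of_mem (Multiset.mem_coe.2 hi)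
  refine ⟨l.attach.map fun i => ⟨i.1, h i.1 i.2⟩, ?_, ?_⟩
  · have := A.card_le_sum_int l
    rw [hl'] at this
    simp only [Set.mem_ofPred_eq, List.length_map, List.length_attach]
    simp only [Multiset.coe_card] at this
    omega
  · rw [List.map_map]
    exact List.attach_map_subtype_val l

/-- A word of internal degree `n` has at most `n` letters, all taken from the finitely many
generators of internal degree at most `n`. -/
theorem finite_intSet (n : ℤ) : Module.Finite k (cspan k (intSet A.toBiBasis n)) := by
  refine Module.Finite.span_of_finite k (((A.finite_intSet_words n).image
    (word k A.toBiBasis)).subset ?_)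
  rintro _ ⟨l, hl, rfl⟩
  exact ⟨l, hl, rfl⟩

instance finite_piece (p q : ℤ) : Module.Finite k (piece k A.toBiBasis p q) := by
  have := A.finite_intSet (-q)
  rw [piece_eq]
  exact Submodule.finiteDimensional_of_le (cspan_mono (biSet_subset_intSet p q))

/-! ### Minimal differentials and differential forms -/

/-- The differential has no linear part. -/
def IsMinimal : Prop := ∀ i, A.d (A.x i) ∈ cspan k (lenSet A.toBiBasis 2)

/-- Decomposable cocycles are coboundaries. -/
def DecomposableExact : Prop :=
  ∀ c ∈ cspan k (lenSet A.toBiBasis 2), A.d c = 0 → ∃ w, A.d w = c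

variable {A}

theorem IsMinimal.d_mem (h : A.IsMinimal) {m : ℕ} {a : Cochain k A.toBiBasis}
    (ha : a ∈ cspan k (lenSet A.toBiBasis m)) :
    A.d a ∈ cspan k (lenSet A.toBiBasis (m + 1)) := by
  refine mem_comap_of_word A.d _ (fun l hl => ?_) a ha
  suffices hs : A.d (word k A.toBiBasis l) ∈ cspan k (lenSet A.toBiBasis (l.length + 1)) by
    refine cspan_mono (fun s hs => ?_) hs
    simp only [lenSet, Set.mem_ofPred_eq, Multiset.coe_card] at *
    omega
  clear hl ha
  induction l with
  | nil => rw [word_nil, A.d_one]; exact Submodule.zero_mem _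
  | cons i l ih =>
    rw [word_cons, d_x_mul]
    refine Submodule.add_mem _ ?_ (Submodule.smul_mem _ _ ?_)
    · have := mul_mem_lenSet (h i) (word_mem_cspan (k := k)
        (show (l : Multiset A.ι) ∈ lenSet A.toBiBasis l.length by simp [lenSet]))
      convert this using 3
      simp only [List.length_cons]; ring
    · have h1 := word_mem_cspan (k := k) (show (([i] : List A.ι) : Multiset A.ι) ∈ lenSet A.toBiBasis 1 by
        simp [lenSet])
      rw [word_singleton] at h1
      have := mul_mem_lenSet h1 ih
      convert this using 3
      simp only [List.length_cons]; ring

/-- The commutator of `∂/∂x^j` and the differential. -/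
theorem pd_d (s : Finset A.ι) (j : A.ι) (l : List A.ι) (hl : ∀ i ∈ l, i ∈ s) :
    pd j (A.d (word k A.toBiBasis l)) =
      ∑ i ∈ s, pd j (A.d (A.x i)) * pd i (word k A.toBiBasis l) +
        ksign k (1 - A.tot j) • A.d (pd j (word k A.toBiBasis l)) := by
  classical
  induction l with
  | nil => simp [word_nil, pd_one, A.d_one]
  | cons i l ih =>
    have hi := hl i (by simp)
    have ih := ih fun j hj => hl j (by simp [hj])
    have hdx : A.d (A.x i) ∈ cspan k (totSet A.toBiBasis (1 - A.tot i + 1)) :=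
      A.d_mem_totSet (x_mem_totSet i)
    rw [word_cons, d_x_mul, map_add, pd_mul j hdx, map_smul, pd_x_mul, ih]
    generalize hε : ksign k ((A.tot j - 1) * (1 - A.tot i + 1)) = ε
    simp only [pd_x_mul, mul_add, Finset.sum_add_distrib, map_add, map_smul, d_x_mul]
    have e1 : ∑ i' ∈ s, pd j (A.d (A.x i')) * (if i = i' then word k A.toBiBasis l else 0) =
        pd j (A.d (A.x i)) * word k A.toBiBasis l := by
      simp [hi]
    have e2 : ∀ i' ∈ s, pd j (A.d (A.x i')) * ksign k ((A.tot i' - 1) * (1 - A.tot i)) •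
        (A.x i * pd i' (word k A.toBiBasis l)) = ksign k ((1 - A.tot i) * A.tot j) •
          (A.x i * (pd j (A.d (A.x i')) * pd i' (word k A.toBiBasis l))) := by
      intro i' _
      have h1 := pd_mem_totSet j (A.d_mem_totSet (x_mem_totSet (k := k) (B := A.toBiBasis) i'))
      rw [mul_smul_comm, ← mul_assoc (A.x i), x_mul_comm i h1, smul_mul_assoc, smul_smul, mul_assoc]
      congr 1
      rw [← ksign_add]
      apply ksign_congr
      exact ⟨(1 - A.tot i) * (A.tot i' - 1 - A.tot j), by ring⟩
    rw [e1, Finset.sum_congr rfl e2, ← Finset.smul_sum, ← Finset.mul_sum]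
    have e3 : A.d (if i = j then word k A.toBiBasis l else 0) =
        if i = j then A.d (word k A.toBiBasis l) else 0 := by
      split_ifs <;> simp
    rw [e3]
    simp only [smul_add, smul_smul, mul_smul_comm, ← ksign_add]
    have s1 : ksign k (1 - A.tot j + (A.tot j - 1) * (1 - A.tot i)) =
        ε := by
      rw [← hε]; apply ksign_congr; exact ⟨1 - A.tot j, by ring⟩
    have s2 : ksign k (1 - A.tot j + ((A.tot j - 1) * (1 - A.tot i) + (1 - A.tot i))) =
        ksign k (1 - A.tot i + ((A.tot j - 1) * (1 - A.tot i) + (1 - A.tot j))) := by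
      congr 1; ring
    have s3 : ksign k (1 - A.tot i + (A.tot j - 1) * (1 - A.tot i)) =
        ksign k ((1 - A.tot i) * A.tot j) := by
      congr 1; ring
    have s4 : (ksign k (1 - A.tot i) • if i = j then A.d (word k A.toBiBasis l) else 0) =
        ksign k (1 - A.tot j) • if i = j then A.d (word k A.toBiBasis l) else 0 := by
      split_ifs with h
      · rw [h]
      · simp
    rw [s1, s2, s3, s4]
    abel

theorem pd_d_of_mem {n : ℤ} {s : Finset A.ι} (hs : ∀ i, A.int i ≤ n → i ∈ s) (j : A.ι)
    {c : Cochain k A.toBiBasis} (hc : c ∈ cspan k (intSet A.toBiBasis n)) :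
    pd j (A.d c) = ∑ i ∈ s, pd j (A.d (A.x i)) * pd i c + ksign k (1 - A.tot j) • A.d (pd j c) := by
  refine (eqOn_cspan (f := pd j ∘ₗ A.d) (g := ∑ i ∈ s, LinearMap.mulLeft k (pd j (A.d (A.x i))) ∘ₗ
    pd i + ksign k (1 - A.tot j) • A.d ∘ₗ pd j) (fun l hl => ?_) c hc).trans ?_
  · simp only [LinearMap.comp_apply, LinearMap.add_apply, LinearMap.sum_apply,
      LinearMap.mulLeft_apply, LinearMap.smul_apply]
    refine pd_d s j l fun i hi => hs i ?_
    rw [← show ((l : Multiset A.ι).map A.int).sum = n from hl]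
    exact A.int_le_of_mem (Multiset.mem_coe.2 hi)
  · simp

/-- The Lie derivative of the one-form `∑ dx^i ω i` along the differential. -/
def lieD (s : Finset A.ι) (ω : A.ι → Cochain k A.toBiBasis) (j : A.ι) : Cochain k A.toBiBasis :=
  ∑ i ∈ s, pd j (A.d (A.x i)) * ω i + ksign k (1 - A.tot j) • A.d (ω j)

theorem lieD_sub (s : Finset A.ι) (ω ω' : A.ι → Cochain k A.toBiBasis) :
    lieD s (ω - ω') = lieD s ω - lieD s ω' := by
  ext j
  simp only [lieD, Pi.sub_apply, mul_sub, Finset.sum_sub_distrib, map_sub, smul_sub]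
  abel

theorem lieD_add (s : Finset A.ι) (ω ω' : A.ι → Cochain k A.toBiBasis) :
    lieD s (ω + ω') = lieD s ω + lieD s ω' := by
  ext j
  simp only [lieD, Pi.add_apply, mul_add, Finset.sum_add_distrib, map_add, smul_add]
  abel

/-- The Lie derivative along an odd vector field of square zero squares to zero. In coordinates,
applying `∂/∂x^j` to `d (d x^l) = 0` turns the double sum into the negative of the term containing
`d (∂_j d x^l)`. The set `s` has to be closed under passing to smaller internal degree, so that it
contains every letter of each `d x^l` with `l ∈ s`. -/
theorem lieD_lieD {n : ℤ} {s : Finset A.ι} (hs : ∀ i, i ∈ s ↔ A.int i ≤ n)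
    (ω : A.ι → Cochain k A.toBiBasis) : lieD s (lieD s ω) = 0 := by
  ext j
  have h1 : ∀ i, A.d (pd j (A.d (A.x i)) * ω i) = A.d (pd j (A.d (A.x i))) * ω i +
      ksign k (1 - A.tot i + 1 + (A.tot j - 1)) • (pd j (A.d (A.x i)) * A.d (ω i)) := fun i =>
    A.d_mul_of_mem (pd_mem_totSet j (A.d_mem_totSet (x_mem_totSet i))) _
  have h2 : ∀ l ∈ s, ∑ i ∈ s, pd j (A.d (A.x i)) * (pd i (A.d (A.x l)) * ω l) =
      -(ksign k (1 - A.tot j) • (A.d (pd j (A.d (A.x l))) * ω l)) := by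
    intro l hl
    have h4 : A.d (A.x l) ∈ cspan k (intSet A.toBiBasis (A.int l)) :=
      A.d_mem_intSet (x_mem_intSet _)
    have h5 := pd_d_of_mem (s := s) (fun i hi => (hs i).2 (hi.trans ((hs l).1 hl))) j h4
    rw [A.d_d, map_zero] at h5
    simp only [← mul_assoc, ← Finset.sum_mul]
    rw [eq_neg_of_add_eq_zero_left h5.symm, neg_mul, smul_mul_assoc]
  have h3 : ∀ i, ksign k (1 - A.tot j) * ksign k (1 - A.tot i + 1 + (A.tot j - 1)) =
      - ksign k (1 - A.tot i) := by
    intro i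
    by_cases hi : Even (A.tot i) <;> by_cases hj : Even (A.tot j) <;>
      simp [ksign_eq, Int.even_add, Int.even_sub, hi, hj]
  simp only [lieD, mul_add, Finset.sum_add_distrib, Finset.mul_sum, map_add, map_sum, map_smul, h1,
    A.d_d, smul_zero, add_zero, Pi.zero_apply, smul_add, Finset.smul_sum, mul_smul_comm, smul_smul, h3]
  rw [Finset.sum_comm, Finset.sum_congr rfl h2]
  simp only [neg_smul, Finset.sum_neg_distrib]
  abel

/-- Every word in `d x^i` has at least two letters and total weight `int i`, so each letter has
strictly smaller internal degree. This makes the Lie derivative triangular for the filtration of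
one-forms by the internal degree of `dx^j`. -/
theorem IsMinimal.pd_d_x_eq_zero (h : A.IsMinimal) {i j : A.ι} (hij : A.int i ≤ A.int j) :
    pd j (A.d (A.x i)) = 0 := by
  have h4 : A.d (A.x i) ∈ cspan k (intSet A.toBiBasis (A.int i)) :=
    A.d_mem_intSet (x_mem_intSet _)
  refine pd_eq_zero (S := lenSet A.toBiBasis 2 ∩ intSet A.toBiBasis (A.int i)) ?_
    (mem_cspan_inter (h i) h4)
  rintro s ⟨h1, h2⟩
  have := A.card_le_sum_int s
  simp only [lenSet, intSet, Set.mem_ofPred_eq, Multiset.card_cons, Multiset.map_cons,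
    Multiset.sum_cons] at *
  omega

/-- One-forms are filtered by the internal degree of `dx^j`, and on the graded pieces the Lie
derivative is, up to sign, `d` applied to coefficients. For a closed form the coefficients of top
degree are therefore decomposable cocycles, hence exact; subtracting the Lie derivative of their
primitives lowers the top degree, which is bounded by `t`. Primitives of positive length are needed
so that the corrected form still has decomposable coefficients. -/
theorem exists_lieD_eq (hmin : A.IsMinimal) (hex : A.DecomposableExact) {n : ℤ} {s : Finset A.ι}
    (hs : ∀ i, i ∈ s ↔ A.int i ≤ n) (t : ℕ) (ω : A.ι → Cochain k A.toBiBasis)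
    (h0 : ∀ j, (t : ℤ) ≤ A.int j → ω j = 0)
    (hω : ∀ j, ω j ∈ cspan k (lenSet A.toBiBasis 2))
    (hω' : ∀ j, ω j ∈ cspan k (intSet A.toBiBasis (n - A.int j)))
    (hcl : lieD s ω = 0) :
    ∃ b : A.ι → Cochain k A.toBiBasis, (∀ j, b j ∈ cspan k (lenSet A.toBiBasis 1)) ∧
      (∀ j, b j ∈ cspan k (intSet A.toBiBasis (n - A.int j))) ∧ lieD s b = ω := by
  classical
  induction t generalizing ω with
  | zero =>
    have : ω = 0 := funext fun j => h0 j (A.int_pos j).le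
    refine ⟨0, fun j => Submodule.zero_mem _, fun j => Submodule.zero_mem _, ?_⟩
    ext j
    simp [lieD, this]
  | succ t ih =>
    have key : ∀ j, ∃ b, b ∈ cspan k (lenSet A.toBiBasis 1) ∧
        b ∈ cspan k (intSet A.toBiBasis (n - A.int j)) ∧
        (A.int j = t → A.d b = ksign k (1 - A.tot j) • ω j) ∧ (A.int j ≠ t → b = 0) := by
      intro j
      by_cases hj : A.int j = t
      -- In nonpositive internal degree the decomposable coefficient is zero already. Otherwise the
      -- primitive may be projected to internal degree `n - int j`, which is nonzero, and this
      -- removes a possible constant term.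
      · by_cases hn : n - A.int j ≤ 0
        · refine ⟨0, Submodule.zero_mem _, Submodule.zero_mem _, fun _ => ?_, fun _ => rfl⟩
          rw [A.eq_zero_of_int_nonpos hn (hω' j)
            (lenSet_anti one_le_two (hω j)), smul_zero, map_zero]
        · have h1 := congrFun hcl j
          have h2 : ∑ i ∈ s, pd j (A.d (A.x i)) * ω i = 0 := by
            refine Finset.sum_eq_zero fun i _ => ?_
            by_cases hi : (t : ℤ) + 1 ≤ A.int i
            · rw [h0 i (by push_cast; exact hi), mul_zero]
            · rw [hmin.pd_d_x_eq_zero (by omega), zero_mul]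
          rw [lieD, h2, zero_add, Pi.zero_apply, smul_eq_zero] at h1
          have h3 := h1.resolve_left (ksign_ne_zero k _)
          obtain ⟨w, hw⟩ := hex _ (Submodule.smul_mem _ (ksign k (1 - A.tot j)) (hω j))
            (by rw [map_smul, h3, smul_zero])
          refine ⟨cproj (intSet A.toBiBasis (n - A.int j)) w,
            cspan_mono (A.intSet_subset_lenSet (by omega)) (cproj_mem _ _), cproj_mem _ _,
            fun _ => ?_, fun h => (h hj).elim⟩
          rw [d_cproj_intSet, hw, map_smul, cproj_of_mem (hω' j)]
      · exact ⟨0, Submodule.zero_mem _, Submodule.zero_mem _, fun h => (hj h).elim, fun _ => rfl⟩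
    choose b hb1 hb2 hb3 hb4 using key
    have g1 : ∀ j, (t : ℤ) ≤ A.int j → (ω - lieD s b) j = 0 := by
      intro j hj
      have h2 : ∑ i ∈ s, pd j (A.d (A.x i)) * b i = 0 := by
        refine Finset.sum_eq_zero fun i _ => ?_
        by_cases hi : A.int i = t
        · rw [hmin.pd_d_x_eq_zero (by omega), zero_mul]
        · rw [hb4 i hi, mul_zero]
      rw [Pi.sub_apply, lieD, h2, zero_add]
      by_cases hj' : A.int j = t
      · rw [hb3 j hj', smul_smul, ksign_mul_self, one_smul, sub_self]
      · rw [h0 j (by push_cast; omega), hb4 j hj', map_zero, smul_zero, sub_zero]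
    have g2 : ∀ j, (ω - lieD s b) j ∈ cspan k (lenSet A.toBiBasis 2) := by
      intro j
      rw [Pi.sub_apply, lieD]
      refine Submodule.sub_mem _ (hω j) (Submodule.add_mem _ (Submodule.sum_mem _ fun i _ => ?_)
        (Submodule.smul_mem _ _ (hmin.d_mem (hb1 j))))
      exact mul_mem_lenSet (m := 1) (n := 1) (pd_mem_lenSet j (hmin i)) (hb1 i)
    have g3 : ∀ j, (ω - lieD s b) j ∈ cspan k (intSet A.toBiBasis (n - A.int j)) := by
      intro j
      rw [Pi.sub_apply, lieD]
      refine Submodule.sub_mem _ (hω' j) (Submodule.add_mem _ (Submodule.sum_mem _ fun i _ => ?_)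
        (Submodule.smul_mem _ _ (A.d_mem_intSet (hb2 j))))
      have := mul_mem_intSet (pd_mem_intSet j (A.d_mem_intSet (x_mem_intSet i))) (hb2 i)
      convert this using 3
      ring
    obtain ⟨b', hb1', hb2', hb'⟩ := ih (ω - lieD s b) g1 g2 g3
      (by rw [lieD_sub, hcl, lieD_lieD hs, sub_zero])
    refine ⟨b' + b, fun j => Submodule.add_mem _ (hb1' j) (hb1 j),
      fun j => Submodule.add_mem _ (hb2' j) (hb2 j), ?_⟩
    rw [lieD_add, hb', sub_add_cancel]

/-- The Euler field is weighted by internal degree rather than by word length: the differential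
preserves internal degree, so this field commutes with it, whereas it does not preserve length. -/
theorem euler_of_mem {n : ℤ} {s : Finset A.ι} (hs : ∀ i, A.int i ≤ n → i ∈ s)
    {c : Cochain k A.toBiBasis} (hc : c ∈ cspan k (intSet A.toBiBasis n)) :
    ∑ j ∈ s, (A.int j : k) • (A.x j * pd j c) = (n : k) • c := by
  have h : ∀ a ∈ cspan k (intSet A.toBiBasis n), (∑ j ∈ s, (A.int j : k) •
      LinearMap.mulLeft k (A.x j) ∘ₗ pd j) a =
      ((n : k) • LinearMap.id : Cochain k A.toBiBasis →ₗ[k] Cochain k A.toBiBasis) a := by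
    refine eqOn_cspan fun l hl => ?_
    simp only [LinearMap.sum_apply, LinearMap.smul_apply, LinearMap.comp_apply,
      LinearMap.mulLeft_apply, LinearMap.id_apply]
    have hl' : ((l : Multiset A.ι).map A.int).sum = n := hl
    rw [euler_word s (fun j => (A.int j : k)) l fun i hi => Or.inl (hs i (hl' ▸
      A.int_le_of_mem (Multiset.mem_coe.2 hi)))]
    congr 1
    rw [← hl']
    simp [Int.cast_list_sum, Function.comp_def]
  simpa using h c hc

/-- If all decomposable cocycles are coboundaries, then those of length at least three are
coboundaries of decomposable cochains. -/
theorem exists_decomposable_primitive [CharZero k] (hmin : A.IsMinimal) (hex : A.DecomposableExact)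
    {n : ℤ} (hn : 0 < n) {c : Cochain k A.toBiBasis} (hc : c ∈ cspan k (lenSet A.toBiBasis 3))
    (hc' : c ∈ cspan k (intSet A.toBiBasis n)) (hd : A.d c = 0) :
    ∃ u ∈ cspan k (lenSet A.toBiBasis 2), A.d u = c := by
  set s := (A.finite_le n).toFinset with hs
  have hs : ∀ i, i ∈ s ↔ A.int i ≤ n := fun i => by simp [hs]
  have g1 : ∀ j, ((n.toNat + 1 : ℕ) : ℤ) ≤ A.int j → pd j c = 0 := fun j hj =>
    A.eq_zero_of_int_nonpos (by push_cast at hj; omega) (pd_mem_intSet j hc')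
      (lenSet_anti one_le_two (pd_mem_lenSet (m := 2) j hc))
  have g2 : lieD s (fun j => pd j c) = 0 := by
    ext j
    rw [Pi.zero_apply, lieD, ← pd_d_of_mem (fun i hi => (hs i).2 hi) j hc', hd, map_zero]
  -- The one-form with coefficients `∂_j c` is closed because `c` is, and its coefficients have
  -- length at least two because `c` has length at least three.
  obtain ⟨b, hb1, hb2, hb3⟩ := exists_lieD_eq hmin hex hs (n.toNat + 1) (fun j => pd j c)
    g1 (fun j => pd_mem_lenSet (m := 2) j hc) (fun j => pd_mem_intSet j hc') g2
  have h1 := euler_of_mem (fun i hi => (hs i).2 hi) hc'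
  have h2 : ∀ j, pd j c = lieD s b j := fun j => (congrFun hb3 j).symm
  have hn' : (n : k) ≠ 0 := by exact_mod_cast hn.ne'
  -- Contraction of `b` with the Euler field, normalised by its eigenvalue `n` on `c`. Each summand
  -- is a generator times an element of positive length, hence decomposable.
  refine ⟨(n : k)⁻¹ • ∑ j ∈ s, (A.int j : k) • (A.x j * b j), ?_, ?_⟩
  · refine Submodule.smul_mem _ _ (Submodule.sum_mem _ fun j _ => Submodule.smul_mem _ _ ?_)
    exact mul_mem_lenSet (m := 1) (n := 1) (x_mem_lenSet j) (hb1 j)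
  rw [map_smul, inv_smul_eq_iff₀ hn', ← h1, map_sum]
  simp only [h2, lieD, map_smul, d_x_mul, mul_add, smul_add, Finset.sum_add_distrib]
  congr 1
  · simp only [Finset.mul_sum, Finset.smul_sum]
    rw [Finset.sum_comm]
    refine Finset.sum_congr rfl fun i hi => ?_
    -- Euler's identity for `d x^i`, still of weight `int i`, is what lets contraction commute with
    -- the differential.
    have h3 := euler_of_mem (A := A) (n := A.int i) (s := s)
      (fun j hj => (hs j).2 (hj.trans ((hs i).1 hi))) (A.d_mem_intSet (x_mem_intSet i))
    rw [← smul_mul_assoc, ← h3, Finset.sum_mul]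
    simp only [smul_mul_assoc, mul_assoc]
  · simp only [mul_smul_comm]

end LInf

/-! ### The filtration by word length -/

namespace Cochain

variable {k : Type u} [Field k] {B B' : BiBasis.{v}}

theorem map_cproj_biSet (f : Cochain k B →ₗ[k] Cochain k B') (p₀ q₀ : ℤ)
    (hf : ∀ p q, ∀ a ∈ cspan k (biSet B p q), f a ∈ cspan k (biSet B' (p + p₀) (q + q₀))) (p q : ℤ)
    (a : Cochain k B) :
    f (cproj (biSet B p q) a) = cproj (biSet B' (p + p₀) (q + q₀)) (f a) := by
  classical
  refine LinearMap.congr_fun (f := f ∘ₗ cproj _) (g := cproj _ ∘ₗ f) (ext_word fun l => ?_) a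
  simp only [LinearMap.comp_apply, cproj_word]
  have h := hf _ _ _ (word_mem_cspan (k := k)
    (show (l : Multiset B.ι) ∈ biSet B _ _ from ⟨rfl, rfl⟩))
  split_ifs with hl
  · rw [cproj_of_mem (hf _ _ _ (word_mem_cspan hl))]
  · rw [map_zero, cproj_eq_zero _ h]
    rw [Set.disjoint_left]
    rintro s ⟨h1, h2⟩ ⟨h3, h4⟩
    exact hl ⟨by linarith, by linarith⟩

theorem exists_card_le (c : Cochain k B) : ∃ N : ℕ, c ∈ cspan k {s : Multiset B.ι | s.card ≤ N} := by
  have ha : c ∈ Submodule.span k (Set.range (word k B)) := by rw [span_words]; trivial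
  induction ha using Submodule.span_induction with
  | mem a h =>
    obtain ⟨l, rfl⟩ := h
    exact ⟨l.length, word_mem_cspan (by simp)⟩
  | zero => exact ⟨0, Submodule.zero_mem _⟩
  | add a b _ _ ha hb =>
    obtain ⟨m, hm⟩ := ha
    obtain ⟨n, hn⟩ := hb
    have h : ∀ {i j : ℕ}, i ≤ j → cspan k {s : Multiset B.ι | s.card ≤ i} ≤
        cspan k {s : Multiset B.ι | s.card ≤ j} := fun hij => cspan_mono fun s hs => le_trans hs hij
    exact ⟨max m n, Submodule.add_mem _ (h (le_max_left m n) hm) (h (le_max_right m n) hn)⟩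
  | smul r a _ ha =>
    obtain ⟨m, hm⟩ := ha
    exact ⟨m, Submodule.smul_mem _ _ hm⟩

/-- The length filtration is separated, because each cochain is a finite combination of words. -/
theorem eq_zero_of_mem_lenSet {c : Cochain k B} (h : ∀ m, c ∈ cspan k (lenSet B m)) : c = 0 := by
  obtain ⟨N, hN⟩ := exists_card_le c
  refine eq_zero_of_mem_disjoint (Set.disjoint_left.2 fun s h1 h2 => ?_) hN (h (N + 1))
  simp only [lenSet, Set.mem_ofPred_eq] at h1 h2
  omega

theorem lenEq_disjoint {m n : ℕ} (h : m < n) : Disjoint (lenEq B m) (lenSet B n) :=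
  Set.disjoint_left.2 fun s h1 h2 => by simp only [lenSet, lenEq, Set.mem_ofPred_eq] at *; omega

theorem lenEq_le (m : ℕ) : cspan k (lenEq B m) ≤ cspan k (lenSet B m) :=
  cspan_mono fun _ hs => hs.ge

/-- An element of `lenSet m` is its part of length `m` up to `lenSet (m + 1)`. -/
theorem sub_cproj_lenEq {m : ℕ} {a : Cochain k B} (ha : a ∈ cspan k (lenSet B m)) :
    a - cproj (lenEq B m) a ∈ cspan k (lenSet B (m + 1)) := by
  have h := cproj_add_compl (lenEq B m) a
  rw [sub_eq_of_eq_add' h.symm]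
  refine cspan_mono ?_ (mem_cspan_inter (cproj_mem (lenEq B m)ᶜ a) (cproj_mem_of_mem ha))
  rintro s ⟨h1, h2⟩
  simp only [lenSet, lenEq, Set.mem_ofPred_eq, Set.mem_compl_iff] at *
  omega

end Cochain

namespace LInf

open Cochain

variable {k : Type u} [Field k] (A : LInf.{u, v} k)

/-! ### The quadratic part of a minimal differential -/

/-- The differential is quadratic. -/
def IsQuadratic : Prop := ∀ i, A.d (A.x i) ∈ cspan k (lenEq A.toBiBasis 2)

/-- The quadratic part of the differential. -/
def quadD : Cochain k A.toBiBasis →ₗ[k] Cochain k A.toBiBasis :=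
  der 1 (fun i => cproj (lenEq A.toBiBasis 2) (A.d (A.x i)))
    fun _ => cproj_mem_of_mem (A.d_mem_totSet (x_mem_totSet _))

variable {A}

theorem quadD_x (i : A.ι) : A.quadD (A.x i) = cproj (lenEq A.toBiBasis 2) (A.d (A.x i)) := der_x i

theorem quadD_mul {n : ℤ} {a : Cochain k A.toBiBasis} (ha : a ∈ cspan k (totSet A.toBiBasis n))
    (b : Cochain k A.toBiBasis) : A.quadD (a * b) = A.quadD a * b + ksign k n • (a * A.quadD b) := by
  rw [quadD, der_mul ha, one_mul]

theorem quadD_x_mul (i : A.ι) (b : Cochain k A.toBiBasis) : A.quadD (A.x i * b) =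
    A.quadD (A.x i) * b + ksign k (1 - A.tot i) • (A.x i * A.quadD b) :=
  quadD_mul (x_mem_totSet i) b

theorem quadD_one : A.quadD 1 = 0 := der_one

theorem quadD_x_mem_biSet (i : A.ι) :
    A.quadD (A.x i) ∈ cspan k (biSet A.toBiBasis (1 - A.coh i + 1) (-A.int i)) := by
  rw [quadD_x]
  exact cproj_mem_of_mem (A.d_mem_biSet (x_mem_biSet _))

theorem quadD_mem_biSet {p q : ℤ} {a : Cochain k A.toBiBasis}
    (ha : a ∈ cspan k (biSet A.toBiBasis p q)) :
    A.quadD a ∈ cspan k (biSet A.toBiBasis (p + 1) q) := by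
  refine mem_comap_of_word A.quadD _ (fun l hl => ?_) a ha
  clear ha
  induction l generalizing p q with
  | nil => rw [word_nil, quadD_one]; exact Submodule.zero_mem _
  | cons i l ih =>
    have hl' : (l : Multiset A.ι) ∈ biSet A.toBiBasis (p - (1 - A.coh i)) (q + A.int i) := by
      obtain ⟨h1, h2⟩ := hl
      rw [← Multiset.cons_coe] at h1 h2
      simp only [Multiset.map_cons, Multiset.sum_cons] at h1 h2
      exact ⟨by linarith, by linarith⟩
    rw [word_cons, quadD_x_mul]
    refine Submodule.add_mem _ ?_ (Submodule.smul_mem _ _ ?_)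
    · convert! mul_mem_biSet (quadD_x_mem_biSet i) (word_mem_cspan hl') using 3 <;> ring
    · convert! mul_mem_biSet (x_mem_biSet i) (ih hl') using 3 <;> ring

theorem quadD_mem_lenEq {m : ℕ} {a : Cochain k A.toBiBasis}
    (ha : a ∈ cspan k (lenEq A.toBiBasis m)) : A.quadD a ∈ cspan k (lenEq A.toBiBasis (m + 1)) := by
  refine mem_comap_of_word A.quadD _ (fun l hl => ?_) a ha
  clear ha
  induction l generalizing m with
  | nil => rw [word_nil, quadD_one]; exact Submodule.zero_mem _
  | cons i l ih =>
    obtain rfl : l.length + 1 = m := by simpa [lenEq] using hl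
    have hl' : (l : Multiset A.ι) ∈ lenEq A.toBiBasis l.length := by simp [lenEq]
    rw [word_cons, quadD_x_mul]
    refine Submodule.add_mem _ ?_ (Submodule.smul_mem _ _ ?_)
    · convert! mul_mem_lenEq (m := 2) (quadD_x i ▸ cproj_mem _ _) (word_mem_cspan hl') using 3
      ring
    · convert! mul_mem_lenEq (x_mem_lenEq i) (ih hl') using 3
      ring

theorem IsMinimal.d_sub_quadD_mem (h : A.IsMinimal) {m : ℕ} {a : Cochain k A.toBiBasis}
    (ha : a ∈ cspan k (lenEq A.toBiBasis m)) :
    A.d a - A.quadD a ∈ cspan k (lenSet A.toBiBasis (m + 2)) := by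
  refine mem_comap_of_word (A.d - A.quadD) _ (fun l hl => ?_) a ha
  clear ha
  rw [LinearMap.sub_apply]
  induction l generalizing m with
  | nil => rw [word_nil, quadD_one, A.d_one, sub_zero]; exact Submodule.zero_mem _
  | cons i l ih =>
    obtain rfl : l.length + 1 = m := by simpa [lenEq] using hl
    have hl' : (l : Multiset A.ι) ∈ lenSet A.toBiBasis l.length := by simp [lenSet]
    have e : A.d (word k A.toBiBasis (i :: l)) - A.quadD (word k A.toBiBasis (i :: l)) =
        (A.d (A.x i) - A.quadD (A.x i)) * word k A.toBiBasis l +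
          ksign k (1 - A.tot i) • (A.x i *
            (A.d (word k A.toBiBasis l) - A.quadD (word k A.toBiBasis l))) := by
      rw [word_cons, quadD_x_mul, d_x_mul, sub_mul, mul_sub, smul_sub]
      abel
    rw [e]
    refine Submodule.add_mem _ ?_ (Submodule.smul_mem _ _ ?_)
    · convert! mul_mem_lenSet (m := 3) (quadD_x (k := k) i ▸ sub_cproj_lenEq (h i))
        (word_mem_cspan hl') using 3
      ring
    · convert! mul_mem_lenSet (x_mem_lenSet i) (ih (m := l.length) (by simp [lenEq])) using 3
      ring

/-- On words of length `m`, the square of the quadratic part is the component of length `m + 2` of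
`d ∘ d = 0`, since the rest of the differential raises length by at least two. It is enough to see
this on generators, and the Leibniz rule does the rest. -/
theorem IsMinimal.quadD_quadD (h : A.IsMinimal) (a : Cochain k A.toBiBasis) :
    A.quadD (A.quadD a) = 0 := by
  have hx : ∀ i, A.quadD (A.quadD (A.x i)) = 0 := by
    intro i
    have h1 : A.quadD (A.x i) ∈ cspan k (lenEq A.toBiBasis 2) := quadD_mem_lenEq (x_mem_lenEq i)
    have h2 : A.d (A.x i) - A.quadD (A.x i) ∈ cspan k (lenSet A.toBiBasis 3) :=
      h.d_sub_quadD_mem (x_mem_lenEq i)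
    have h3 : A.d (A.d (A.x i) - A.quadD (A.x i)) ∈ cspan k (lenSet A.toBiBasis 4) := h.d_mem h2
    have h4 := h.d_sub_quadD_mem h1
    rw [map_sub, A.d_d, zero_sub] at h3
    refine eq_zero_of_mem_disjoint (lenEq_disjoint (show 3 < 4 by norm_num)) (quadD_mem_lenEq h1) ?_
    have := Submodule.add_mem _ h3 h4
    rw [← Submodule.neg_mem_iff]
    convert! this using 1
    abel
  refine LinearMap.congr_fun (f := A.quadD ∘ₗ A.quadD) (g := 0) (ext_word fun l => ?_) a
  rw [LinearMap.comp_apply, LinearMap.zero_apply]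
  induction l with
  | nil => rw [word_nil, quadD_one, map_zero]
  | cons i l ih =>
    have h1 : A.quadD (A.x i) ∈ cspan k (totSet A.toBiBasis (1 - A.tot i + 1)) := by
      rw [quadD_x]
      exact cproj_mem_of_mem (A.d_mem_totSet (x_mem_totSet i))
    rw [word_cons, quadD_x_mul, map_add, quadD_mul h1, hx, map_smul, quadD_x_mul, ih]
    have : ksign k (1 - A.tot i + 1) = - ksign k (1 - A.tot i) := by
      rw [ksign_add]; simp [ksign_eq]
    rw [this]
    simp

/-- The `L_∞` algebra with the quadratic part of a minimal differential. -/
def quad (h : A.IsMinimal) : LInf.{u, v} k where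
  toBiBasis := A.toBiBasis
  int_pos := A.int_pos
  finite_le := A.finite_le
  d := A.quadD
  d_piece p q a ha := by
    rw [piece_eq] at *
    exact quadD_mem_biSet ha
  d_mul p q a ha b := by
    rw [piece_eq] at ha
    exact quadD_mul (cspan_mono (biSet_subset_totSet p q) ha) b
  d_d := h.quadD_quadD

theorem quad_isQuadratic (h : A.IsMinimal) : (quad h).IsQuadratic :=
  fun i => quadD_mem_lenEq (A := A) (m := 1) (x_mem_lenEq i)

/-! ### Change of coordinates -/

section coordinates

/-- Homogeneous coordinates. -/
abbrev Coordinates (A : LInf.{u, v} k) : Type _ :=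
  ∀ i : A.ι, cspan k (biSet A.toBiBasis (1 - A.coh i) (-A.int i))

theorem mem_totSet_of_biSet {i : A.ι} {a : Cochain k A.toBiBasis}
    (ha : a ∈ cspan k (biSet A.toBiBasis (1 - A.coh i) (-A.int i))) :
    a ∈ cspan k (totSet A.toBiBasis (1 - A.tot i)) := by
  refine cspan_mono ?_ ha
  convert! biSet_subset_totSet _ _ using 2
  simp [BiBasis.tot]; ring

theorem mem_intSet_of_biSet {i : A.ι} {p : ℤ} {a : Cochain k A.toBiBasis}
    (ha : a ∈ cspan k (biSet A.toBiBasis p (-A.int i))) :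
    a ∈ cspan k (intSet A.toBiBasis (A.int i)) := by
  refine cspan_mono ?_ ha
  convert! biSet_subset_intSet _ _ using 2
  simp

/-- The substitution `x i ↦ y i`. -/
def subst (y : Coordinates A) : Cochain k A.toBiBasis →ₐ[k] Cochain k A.toBiBasis :=
  lift (fun i => (y i).1) fun i j =>
    graded_comm (mem_totSet_of_biSet (y i).2) (mem_totSet_of_biSet (y j).2)

theorem subst_x (y : Coordinates A) (i : A.ι) : subst y (A.x i) = y i := lift_x _ _ _

theorem subst_mem_biSet (y : Coordinates A) {p q : ℤ} {a : Cochain k A.toBiBasis}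
    (ha : a ∈ cspan k (biSet A.toBiBasis p q)) : subst y a ∈ cspan k (biSet A.toBiBasis p q) := by
  refine mem_comap_of_word (subst y).toLinearMap _ (fun l hl => ?_) a ha
  clear ha
  rw [AlgHom.toLinearMap_apply]
  induction l generalizing p q with
  | nil => rw [word_nil, map_one, ← word_nil]; exact word_mem_cspan hl
  | cons i l ih =>
    have hl' : (l : Multiset A.ι) ∈ biSet A.toBiBasis (p - (1 - A.coh i)) (q + A.int i) := by
      obtain ⟨h1, h2⟩ := hl
      rw [← Multiset.cons_coe] at h1 h2
      simp only [Multiset.map_cons, Multiset.sum_cons] at h1 h2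
      exact ⟨by linarith, by linarith⟩
    rw [word_cons, map_mul, show subst y (Cochain.x k A.toBiBasis i) = y i from subst_x y i]
    convert! mul_mem_biSet (y i).2 (ih hl') using 3 <;> ring

/-- Coordinates that agree with the given ones up to decomposables. -/
def IsUnipotent (y : Coordinates A) : Prop :=
  ∀ i, (y i).1 - A.x i ∈ cspan k (lenSet A.toBiBasis 2)

/-- The substitution is the identity on the graded pieces of the length filtration: replacing one
letter at a time, each replacement costs an element of length at least two. -/
theorem IsUnipotent.subst_mem {y : Coordinates A} (hy : IsUnipotent y) {m : ℕ}
    {a : Cochain k A.toBiBasis} (ha : a ∈ cspan k (lenSet A.toBiBasis m)) :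
    subst y a - a ∈ cspan k (lenSet A.toBiBasis (m + 1)) := by
  suffices h : ∀ l : List A.ι, subst y (word k A.toBiBasis l) - word k A.toBiBasis l ∈
      cspan k (lenSet A.toBiBasis (l.length + 1)) by
    refine mem_comap_of_word ((subst y).toLinearMap - LinearMap.id) _ (fun l hl => ?_) a ha
    exact lenSet_anti (Nat.succ_le_succ (by simpa [lenSet] using hl)) (h l)
  intro l
  induction l with
  | nil => rw [word_nil, map_one, sub_self]; exact Submodule.zero_mem _
  | cons i l ih =>
    have hl : word k A.toBiBasis l ∈ cspan k (lenSet A.toBiBasis l.length) :=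
      word_mem_cspan (by simp [lenSet])
    have h1 : subst y (word k A.toBiBasis l) ∈ cspan k (lenSet A.toBiBasis l.length) := by
      rw [← sub_add_cancel (subst y (word k A.toBiBasis l)) (word k A.toBiBasis l)]
      exact Submodule.add_mem _ (lenSet_anti (Nat.le_succ _) ih) hl
    have e : subst y (word k A.toBiBasis (i :: l)) - word k A.toBiBasis (i :: l) =
        ((y i).1 - A.x i) * subst y (word k A.toBiBasis l) +
        A.x i * (subst y (word k A.toBiBasis l) - word k A.toBiBasis l) := by
      rw [word_cons, map_mul, show subst y (Cochain.x k A.toBiBasis i) = y i from subst_x y i]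
      noncomm_ring
    rw [e]
    refine Submodule.add_mem _ ?_ ?_
    · convert! mul_mem_lenSet (hy i) h1 using 3
      simp only [List.length_cons]; ring
    · convert! mul_mem_lenSet (x_mem_lenSet i) ih using 3
      simp only [List.length_cons]; ring

theorem IsUnipotent.subst_mem_lenSet {y : Coordinates A} (hy : IsUnipotent y) {m : ℕ}
    {a : Cochain k A.toBiBasis} (ha : a ∈ cspan k (lenSet A.toBiBasis m)) :
    subst y a ∈ cspan k (lenSet A.toBiBasis m) := by
  rw [← sub_add_cancel (subst y a) a]
  exact Submodule.add_mem _ (lenSet_anti (Nat.le_succ _) (hy.subst_mem ha)) ha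

theorem lt_of_mem_word {n : ℤ} {l : List A.ι}
    (h1 : (l : Multiset A.ι) ∈ lenSet A.toBiBasis 2 ∩ intSet A.toBiBasis n) : ∀ j ∈ l, A.int j < n := by
  obtain ⟨h1, h2⟩ := h1
  intro j hj
  obtain ⟨s, hs⟩ := Multiset.exists_cons_of_mem (Multiset.mem_coe.2 hj)
  rw [hs] at h1 h2
  have := A.card_le_sum_int s
  simp only [lenSet, intSet, Set.mem_ofPred_eq, Multiset.card_cons, Multiset.map_cons,
    Multiset.sum_cons] at *
  omega

/-- Injectivity uses the length filtration: an element of the kernel lies in every step, hence is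
zero. Surjectivity uses internal degree: `y i - x i` is decomposable of the same weight, so it
involves only generators of smaller internal degree, which are in the range by induction. -/
theorem IsUnipotent.bijective {y : Coordinates A} (hy : IsUnipotent y) :
    Function.Bijective (subst y) := by
  constructor
  · rw [injective_iff_map_eq_zero]
    intro a ha
    refine eq_zero_of_mem_lenSet fun m => ?_
    induction m with
    | zero => exact cspan_mono (fun s _ => Nat.zero_le _) (cspan_univ (k := k) ▸ Submodule.mem_top)
    | succ m ih =>
      have := hy.subst_mem ih
      rw [ha, zero_sub] at this
      exact (Submodule.neg_mem_iff _).1 this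
  · have hw : ∀ l : List A.ι, (∀ i ∈ l, A.x i ∈ (subst y).range) →
        word k A.toBiBasis l ∈ (subst y).range := by
      intro l hl
      induction l with
      | nil => rw [word_nil]; exact one_mem _
      | cons i l ih =>
        rw [word_cons]
        exact mul_mem (hl i (by simp)) (ih fun j hj => hl j (by simp [hj]))
    have hx : ∀ (n : ℕ) (i : A.ι), A.int i < n → A.x i ∈ (subst y).range := by
      intro n
      induction n with
      | zero => intro i hi; have := A.int_pos i; omega
      | succ n ih =>
        intro i hi
        rw [← sub_sub_cancel (y i).1 (A.x i)]
        refine sub_mem ⟨A.x i, subst_x y i⟩ ?_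
        have h1 := mem_cspan_inter (hy i) (mem_intSet_of_biSet
          (Submodule.sub_mem _ (y i).2 (x_mem_biSet i)))
        have := cspan_le (N := Subalgebra.toSubmodule (subst y).range)|>.2
          (fun l hl => hw l fun j hj => ih j (by have := lt_of_mem_word hl j hj; omega)) h1
        exact this
    intro a
    have : a ∈ cspan k (Set.univ : Set (Multiset A.ι)) := by rw [cspan_univ]; trivial
    exact cspan_le (N := Subalgebra.toSubmodule (subst y).range)|>.2
      (fun l _ => hw l fun j _ => hx ((A.int j).toNat + 1) j (by omega)) this

/-- A decomposable element of weight `n` has no letter of internal degree `n` or more. This makes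
the recursive definition of the new coordinates independent of the values not yet defined. -/
theorem subst_congr {y y' : Coordinates A} {n : ℤ} (h : ∀ j, A.int j < n → y j = y' j)
    {a : Cochain k A.toBiBasis} (ha : a ∈ cspan k (lenSet A.toBiBasis 2 ∩ intSet A.toBiBasis n)) :
    subst y a = subst y' a := by
  refine eqOn_cspan (f := (subst y).toLinearMap) (g := (subst y').toLinearMap) (fun l hl => ?_) a ha
  replace hl := lt_of_mem_word hl
  simp only [AlgHom.toLinearMap_apply]
  clear ha
  induction l with
  | nil => rw [word_nil, map_one, map_one]
  | cons i l ih =>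
    rw [word_cons, map_mul, map_mul, ih fun j hj => hl j (by simp [hj]),
      show subst y (Cochain.x k A.toBiBasis i) = y i from subst_x y i,
      show subst y' (Cochain.x k A.toBiBasis i) = y' i from subst_x y' i, h i (hl i (by simp))]

variable (A) in
open Classical in
/-- The correction term for the coordinate `i`. -/
def correction (y : Coordinates A) (i : A.ι) :
    cspan k (biSet A.toBiBasis (1 - A.coh i) (-A.int i)) :=
  -- The default value zero keeps the recursion total. Under the hypotheses of `d_quadCoord` the
  -- condition holds at every step of the recursion.
  if h : ∃ u : cspan k (biSet A.toBiBasis (1 - A.coh i) (-A.int i)),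
    u.1 ∈ cspan k (lenSet A.toBiBasis 2) ∧ A.d u.1 = A.d (A.x i) - subst y (A.quadD (A.x i))
  then h.choose else 0

theorem correction_mem (y : Coordinates A) (i : A.ι) :
    (correction A y i).1 ∈ cspan k (lenSet A.toBiBasis 2) := by
  unfold correction
  split_ifs with h
  · exact h.choose_spec.1
  · exact Submodule.zero_mem _

variable (A) in
open Classical in
/-- Coordinates in which the differential becomes quadratic. -/
def quadCoord : Coordinates A :=
  (measure fun i : A.ι => (A.int i).toNat).wf.fix fun i rec =>
    ⟨A.x i, x_mem_biSet i⟩ - correction A (fun j =>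
      -- The old coordinates serve as placeholders in internal degrees not yet reached; by
      -- `subst_congr` they never enter.
      if h : (A.int j).toNat < (A.int i).toNat then rec j h else ⟨A.x j, x_mem_biSet j⟩) i

open Classical in
theorem quadCoord_eq (i : A.ι) : quadCoord A i = ⟨A.x i, x_mem_biSet i⟩ - correction A (fun j =>
      if (A.int j).toNat < (A.int i).toNat then quadCoord A j else ⟨A.x j, x_mem_biSet j⟩) i := by
  rw [quadCoord, WellFounded.fix_eq]
  rfl

theorem quadCoord_isUnipotent : IsUnipotent (quadCoord A) := by
  classical
  intro i
  rw [quadCoord_eq]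
  simp only [Submodule.coe_sub, sub_sub_cancel_left]
  exact Submodule.neg_mem _ (correction_mem _ _)

/-- The obstruction `d x^i - y^*(d₂ x^i)` is a cocycle, since `d y^j = y^*(d₂ x^j)` for the lower
coordinates and `d₂² = 0`. Both terms agree with `d₂ x^i` up to length three, so the obstruction has
a decomposable primitive `u`, and `y^i = x^i - u` has the required differential. -/
theorem d_quadCoord [CharZero k] (hmin : A.IsMinimal) (hex : A.DecomposableExact) (i : A.ι) :
    A.d (quadCoord A i) = subst (quadCoord A) (A.quadD (A.x i)) := by
  classical
  suffices H : ∀ (n : ℕ) (i : A.ι), A.int i < n →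
      A.d (quadCoord A i) = subst (quadCoord A) (A.quadD (A.x i)) from
    H ((A.int i).toNat + 1) i (by omega)
  intro n
  induction n with
  | zero => intro i hi; have := A.int_pos i; omega
  | succ n ih =>
    intro i hi
    set y := quadCoord A with hy
    have hq : A.quadD (A.x i) ∈ cspan k (lenSet A.toBiBasis 2 ∩ intSet A.toBiBasis (A.int i)) :=
      mem_cspan_inter (lenEq_le 2 (quadD_mem_lenEq (m := 1) (x_mem_lenEq i)))
        (mem_intSet_of_biSet (quadD_x_mem_biSet i))
    have hw : ∀ l : List A.ι, (∀ j ∈ l, A.int j < A.int i) →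
        A.d (subst y (word k A.toBiBasis l)) = subst y (A.quadD (word k A.toBiBasis l)) := by
      intro l hl
      induction l with
      | nil => rw [word_nil, map_one, A.d_one, quadD_one, map_zero]
      | cons j l ihl =>
        have hj := hl j (by simp)
        rw [word_cons, map_mul, show subst y (Cochain.x k A.toBiBasis j) = y j from subst_x y j,
          A.d_mul_of_mem (mem_totSet_of_biSet (y j).2), ihl fun j hj => hl j (by simp [hj]),
          ih j (by omega), quadD_x_mul, map_add, map_smul, map_mul, map_mul,
          show subst y (Cochain.x k A.toBiBasis j) = y j from subst_x y j]
    have hcl : A.d (subst y (A.quadD (A.x i))) = 0 := by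
      refine (eqOn_cspan (f := A.d ∘ₗ (subst y).toLinearMap) (g := (subst y).toLinearMap ∘ₗ A.quadD)
        (fun l hl => hw l (lt_of_mem_word hl)) _ hq).trans ?_
      simp [hmin.quadD_quadD]
    have hc : A.d (A.x i) - subst y (A.quadD (A.x i)) ∈
        cspan k (biSet A.toBiBasis (1 - A.coh i + 1) (-A.int i)) :=
      Submodule.sub_mem _ (A.d_mem_biSet (x_mem_biSet i)) (subst_mem_biSet y (quadD_x_mem_biSet i))
    obtain ⟨u, hu1, hu2⟩ := exists_decomposable_primitive hmin hex (A.int_pos i)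
      (c := A.d (A.x i) - subst y (A.quadD (A.x i))) (by
        have h1 : A.d (A.x i) - A.quadD (A.x i) ∈ cspan k (lenSet A.toBiBasis 3) :=
          hmin.d_sub_quadD_mem (m := 1) (x_mem_lenEq i)
        have h2 := quadCoord_isUnipotent.subst_mem (m := 2) (cspan_mono Set.inter_subset_left hq)
        rw [← sub_sub_sub_cancel_right _ _ (A.quadD (A.x i))]
        exact Submodule.sub_mem _ h1 h2) (mem_intSet_of_biSet hc) (by
        rw [map_sub, A.d_d, hcl, sub_zero])
    -- The primitive is projected to the bidegree of `x i`, and the full coordinates are traded for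
    -- the partially defined ones of the recursion, which agree with them below `int i`.
    have hex' : ∃ u : cspan k (biSet A.toBiBasis (1 - A.coh i) (-A.int i)),
        u.1 ∈ cspan k (lenSet A.toBiBasis 2) ∧
        A.d u.1 = A.d (A.x i) - subst (fun j => if (A.int j).toNat < (A.int i).toNat then
          quadCoord A j else ⟨A.x j, x_mem_biSet j⟩) (A.quadD (A.x i)) := by
      refine ⟨⟨cproj (biSet A.toBiBasis (1 - A.coh i) (-A.int i)) u, cproj_mem _ _⟩,
        cproj_mem_of_mem hu1, ?_⟩
      rw [d_cproj_biSet, hu2, cproj_of_mem hc]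
      congr 1
      refine subst_congr (fun j hj => ?_) hq
      have := A.int_pos j
      rw [if_pos (by omega)]
    rw [hy, quadCoord_eq, correction, dif_pos hex', Submodule.coe_sub, map_sub,
      hex'.choose_spec.2, sub_sub_cancel]
    refine subst_congr (fun j hj => ?_) hq
    have := A.int_pos j
    rw [if_pos (by omega)]

end coordinates

/-! ### Cohomology of a quadratic model -/

theorem IsQuadratic.isMinimal (h : A.IsQuadratic) : A.IsMinimal := fun i => lenEq_le 2 (h i)

theorem IsMinimal.d_mem_two (h : A.IsMinimal) (a : Cochain k A.toBiBasis) :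
    A.d a ∈ cspan k (lenSet A.toBiBasis 2) := by
  refine mem_comap_of_word (S := Set.univ) A.d _ (fun l _ => ?_) a (by rw [cspan_univ]; trivial)
  cases l with
  | nil => rw [word_nil, A.d_one]; exact Submodule.zero_mem _
  | cons i l => exact h.d_mem (m := 1) (word_mem_cspan (by simp [lenSet]))

theorem IsQuadratic.d_mem_lenEq (h : A.IsQuadratic) {m : ℕ} {a : Cochain k A.toBiBasis}
    (ha : a ∈ cspan k (lenEq A.toBiBasis m)) : A.d a ∈ cspan k (lenEq A.toBiBasis (m + 1)) := by
  have : A.d = A.quadD := by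
    refine ext_word fun l => ?_
    induction l with
    | nil => rw [word_nil, A.d_one, quadD_one]
    | cons i l ih => rw [word_cons, quadD_x_mul, d_x_mul, ih, quadD_x, cproj_of_mem (h i)]
  rw [this]
  exact quadD_mem_lenEq ha

variable (A) in
/-- The linear cocycles of bidegree `(p, q)`. -/
def linCocycles (p q : ℤ) : Submodule k (Cochain k A.toBiBasis) :=
  LinearMap.ker A.d ⊓ linear k A.toBiBasis ⊓ piece k A.toBiBasis p q

/-- A quadratic differential is homogeneous for length, so the linear part of a cocycle is a
cocycle, and the decomposable remainder is then exact. Coboundaries are decomposable, so no nonzero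
linear cocycle is exact. The condition `q ≠ 0` excludes the constants, which are neither linear nor
decomposable. -/
theorem IsQuadratic.transfer {F A : LInf.{u, v} k} (hFq : F.IsQuadratic)
    (Φ : Cochain k F.toBiBasis ≃ₐ[k] Cochain k A.toBiBasis) (hd : ∀ a, Φ (F.d a) = A.d (Φ a))
    (hp : ∀ p q a, a ∈ piece k F.toBiBasis p q ↔ Φ a ∈ piece k A.toBiBasis p q)
    (hlen : ∀ a ∈ cspan k (lenSet F.toBiBasis 2), Φ a ∈ cspan k (lenSet A.toBiBasis 2))
    (hex : A.DecomposableExact) : F.DecomposableExact ∧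
      ∀ p q, q ≠ 0 → Nonempty (F.linCocycles p q ≃ₗ[k] A.H p q) := by
  have hFe : F.DecomposableExact := by
    intro c hc hc0
    obtain ⟨w, hw⟩ := hex (Φ c) (hlen c hc) (by rw [← hd, hc0, map_zero])
    refine ⟨Φ.symm w, Φ.injective ?_⟩
    rw [hd, AlgEquiv.apply_symm_apply, hw]
  refine ⟨hFe, fun p q hq => ?_⟩
  let f0 : F.linCocycles p q →ₗ[k] ↥(LinearMap.ker A.d ⊓ piece k A.toBiBasis p q) :=
    LinearMap.codRestrict _ (Φ.toLinearMap ∘ₗ Submodule.subtype _) (by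
      rintro ⟨a, ⟨ha1, ha2⟩, ha3⟩
      refine ⟨?_, (hp p q a).1 ha3⟩
      change A.d (Φ a) = 0
      rw [← hd, show F.d a = 0 from ha1, map_zero])
  refine ⟨LinearEquiv.ofBijective (Submodule.mkQ _ ∘ₗ f0) ⟨?_, ?_⟩⟩
  · rw [injective_iff_map_eq_zero]
    rintro ⟨a, ⟨ha1, ha2⟩, ha3⟩ h
    rw [LinearMap.comp_apply, Submodule.mkQ_apply, Submodule.Quotient.mk_eq_zero,
      Submodule.mem_comap, sup_bot_eq] at h
    obtain ⟨w, hw, hw'⟩ := h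
    change A.d w = Φ a at hw'
    have h1 : a = F.d (Φ.symm w) := Φ.injective (by
      rw [hd, AlgEquiv.apply_symm_apply, hw'])
    have h2 := hFq.isMinimal.d_mem_two (Φ.symm w)
    rw [← h1] at h2
    rw [linear_eq] at ha2
    ext1
    exact eq_zero_of_mem_disjoint (lenEq_disjoint one_lt_two) ha2 h2
  · intro z
    obtain ⟨⟨z, hz1, hz2⟩, rfl⟩ := Submodule.mkQ_surjective _ z
    have hz1 : A.d z = 0 := hz1
    obtain ⟨c, rfl⟩ := Φ.surjective z
    have hc := (hp p q c).2 hz2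
    have hdc : F.d c = 0 := Φ.injective (by rw [hd, hz1, map_zero])
    rw [piece_eq] at hc
    have hc1 : c ∈ cspan k (lenSet F.toBiBasis 1) :=
      cspan_mono (F.intSet_subset_lenSet (neg_ne_zero.2 hq))
        (cspan_mono (biSet_subset_intSet p q) hc)
    set ℓ := cproj (lenEq F.toBiBasis 1) c with hℓ
    have hr := sub_cproj_lenEq hc1
    rw [← hℓ] at hr
    have h1 : F.d ℓ ∈ cspan k (lenEq F.toBiBasis 2) :=
      hFq.d_mem_lenEq (m := 1) (cproj_mem _ _)
    have h2 : F.d (c - ℓ) ∈ cspan k (lenSet F.toBiBasis 3) :=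
      hFq.isMinimal.d_mem (m := 2) hr
    -- The differential of the linear part has length two, and that of the remainder has length at
    -- least three; their sum vanishes, so each does.
    have h3 : F.d ℓ = 0 := by
      refine eq_zero_of_mem_disjoint (lenEq_disjoint (show 2 < 3 by norm_num)) h1 ?_
      rw [map_sub, hdc, zero_sub] at h2
      exact (Submodule.neg_mem_iff _).1 h2
    obtain ⟨w, hw⟩ := hFe (c - ℓ) hr (by rw [map_sub, hdc, h3, sub_zero])
    have hℓp : ℓ ∈ cspan k (biSet F.toBiBasis p q) := cproj_mem_of_mem hc
    have hw' : F.d (cproj (biSet F.toBiBasis (p - 1) q) w) = c - ℓ := by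
      have := F.d_cproj_biSet (p - 1) q w
      rw [sub_add_cancel, hw, cproj_of_mem (Submodule.sub_mem _ hc hℓp)] at this
      exact this
    refine ⟨⟨ℓ, ⟨h3, by rw [linear_eq]; exact cproj_mem _ _⟩, by rw [piece_eq]; exact hℓp⟩, ?_⟩
    rw [LinearMap.comp_apply, Submodule.mkQ_apply, Submodule.mkQ_apply, Submodule.Quotient.eq,
      Submodule.mem_comap, sup_bot_eq]
    refine ⟨-Φ (cproj (biSet F.toBiBasis (p - 1) q) w), Submodule.neg_mem _ ((hp _ _ _).1 ?_), ?_⟩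
    · rw [piece_eq]; exact cproj_mem _ _
    · change A.d (-Φ _) = Φ ℓ - Φ c
      rw [map_neg, ← hd, hw', map_sub, neg_sub]

/-- A minimal `L_∞` algebra whose decomposable cocycles are exact is isomorphic to one with
quadratic differential. -/
theorem exists_quadratic [CharZero k] (hmin : A.IsMinimal) (hex : A.DecomposableExact) :
    ∃ F : LInf.{u, v} k, F.IsQuadratic ∧ F.DecomposableExact ∧ A.Isomorphic F ∧
      ∀ p q, q ≠ 0 → Nonempty (F.linCocycles p q ≃ₗ[k] A.H p q) := by
  classical
  have hy : IsUnipotent (quadCoord A) := quadCoord_isUnipotent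
  set Φ := AlgEquiv.ofBijective (subst (quadCoord A)) hy.bijective with hΦ
  have hΦa : ∀ a, Φ a = subst (quadCoord A) a := fun a => rfl
  have hd : ∀ a, Φ ((quad hmin).d a) = A.d (Φ a) := by
    intro a
    refine (LinearMap.congr_fun (f := A.d ∘ₗ (subst (quadCoord A)).toLinearMap)
      (g := (subst (quadCoord A)).toLinearMap ∘ₗ A.quadD) (ext_word fun l => ?_) a).symm
    simp only [LinearMap.comp_apply, AlgHom.toLinearMap_apply]
    induction l with
    | nil => rw [word_nil, map_one, A.d_one, quadD_one, map_zero]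
    | cons j l ihl =>
      rw [word_cons, map_mul, show subst (quadCoord A) (Cochain.x k A.toBiBasis j) = quadCoord A j
        from subst_x _ j, A.d_mul_of_mem (mem_totSet_of_biSet (quadCoord A j).2), ihl,
        d_quadCoord hmin hex, quadD_x_mul, map_add, map_smul, map_mul, map_mul,
        show subst (quadCoord A) (Cochain.x k A.toBiBasis j) = quadCoord A j from subst_x _ j]
  have hpiece : ∀ p q, ∀ a ∈ piece k A.toBiBasis p q, Φ a ∈ piece k A.toBiBasis p q := by
    intro p q a ha
    rw [piece_eq] at *
    exact subst_mem_biSet _ ha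
  have hpiece' : ∀ p q, ∀ a, Φ a ∈ piece k A.toBiBasis p q → a ∈ piece k A.toBiBasis p q := by
    intro p q a ha
    have h := map_cproj_biSet (subst (quadCoord A)).toLinearMap 0 0 (fun p q a ha => by
      rw [add_zero, add_zero]; exact subst_mem_biSet _ ha) p q a
    rw [add_zero, add_zero] at h
    simp only [AlgHom.toLinearMap_apply] at h
    rw [piece_eq] at *
    rw [← hΦa a, cproj_of_mem ha, ← hΦa] at h
    rw [← Φ.injective h]
    exact cproj_mem _ _
  have hFq := quad_isQuadratic hmin
  obtain ⟨hFe, hH⟩ := hFq.transfer Φ hd (fun p q a => ⟨hpiece p q a, hpiece' p q a⟩)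
    (fun a ha => hy.subst_mem_lenSet ha) hex
  refine ⟨quad hmin, hFq, hFe, ⟨Φ, fun p q => ?_, hd⟩, hH⟩
  ext b
  constructor
  · rintro ⟨a, ha, rfl⟩
    exact hpiece p q a ha
  · intro hb
    refine ⟨Φ.symm b, hpiece' p q _ ?_, Φ.apply_symm_apply b⟩
    rwa [AlgEquiv.apply_symm_apply]

end LInf

/-! ### Second coefficients -/

namespace Cochain

variable {k : Type u} [Field k] {B : BiBasis.{v}}

theorem pd_pd (a b : B.ι) (c : Cochain k B) :
    pd a (pd b c) = ksign k ((1 - B.tot a) * (1 - B.tot b)) • pd b (pd a c) := by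
  classical
  refine LinearMap.congr_fun (f := pd a ∘ₗ pd b)
    (g := ksign k ((1 - B.tot a) * (1 - B.tot b)) • pd b ∘ₗ pd a) (ext_word fun l => ?_) c
  simp only [LinearMap.comp_apply, LinearMap.smul_apply]
  induction l with
  | nil => simp [word_nil, pd_one]
  | cons i l ih =>
    simp only [word_cons, pd_x_mul, map_add, map_smul, smul_add, ih, smul_smul, mul_smul_comm]
    have e1 : ∀ (p q : B.ι), (if i = p then pd q (word k B l) else 0) =
        pd q (if i = p then word k B l else 0) := by
      intro p q; split_ifs <;> simp
    have e2 : ksign k ((B.tot b - 1) * (1 - B.tot i)) • (if i = a then pd b (word k B l) else 0) =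
        ksign k ((1 - B.tot a) * (1 - B.tot b)) • (if i = a then pd b (word k B l) else 0) := by
      split_ifs with h
      · subst h
        congr 1
        apply ksign_congr
        exact ⟨(B.tot b - 1) * (1 - B.tot i), by ring⟩
      · simp
    have e3 : (ksign k ((1 - B.tot a) * (1 - B.tot b)) * ksign k ((B.tot a - 1) * (1 - B.tot i))) •
          (if i = b then pd a (word k B l) else 0) = (if i = b then pd a (word k B l) else 0) := by
      split_ifs with h
      · subst h
        rw [← ksign_add, show (1 - B.tot a) * (1 - B.tot i) + (B.tot a - 1) * (1 - B.tot i) = 0 by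
          ring, ksign_zero, one_smul]
      · simp
    rw [← e1, ← e1, e2, e3]
    have e4 : ksign k ((B.tot b - 1) * (1 - B.tot i)) * (ksign k ((B.tot a - 1) * (1 - B.tot i)) *
        ksign k ((1 - B.tot a) * (1 - B.tot b))) = ksign k ((1 - B.tot a) * (1 - B.tot b)) *
        (ksign k ((B.tot a - 1) * (1 - B.tot i)) * ksign k ((B.tot b - 1) * (1 - B.tot i))) := by
      ring
    rw [e4]
    abel

theorem eq_sum_of_mem_lenEq_one {s : Finset B.ι} {c : Cochain k B} (hc : c ∈ cspan k (lenEq B 1))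
    (hs : ∀ i, coef i c ≠ 0 → i ∈ s) : c = ∑ i ∈ s, coef i c • x k B i := by
  classical
  rw [← linear_eq, linear, Finsupp.mem_span_range_iff_exists_finsupp] at hc
  obtain ⟨f, rfl⟩ := hc
  have h : ∀ j, coef j (f.sum fun i a => a • x k B i) = f j := by
    intro j
    rw [Finsupp.sum, map_sum]
    simp only [map_smul, coef_x, smul_eq_mul, mul_ite, mul_one, mul_zero, Finset.sum_ite_eq',
      Finsupp.mem_support_iff]
    split_ifs with h
    · rfl
    · exact (not_not.1 h).symm
  simp only [h] at hs ⊢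
  rw [Finsupp.sum]
  refine Finset.sum_subset (fun i hi => hs i (Finsupp.mem_support_iff.1 hi)) fun i _ hi => ?_
  rw [Finsupp.notMem_support_iff.1 hi, zero_smul]

/-- The coefficients of a quadratic cochain. -/
def coef₂ (a b : B.ι) : Cochain k B →ₗ[k] k := coef b ∘ₗ pd a

open Classical in
theorem coef₂_x_mul_x (a b m n : B.ι) : coef₂ a b (x k B m * x k B n) =
    (if m = a ∧ n = b then 1 else 0) +
      if m = b ∧ n = a then ksign k ((1 - B.tot m) * (1 - B.tot n)) else 0 := by
  rw [coef₂, LinearMap.comp_apply, pd_x_mul, pd_x, map_add, map_smul]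
  have h1 : coef b (if m = a then x k B n else 0) = if m = a ∧ n = b then (1 : k) else 0 := by
    by_cases h : m = a <;> simp [h, coef_x]
  have h2 : coef b (x k B m * if n = a then 1 else 0) = if m = b ∧ n = a then (1 : k) else 0 := by
    by_cases h : n = a <;> simp [h, coef_x]
  rw [h1, h2]
  congr 1
  split_ifs with h
  · obtain ⟨rfl, rfl⟩ := h
    rw [smul_eq_mul, mul_one]
    apply ksign_congr
    exact ⟨(B.tot n - 1) * (1 - B.tot m), by ring⟩
  · simp

theorem coef₂_swap (a b : B.ι) (c : Cochain k B) :
    coef₂ b a c = ksign k ((1 - B.tot a) * (1 - B.tot b)) * coef₂ a b c := by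
  simp only [coef₂, coef, LinearMap.comp_apply, AlgHom.toLinearMap_apply]
  rw [pd_pd, map_smul, smul_eq_mul]

theorem coef₂_of_mem {S : Set (Multiset B.ι)} {a b : B.ι} (hS : {a, b} ∉ S) :
    ∀ c ∈ cspan k S, coef₂ a b c = 0 := by
  intro c hc
  refine coef_of_mem (S := {s | a ::ₘ s ∈ S}) (by simpa using hS) _ (pd_mem (fun s hs => hs) c hc)

/-- Euler's identity with all weights equal to one has eigenvalue two on quadratic words; this is
the factor one half. -/
theorem eq_sum_of_mem_lenEq_two [CharZero k] {s : Finset B.ι} {c : Cochain k B}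
    (hc : c ∈ cspan k (lenEq B 2 ∩ {t | ∀ i ∈ t, i ∈ s})) :
    c = (2 : k)⁻¹ • ∑ a ∈ s, ∑ b ∈ s, coef₂ a b c • (x k B a * x k B b) := by
  have h : ∀ a ∈ cspan k (lenEq B 2 ∩ {t : Multiset B.ι | ∀ i ∈ t, i ∈ s}),
      (∑ j ∈ s, (1 : k) • LinearMap.mulLeft k (x k B j) ∘ₗ pd j) a =
      ((2 : k) • LinearMap.id : Cochain k B →ₗ[k] Cochain k B) a := by
    refine eqOn_cspan fun l hl => ?_
    simp only [LinearMap.sum_apply, LinearMap.smul_apply, LinearMap.comp_apply,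
      LinearMap.mulLeft_apply, LinearMap.id_apply]
    rw [euler_word s (fun j => (1 : k)) l fun i hi => Or.inl (hl.2 i (Multiset.mem_coe.2 hi))]
    have : l.length = 2 := hl.1
    simp [this, one_add_one_eq_two]
  have h1 := h c hc
  simp only [LinearMap.sum_apply, LinearMap.smul_apply, LinearMap.comp_apply,
      LinearMap.mulLeft_apply, LinearMap.id_apply, one_smul] at h1
  rw [eq_inv_smul_iff₀ two_ne_zero, ← h1]
  refine Finset.sum_congr rfl fun a ha => ?_
  have h2 : pd a c ∈ cspan k (lenEq B 1 ∩ {t : Multiset B.ι | ∀ i ∈ t, i ∈ s}) := by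
    refine pd_mem ?_ c hc
    rintro t ⟨ht1, ht2⟩
    refine ⟨?_, fun i hi => ht2 i (Multiset.mem_cons_of_mem hi)⟩
    simpa [lenEq] using ht1
  have h3 := eq_sum_of_mem_lenEq_one (s := s) (cspan_mono Set.inter_subset_left h2) (fun i hi => by
    by_contra hi'
    exact hi (coef_of_mem (fun h => hi' (h.2 i (by simp))) _ h2))
  conv_lhs => rw [h3, Finset.mul_sum]
  simp only [mul_smul_comm]
  rfl

/-- The cyclic sum of the coefficients of a cubic cochain. -/
def cyclicSum (k : Type u) [Field k] (B : BiBasis.{v}) (T : B.ι → B.ι → B.ι → k) (a b c : B.ι) : k :=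
  T a b c + ksign k ((1 - B.tot b) * (1 - B.tot c)) * T a c b +
    ksign k ((1 - B.tot a) * ((1 - B.tot b) + (1 - B.tot c))) * T b c a

/-- Renaming the summation indices so that each of the three letters in turn takes the last place
gives the same cubic with permuted coefficients. The sum of the three versions has the cyclic sums
as coefficients and equals three times the cubic. -/
theorem cubic_eq_zero [CharZero k] (s : Finset B.ι) (T : B.ι → B.ι → B.ι → k)
    (h : ∀ a b c, cyclicSum k B T a b c = 0) :
    ∑ a ∈ s, ∑ b ∈ s, ∑ c ∈ s, T a b c • (x k B a * x k B b * x k B c) = 0 := by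
  have e1 : ∑ a ∈ s, ∑ b ∈ s, ∑ c ∈ s, T a b c • (x k B a * x k B b * x k B c) =
      ∑ a ∈ s, ∑ b ∈ s, ∑ c ∈ s, (ksign k ((1 - B.tot b) * (1 - B.tot c)) * T a c b) •
        (x k B a * x k B b * x k B c) := by
    refine Finset.sum_congr rfl fun a _ => ?_
    rw [Finset.sum_comm]
    refine Finset.sum_congr rfl fun b _ => Finset.sum_congr rfl fun c _ => ?_
    rw [mul_assoc, x_comm c b, mul_smul_comm, smul_smul, ← mul_assoc, mul_comm (T a c b),
      mul_comm (1 - B.tot c)]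
  have e2 : ∑ a ∈ s, ∑ b ∈ s, ∑ c ∈ s, T a b c • (x k B a * x k B b * x k B c) =
      ∑ a ∈ s, ∑ b ∈ s, ∑ c ∈ s,
        (ksign k ((1 - B.tot a) * ((1 - B.tot b) + (1 - B.tot c))) * T b c a) •
        (x k B a * x k B b * x k B c) := by
    symm
    rw [Finset.sum_comm]
    refine Finset.sum_congr rfl fun b _ => ?_
    rw [Finset.sum_comm]
    refine Finset.sum_congr rfl fun c _ => Finset.sum_congr rfl fun a _ => ?_
    rw [graded_comm (mul_mem_totSet (x_mem_totSet b) (x_mem_totSet c)) (x_mem_totSet a), smul_smul,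
      mul_assoc (x k B a), mul_comm (T b c a), mul_comm _ (1 - B.tot a)]
  have e3 : (3 : k) • ∑ a ∈ s, ∑ b ∈ s, ∑ c ∈ s, T a b c • (x k B a * x k B b * x k B c) = 0 := by
    calc _ = ∑ a ∈ s, ∑ b ∈ s, ∑ c ∈ s, T a b c • (x k B a * x k B b * x k B c) +
          ∑ a ∈ s, ∑ b ∈ s, ∑ c ∈ s, T a b c • (x k B a * x k B b * x k B c) +
          ∑ a ∈ s, ∑ b ∈ s, ∑ c ∈ s, T a b c • (x k B a * x k B b * x k B c) := by module
      _ = ∑ a ∈ s, ∑ b ∈ s, ∑ c ∈ s, cyclicSum k B T a b c • (x k B a * x k B b * x k B c) := by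
        conv_lhs => enter [1, 2]; rw [e1]
        conv_lhs => enter [2]; rw [e2]
        simp only [← Finset.sum_add_distrib, ← add_smul]
        rfl
      _ = 0 := by simp [h]
  exact (smul_eq_zero.1 e3).resolve_left (by norm_num)

/-- Differentiating the vanishing cubic by `x^a`, `x^b`, `x^c` gives six terms. The symmetry of `T`
in its first two arguments pairs them, leaving twice the cyclic sum. -/
theorem cyclicSum_eq_zero [CharZero k] (s : Finset B.ι) (T : B.ι → B.ι → B.ι → k)
    (hT : ∀ a b c, T b a c = ksign k ((1 - B.tot a) * (1 - B.tot b)) * T a b c)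
    (h : ∑ a ∈ s, ∑ b ∈ s, ∑ c ∈ s, T a b c • (x k B a * x k B b * x k B c) = 0)
    {a b c : B.ι} (ha : a ∈ s) (hb : b ∈ s) (hc : c ∈ s) : cyclicSum k B T a b c = 0 := by
  classical
  have h1 : ∀ m n p, coef₂ b c (pd a (x k B m * x k B n * x k B p)) =
      (if m = a then (if n = b ∧ p = c then 1 else 0) +
        (if n = c ∧ p = b then ksign k ((1 - B.tot b) * (1 - B.tot c)) else 0) else 0) +
      (if n = a then (if m = b ∧ p = c then ksign k ((1 - B.tot a) * (1 - B.tot b)) else 0) +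
        (if m = c ∧ p = b then ksign k ((1 - B.tot a) * (1 - B.tot c)) *
          ksign k ((1 - B.tot b) * (1 - B.tot c)) else 0) else 0) +
      (if p = a then (if m = b ∧ n = c then
          ksign k ((1 - B.tot a) * ((1 - B.tot b) + (1 - B.tot c))) else 0) +
        (if m = c ∧ n = b then ksign k ((1 - B.tot a) * ((1 - B.tot b) + (1 - B.tot c))) *
          ksign k ((1 - B.tot b) * (1 - B.tot c)) else 0) else 0) := by
    intro m n p
    have hs : ∀ z, ksign k ((B.tot a - 1) * z) = ksign k ((1 - B.tot a) * z) := fun z =>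
      ksign_congr k ⟨(B.tot a - 1) * z, by ring⟩
    rw [mul_assoc, pd_x_mul, pd_x_mul, pd_x]
    simp only [map_add, map_smul, mul_add, smul_add, mul_smul_comm, mul_ite, mul_one, mul_zero,
      smul_ite, smul_zero, apply_ite (coef₂ b c), map_zero, coef₂_x_mul_x, smul_eq_mul, hs]
    rw [add_assoc]
    congr 1
    · refine if_congr Iff.rfl ?_ rfl
      congr 1
      refine ite_congr rfl (fun hh => ?_) fun _ => rfl
      rw [hh.1, hh.2, mul_comm (1 - B.tot c)]
    congr 1
    · refine if_congr Iff.rfl ?_ rfl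
      congr 1
      · refine ite_congr rfl (fun hh => ?_) fun _ => rfl
        rw [hh.1]
      · refine ite_congr rfl (fun hh => ?_) fun _ => rfl
        rw [hh.1, hh.2, mul_comm (1 - B.tot c) (1 - B.tot b)]
    · refine if_congr Iff.rfl ?_ rfl
      congr 1
      · refine ite_congr rfl (fun hh => ?_) fun _ => rfl
        rw [hh.1, hh.2, ← ksign_add]
      · refine ite_congr rfl (fun hh => ?_) fun _ => rfl
        rw [hh.1, hh.2, ← mul_assoc, ← ksign_add, mul_comm (1 - B.tot c) (1 - B.tot b)]
        ring_nf
  have h2 := congrArg (fun y => coef₂ b c (pd a y)) h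
  simp only [map_sum, map_smul, h1, map_zero] at h2
  simp only [smul_eq_mul, mul_add, mul_ite, mul_one, mul_zero, Finset.sum_add_distrib,
    ite_and, Finset.sum_ite_eq', Finset.sum_ite_irrel, Finset.sum_const_zero, ha, hb, hc, if_true,
    Finset.sum_add_distrib] at h2
  rw [hT a b c, hT a c b, hT b c a, ksign_add] at h2
  have hP := ksign_mul_self k ((1 - B.tot a) * (1 - B.tot b))
  have hQ := ksign_mul_self k ((1 - B.tot b) * (1 - B.tot c))
  have hR := ksign_mul_self k ((1 - B.tot a) * (1 - B.tot c))
  have h3 : (2 : k) * cyclicSum k B T a b c = 0 := by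
    rw [cyclicSum, mul_add (1 - B.tot a), ksign_add]
    linear_combination h2 - T a b c * hP - T a c b * ksign k ((1 - B.tot b) * (1 - B.tot c)) * hR -
      T b c a * ksign k ((1 - B.tot a) * (1 - B.tot b)) * ksign k ((1 - B.tot a) * (1 - B.tot c)) * hQ
  exact (mul_eq_zero.1 h3).resolve_left two_ne_zero

end Cochain

/-! ### The Lie algebra of a quadratic differential -/

namespace LInf

open Cochain

variable {k : Type u} [Field k] {A : LInf.{u, v} k}

/-- The structure constants of a quadratic differential. -/
def kap (A : LInf.{u, v} k) (l a b : A.ι) : k := coef₂ a b (A.d (A.x l))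

theorem degree_of_kap_ne_zero {l a b : A.ι} (h : A.kap l a b ≠ 0) :
    A.coh l = A.coh a + A.coh b ∧ A.int l = A.int a + A.int b := by
  by_contra hc
  refine h (coef₂_of_mem ?_ _ (A.d_mem_biSet (x_mem_biSet l)))
  rintro ⟨h1, h2⟩
  simp only [Multiset.insert_eq_cons, Multiset.map_cons, Multiset.map_singleton, Multiset.sum_cons,
    Multiset.sum_singleton] at h1 h2
  exact hc ⟨by omega, by omega⟩

theorem tot_of_kap_ne_zero {l a b : A.ι} (h : A.kap l a b ≠ 0) : A.tot l = A.tot a + A.tot b := by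
  obtain ⟨h1, h2⟩ := degree_of_kap_ne_zero h
  simp only [BiBasis.tot]
  omega

theorem kap_swap (l a b : A.ι) :
    A.kap l b a = ksign k ((1 - A.tot a) * (1 - A.tot b)) * A.kap l a b := coef₂_swap a b _

/-- The finite set of indices of internal degree at most `n`. -/
def idx (A : LInf.{u, v} k) (n : ℤ) : Finset A.ι := (A.finite_le n).toFinset

theorem mem_idx {n : ℤ} {i : A.ι} : i ∈ A.idx n ↔ A.int i ≤ n := by simp [idx]

theorem cspan_intSet_le {n : ℤ} {S : Set (Multiset A.ι)} {c : Cochain k A.toBiBasis}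
    (hS : c ∈ cspan k S) (hc : c ∈ cspan k (intSet A.toBiBasis n)) {N : ℤ} (hn : n ≤ N) :
    c ∈ cspan k (S ∩ {t | ∀ i ∈ t, i ∈ A.idx N}) := by
  refine cspan_mono ?_ (mem_cspan_inter hS hc)
  rintro t ⟨h1, h2⟩
  refine ⟨h1, fun i hi => mem_idx.2 ?_⟩
  have := A.int_le_of_mem hi
  have h2 : (t.map A.int).sum = n := h2
  omega

theorem IsQuadratic.d_x_eq [CharZero k] (hA : A.IsQuadratic) {N : ℤ} {l : A.ι} (hl : A.int l ≤ N) :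
    A.d (A.x l) = (2 : k)⁻¹ • ∑ a ∈ A.idx N, ∑ b ∈ A.idx N, A.kap l a b • (A.x a * A.x b) :=
  eq_sum_of_mem_lenEq_two (cspan_intSet_le (hA l) (A.d_mem_intSet (x_mem_intSet l)) hl)

/-- By graded symmetry of `τ` the two Leibniz terms have equal sums, which cancels the factor one
half; the one on the right comes from the expansion of `d x^m`. -/
theorem IsQuadratic.d_sum_eq [CharZero k] (hA : A.IsQuadratic) (N : ℤ) (τ : A.ι → A.ι → k)
    (hτ : ∀ a b, τ b a = ksign k ((1 - A.tot a) * (1 - A.tot b)) * τ a b) :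
    A.d ((2 : k)⁻¹ • ∑ m ∈ A.idx N, ∑ n ∈ A.idx N, τ m n • (A.x m * A.x n)) =
      (2 : k)⁻¹ • ∑ a ∈ A.idx N, ∑ b ∈ A.idx N, ∑ n ∈ A.idx N,
        (∑ m ∈ A.idx N, τ m n * A.kap m a b) • (A.x a * A.x b * A.x n) := by
  set s := A.idx N with hs
  have h1 : A.d (∑ m ∈ s, ∑ n ∈ s, τ m n • (A.x m * A.x n)) =
      (2 : k) • ∑ m ∈ s, ∑ n ∈ s, τ m n • (A.d (A.x m) * A.x n) := by
    simp only [map_sum, map_smul, d_x_mul, smul_add, Finset.sum_add_distrib]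
    rw [two_smul]
    congr 1
    rw [Finset.sum_comm]
    refine Finset.sum_congr rfl fun m _ => Finset.sum_congr rfl fun n _ => ?_
    rw [x_mul_comm n (A.d_mem_totSet (x_mem_totSet m)), smul_smul, smul_smul, hτ m n]
    congr 1
    have h := (ksign_congr k (m := (1 - A.tot m) * (1 - A.tot n) + (1 - A.tot n) +
      (1 - A.tot n) * (1 - A.tot m + 1)) (n := 0) ⟨(1 - A.tot n) * (2 - A.tot m), by ring⟩)
    rw [ksign_add, ksign_add, ksign_zero] at h
    linear_combination τ m n * h
  rw [map_smul, h1, smul_smul, inv_mul_cancel₀ two_ne_zero, one_smul]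
  have h2 : ∀ m ∈ s, ∀ n, τ m n • (A.d (A.x m) * A.x n) = (2 : k)⁻¹ • ∑ a ∈ s, ∑ b ∈ s,
      (τ m n * A.kap m a b) • (A.x a * A.x b * A.x n) := by
    intro m hm n
    rw [hA.d_x_eq (mem_idx.1 hm), smul_mul_assoc, smul_comm, Finset.sum_mul, Finset.smul_sum]
    simp only [Finset.sum_mul, Finset.smul_sum, smul_mul_assoc, smul_smul]
    rfl
  rw [Finset.sum_congr rfl fun m hm => Finset.sum_congr rfl fun n _ => h2 m hm n]
  simp only [← Finset.smul_sum]
  congr 1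
  simp only [Finset.sum_smul]
  have h3 : ∀ F : A.ι → A.ι → A.ι → A.ι → Cochain k A.toBiBasis,
      ∑ m ∈ s, ∑ n ∈ s, ∑ a ∈ s, ∑ b ∈ s, F m n a b =
      ∑ a ∈ s, ∑ b ∈ s, ∑ n ∈ s, ∑ m ∈ s, F m n a b := by
    intro F
    calc _ = ∑ m ∈ s, ∑ a ∈ s, ∑ n ∈ s, ∑ b ∈ s, F m n a b :=
          Finset.sum_congr rfl fun m _ => Finset.sum_comm
      _ = ∑ a ∈ s, ∑ m ∈ s, ∑ n ∈ s, ∑ b ∈ s, F m n a b := Finset.sum_comm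
      _ = ∑ a ∈ s, ∑ m ∈ s, ∑ b ∈ s, ∑ n ∈ s, F m n a b :=
          Finset.sum_congr rfl fun a _ => Finset.sum_congr rfl fun m _ => Finset.sum_comm
      _ = ∑ a ∈ s, ∑ b ∈ s, ∑ m ∈ s, ∑ n ∈ s, F m n a b :=
          Finset.sum_congr rfl fun a _ => Finset.sum_comm
      _ = _ := Finset.sum_congr rfl fun a _ => Finset.sum_congr rfl fun b _ => Finset.sum_comm
  exact h3 _

/-- The matrix of a bracket corresponding to that of a quadratic cochain. -/
def brCoef (A : LInf.{u, v} k) (τ : A.ι → A.ι → k) (a b : A.ι) : k :=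
  -(ksign k (A.tot a * (A.tot b + 1)) * τ a b)

theorem brCoef_brCoef (τ : A.ι → A.ι → k) : A.brCoef (A.brCoef τ) = τ := by
  ext a b
  rw [brCoef, brCoef, mul_neg, neg_neg, ← mul_assoc, ksign_mul_self, one_mul]

/-- Up to an overall sign the two conditions are the same equation; `brCoef` carries the signs of
the shift between brackets and cochains. The outer bracket `τ` is independent of the inner one: with
`τ = kap r` this is the Jacobi identity of the algebra, and with the brackets of images of a partial
homomorphism it is the Jacobi identity of the target. -/
theorem jacobi_iff (s : Finset A.ι) (τ : A.ι → A.ι → k)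
    (hτ : ∀ a b, τ b a = ksign k ((1 - A.tot a) * (1 - A.tot b)) * τ a b) (a b n : A.ι) :
    ∑ m ∈ s, A.brCoef (A.kap m) b n * A.brCoef τ a m =
      ∑ m ∈ s, A.brCoef (A.kap m) a b * A.brCoef τ m n +
      ksign k (A.tot a * A.tot b) * ∑ m ∈ s, A.brCoef (A.kap m) a n * A.brCoef τ b m ↔
    cyclicSum k A.toBiBasis (fun a b n => ∑ m ∈ s, τ m n * A.kap m a b) a b n = 0 := by
  have h1 : ∀ a b n, ∑ m ∈ s, A.brCoef (A.kap m) b n * A.brCoef τ a m =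
      ksign k (A.tot b * (A.tot n + 1) + A.tot a * (A.tot b + A.tot n + 1) +
        (1 - (A.tot b + A.tot n)) * (1 - A.tot a)) * ∑ m ∈ s, τ m a * A.kap m b n := by
    intro a b n
    rw [Finset.mul_sum]
    refine Finset.sum_congr rfl fun m _ => ?_
    by_cases hk : A.kap m b n = 0
    · simp [hk, brCoef]
    · rw [brCoef, brCoef, hτ m a, tot_of_kap_ne_zero hk, ksign_add, ksign_add]
      ring
  have h2 : ∑ m ∈ s, A.brCoef (A.kap m) a b * A.brCoef τ m n =
      ksign k (A.tot a * (A.tot b + 1) + (A.tot a + A.tot b) * (A.tot n + 1)) *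
        ∑ m ∈ s, τ m n * A.kap m a b := by
    rw [Finset.mul_sum]
    refine Finset.sum_congr rfl fun m _ => ?_
    by_cases hk : A.kap m a b = 0
    · simp [hk, brCoef]
    · rw [brCoef, brCoef, tot_of_kap_ne_zero hk, ksign_add]
      ring
  rw [h1 a b n, h1 b a n, h2]
  simp only [cyclicSum]
  generalize ∑ m ∈ s, τ m a * A.kap m b n = T₃
  generalize ∑ m ∈ s, τ m n * A.kap m a b = T₁
  generalize ∑ m ∈ s, τ m b * A.kap m a n = T₂
  generalize A.tot a = ta
  generalize A.tot b = tb
  generalize A.tot n = tn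
  -- Only parities enter the signs. In each of the eight cases the equations agree or are opposite.
  by_cases ha : Even ta <;> by_cases hb : Even tb <;> by_cases hn : Even tn <;>
    simp only [ksign_eq, ha, hb, hn, Int.even_add, Int.even_sub, Int.even_mul, Int.not_even_one,
      iff_true, iff_false, not_true_eq_false, or_true, or_false, or_self, iff_self, if_true, if_false] <;>
    constructor <;> intro h <;> first | linear_combination h | linear_combination -h

/-- The cubic cochain `d (d x^r) = 0`, read off in coefficients. -/
theorem kap_cyclic [CharZero k] (hA : A.IsQuadratic) {N : ℤ} {r a b n : A.ι} (hr : A.int r ≤ N)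
    (ha : A.int a ≤ N) (hb : A.int b ≤ N) (hn : A.int n ≤ N) :
    cyclicSum k A.toBiBasis (fun a b n => ∑ m ∈ A.idx N, A.kap r m n * A.kap m a b) a b n = 0 := by
  refine cyclicSum_eq_zero (A.idx N) _ (fun a b c => ?_) ?_ (mem_idx.2 ha) (mem_idx.2 hb)
    (mem_idx.2 hn)
  · rw [Finset.mul_sum]
    refine Finset.sum_congr rfl fun m _ => ?_
    rw [kap_swap m a b]
    ring
  · have h := hA.d_sum_eq N (A.kap r) (kap_swap r)
    rw [← hA.d_x_eq hr, A.d_d] at h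
    exact (smul_eq_zero.1 h.symm).resolve_left (inv_ne_zero two_ne_zero)

/-- The bracket of two basis vectors. -/
def brBasis (A : LInf.{u, v} k) (a b : A.ι) : A.ι →₀ k :=
  ∑ l ∈ A.idx (A.int a + A.int b), Finsupp.single l (A.brCoef (A.kap l) a b)

theorem brCoef_kap_ne_zero {l a b : A.ι} (h : A.brCoef (A.kap l) a b ≠ 0) : A.kap l a b ≠ 0 := by
  rintro h0
  simp [brCoef, h0] at h

theorem brBasis_apply (a b l : A.ι) : A.brBasis a b l = A.brCoef (A.kap l) a b := by
  classical
  rw [brBasis, Finsupp.finsetSum_apply]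
  simp only [Finsupp.single_apply, Finset.sum_ite_eq', mem_idx]
  split_ifs with h
  · rfl
  · by_contra h0
    exact h (degree_of_kap_ne_zero (brCoef_kap_ne_zero (Ne.symm h0))).2.le

/-- The bracket defined by a quadratic differential. -/
def lieBr (A : LInf.{u, v} k) : (A.ι →₀ k) →ₗ[k] (A.ι →₀ k) →ₗ[k] (A.ι →₀ k) :=
  Finsupp.linearCombination k fun a => Finsupp.linearCombination k (A.brBasis a)

theorem lieBr_e (a b : A.ι) : A.lieBr (A.e k a) (A.e k b) = A.brBasis a b := by
  simp [lieBr, BiBasis.e]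

theorem eq_sum_e {s : Finset A.ι} {y : A.ι →₀ k} (h : ∀ i, y i ≠ 0 → i ∈ s) :
    y = ∑ i ∈ s, y i • A.e k i := by
  conv_lhs => rw [← y.sum_single]
  rw [Finsupp.sum_of_support_subset _ (fun i hi => h i (Finsupp.mem_support_iff.1 hi))]
  · simp [BiBasis.e]
  · simp

theorem brBasis_eq_sum {a b : A.ι} {N : ℤ} (h : A.int a + A.int b ≤ N) :
    A.brBasis a b = ∑ m ∈ A.idx N, A.brCoef (A.kap m) a b • A.e k m := by
  rw [eq_sum_e (y := A.brBasis a b) (s := A.idx N)]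
  · simp only [brBasis_apply]
  · intro i hi
    rw [brBasis_apply] at hi
    have := (degree_of_kap_ne_zero (brCoef_kap_ne_zero hi)).2
    exact mem_idx.2 (by omega)

theorem brCoef_kap_swap (l a b : A.ι) : A.brCoef (A.kap l) a b =
    -(ksign k (A.tot a * A.tot b) * A.brCoef (A.kap l) b a) := by
  rw [brCoef, brCoef, kap_swap l a b]
  generalize A.tot a = ta
  generalize A.tot b = tb
  by_cases ha : Even ta <;> by_cases hb : Even tb <;>
    simp only [ksign_eq, ha, hb, Int.even_add, Int.even_sub, Int.even_mul, Int.not_even_one,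
      iff_true, iff_false, not_true_eq_false, or_true, or_false, or_self, iff_self,
      if_true, if_false] <;> ring

/-- The bigraded Lie algebra defined by a quadratic differential. -/
def IsQuadratic.lie [CharZero k] (hA : A.IsQuadratic) : BiLie k A.toBiBasis where
  br := A.lieBr
  br_mem a b := by
    rw [lieBr_e, BiBasis.component, Finsupp.mem_supported]
    intro l hl
    have hl : A.brBasis a b l ≠ 0 := by simpa using hl
    rw [brBasis_apply] at hl
    exact degree_of_kap_ne_zero (brCoef_kap_ne_zero hl)
  antisymm a b := by
    rw [lieBr_e, lieBr_e]
    ext l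
    rw [Finsupp.neg_apply, Finsupp.smul_apply, brBasis_apply, brBasis_apply, smul_eq_mul,
      brCoef_kap_swap]
  jacobi a b n := by
    have ha := A.int_pos a
    have hb := A.int_pos b
    have hn := A.int_pos n
    simp only [lieBr_e]
    ext r
    have hr := A.int_pos r
    -- Any common bound for the internal degrees of all indices involved would do.
    set N := A.int r + A.int a + A.int b + A.int n with hN
    rw [brBasis_eq_sum (a := b) (b := n) (N := N) (by omega),
      brBasis_eq_sum (a := a) (b := b) (N := N) (by omega),
      brBasis_eq_sum (a := a) (b := n) (N := N) (by omega)]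
    simp only [map_sum, map_smul, LinearMap.sum_apply, LinearMap.smul_apply, lieBr_e,
      Finsupp.add_apply, Finsupp.finsetSum_apply, Finsupp.smul_apply, brBasis_apply, smul_eq_mul]
    exact (jacobi_iff (A.idx N) (A.kap r) (kap_swap r) a b n).2
      (kap_cyclic hA (by omega) (by omega) (by omega) (by omega))

theorem IsQuadratic.isStrict [CharZero k] (hA : A.IsQuadratic) : A.IsStrict hA.lie := by
  intro l
  rw [hA.d_x_eq le_rfl, ← smul_neg]
  congr 1
  rw [← Finset.sum_neg_distrib]
  refine Finset.sum_congr rfl fun a _ => ?_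
  rw [← Finset.sum_neg_distrib]
  refine Finset.sum_congr rfl fun b _ => ?_
  rw [← neg_smul]
  congr 1
  change _ = -(_ * A.lieBr _ _ l)
  rw [lieBr_e, brBasis_apply, ← congrFun (congrFun (brCoef_brCoef (A.kap l)) a) b, brCoef]

end LInf

/-! ### Partially defined homomorphisms -/

section BiLie

variable {k : Type u} [Field k] {B : BiBasis.{v}}

theorem BiBasis.component_le {c n : ℤ} {N : Submodule k (B.ι →₀ k)} :
    B.component k c n ≤ N ↔ ∀ i, B.coh i = c → B.int i = n → B.e k i ∈ N := by
  rw [BiBasis.component, Finsupp.supported_eq_span_single, Submodule.span_le]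
  constructor
  · intro h i h1 h2
    exact h ⟨i, ⟨h1, h2⟩, rfl⟩
  · rintro h _ ⟨i, ⟨h1, h2⟩, rfl⟩
    exact h i h1 h2

theorem BiBasis.e_mem (i : B.ι) : B.e k i ∈ B.component k (B.coh i) (B.int i) :=
  BiBasis.component_le.1 le_rfl i rfl rfl

theorem BiBasis.eqOn_component {N : Type*} [AddCommGroup N] [Module k N] {c n : ℤ}
    {f g : (B.ι →₀ k) →ₗ[k] N} (h : ∀ i, B.coh i = c → B.int i = n → f (B.e k i) = g (B.e k i)) :
    ∀ y ∈ B.component k c n, f y = g y := fun _ hy =>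
  (BiBasis.component_le (N := LinearMap.eqLocus f g)).2 h hy

theorem BiBasis.map_component {N : Type*} [AddCommGroup N] [Module k N] {c n : ℤ}
    {f : (B.ι →₀ k) →ₗ[k] N} {M : Submodule k N}
    (h : ∀ i, B.coh i = c → B.int i = n → f (B.e k i) ∈ M) :
    ∀ y ∈ B.component k c n, f y ∈ M := fun _ hy =>
  (BiBasis.component_le (N := M.comap f)).2 h hy

namespace BiLie

variable (L : BiLie k B)

theorem br_mem_of_mem {c n c' n' : ℤ} {a b : B.ι →₀ k} (ha : a ∈ B.component k c n)
    (hb : b ∈ B.component k c' n') : L.br a b ∈ B.component k (c + c') (n + n') := by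
  refine BiBasis.map_component (f := L.br.flip b) (fun i hi hi' => ?_) a ha
  refine BiBasis.map_component (f := L.br (B.e k i)) (fun j hj hj' => ?_) b hb
  subst hi hi' hj hj'
  exact L.br_mem i j

theorem antisymm_of_mem {c n c' n' : ℤ} {a b : B.ι →₀ k} (ha : a ∈ B.component k c n)
    (hb : b ∈ B.component k c' n') :
    L.br a b = -(ksign k ((c + n) * (c' + n')) • L.br b a) := by
  refine BiBasis.eqOn_component (f := L.br.flip b)
    (g := -(ksign k ((c + n) * (c' + n')) • L.br b)) (fun i hi hi' => ?_) a ha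
  refine BiBasis.eqOn_component (f := L.br (B.e k i))
    (g := -(ksign k ((c + n) * (c' + n')) • L.br.flip (B.e k i))) (fun j hj hj' => ?_) b hb
  subst hi hi' hj hj'
  exact L.antisymm i j

theorem jacobi_of_mem {c n c' n' c'' n'' : ℤ} {x y z : B.ι →₀ k} (hx : x ∈ B.component k c n)
    (hy : y ∈ B.component k c' n') (hz : z ∈ B.component k c'' n'') :
    L.br x (L.br y z) = L.br (L.br x y) z +
      ksign k ((c + n) * (c' + n')) • L.br y (L.br x z) := by
  refine BiBasis.eqOn_component (f := L.br.flip (L.br y z)) (g := L.br.flip z ∘ₗ L.br.flip y +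
    ksign k ((c + n) * (c' + n')) • (L.br y ∘ₗ L.br.flip z)) (fun i hi hi' => ?_) x hx
  refine BiBasis.eqOn_component (f := L.br (B.e k i) ∘ₗ L.br.flip z)
    (g := L.br.flip z ∘ₗ L.br (B.e k i) +
    ksign k ((c + n) * (c' + n')) • L.br.flip (L.br (B.e k i) z)) (fun j hj hj' => ?_) y hy
  refine BiBasis.eqOn_component (f := L.br (B.e k i) ∘ₗ L.br (B.e k j))
    (g := L.br (L.br (B.e k i) (B.e k j)) +
    ksign k ((c + n) * (c' + n')) • (L.br (B.e k j) ∘ₗ L.br (B.e k i))) (fun l hl hl' => ?_) z hz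
  subst hi hi' hj hj'
  exact L.jacobi i j l

end BiLie

end BiLie

/-! ### Brackets, linear cocycles and uniqueness of homomorphisms -/

namespace LInf

open Cochain

variable {k : Type u} [Field k] {A : LInf.{u, v} k}

theorem component_eq_zero {c n : ℤ} (hn : n ≤ 0) {y : A.ι →₀ k}
    (hy : y ∈ A.component k c n) : y = 0 :=
  (BiBasis.component_le (N := ⊥)).2 (fun i _ hi => absurd (A.int_pos i) (by omega)) hy

/-- The pairing of vectors with the linear parts of cochains. -/
def pair (A : LInf.{u, v} k) : (A.ι →₀ k) →ₗ[k] Cochain k A.toBiBasis →ₗ[k] k :=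
  Finsupp.linearCombination k fun l => coef l

theorem pair_e (i : A.ι) : A.pair (A.e k i) = coef i := by simp [pair, BiBasis.e]

theorem pair_x (y : A.ι →₀ k) (i : A.ι) : A.pair y (A.x i) = y i := by
  classical
  refine LinearMap.congr_fun (f := A.pair.flip (A.x i)) (g := Finsupp.lapply i) ?_ y
  ext j
  have := LinearMap.congr_fun (A.pair_e j) (A.x i)
  rw [coef_x] at this
  simpa [BiBasis.e, Finsupp.single_apply, eq_comm] using this

/-- The bracket is the transpose of the differential from linear to quadratic cochains. In
particular linear cocycles pair to zero with all brackets. -/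
theorem pair_brBasis {u : Cochain k A.toBiBasis} (hu : u ∈ linear k A.toBiBasis) (a b : A.ι) :
    A.pair (A.brBasis a b) u = A.brCoef (fun a b => coef₂ a b (A.d u)) a b := by
  induction hu using Submodule.span_induction with
  | mem u h =>
    obtain ⟨i, rfl⟩ := h
    rw [pair_x, brBasis_apply]
    rfl
  | zero => simp [brCoef]
  | add u u' _ _ h h' => rw [map_add, h, h']; simp only [brCoef, map_add]; ring
  | smul r u _ h => rw [map_smul, h]; simp only [brCoef, map_smul, smul_eq_mul]; ring

theorem brBasis_mem (a b : A.ι) :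
    A.brBasis a b ∈ A.component k (A.coh a + A.coh b) (A.int a + A.int b) := by
  rw [BiBasis.component, Finsupp.mem_supported]
  intro l hl
  have hl : A.brBasis a b l ≠ 0 := by simpa using hl
  rw [brBasis_apply] at hl
  exact degree_of_kap_ne_zero (brCoef_kap_ne_zero hl)

/-- The linear cocycles are the annihilator of the brackets. Were `y` outside the span of the
brackets, a functional would separate it from them; read as a linear cochain, that functional has
zero differential, yet pairs nontrivially with `y`. -/
theorem IsQuadratic.mem_span_brBasis [CharZero k] (hA : A.IsQuadratic) {c n : ℤ} {y : A.ι →₀ k}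
    (hy : y ∈ A.component k c n) (h : ∀ u ∈ A.linCocycles (1 - c) (-n), A.pair y u = 0) :
    y ∈ Submodule.span k {z | ∃ a b, A.int a + A.int b = n ∧ z = A.brBasis a b} := by
  classical
  by_contra hy'
  obtain ⟨f, hf, hf'⟩ := Submodule.exists_dual_map_eq_bot_of_notMem hy' inferInstance
  have hf' : ∀ a b, A.int a + A.int b = n → f (A.brBasis a b) = 0 := by
    intro a b hab
    have h1 : f (A.brBasis a b) ∈ Submodule.map f (Submodule.span k
      {z | ∃ a b, A.int a + A.int b = n ∧ z = A.brBasis a b}) :=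
      Submodule.mem_map_of_mem (Submodule.subset_span ⟨a, b, hab, rfl⟩)
    rw [hf'] at h1
    exact h1
  -- Only the component of bidegree `(c, n)` of the functional is kept: this makes the cochain a
  -- finite sum and bihomogeneous.
  set u : Cochain k A.toBiBasis :=
    ∑ l ∈ A.idx n with A.coh l = c ∧ A.int l = n, f (A.e k l) • A.x l with hu
  have hcoef : ∀ i, coef i u = if A.coh i = c ∧ A.int i = n then f (A.e k i) else 0 := by
    intro i
    simp only [hu, map_sum, map_smul, coef_x, smul_eq_mul, mul_ite, mul_one, mul_zero,
      Finset.sum_ite_eq', Finset.mem_filter, mem_idx]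
    refine if_congr ⟨fun h => h.2, fun h => ⟨h.2.le, h⟩⟩ rfl rfl
  have h1 : ∀ z ∈ A.component k c n, A.pair z u = f z := by
    refine BiBasis.eqOn_component (f := A.pair.flip u) fun i hi hi' => ?_
    rw [LinearMap.flip_apply, pair_e, hcoef, if_pos ⟨hi, hi'⟩]
  have h2 : ∀ c' n', (c', n') ≠ (c, n) → ∀ z ∈ A.component k c' n', A.pair z u = 0 := by
    intro c' n' hne
    refine BiBasis.eqOn_component (f := A.pair.flip u) (g := 0) fun i hi hi' => ?_
    rw [LinearMap.flip_apply, pair_e, hcoef, if_neg, LinearMap.zero_apply]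
    rintro ⟨h1, h2⟩
    exact hne (by rw [← h1, ← h2, hi, hi'])
  have hlin : u ∈ linear k A.toBiBasis :=
    Submodule.sum_mem _ fun l _ => Submodule.smul_mem _ _ (Submodule.subset_span ⟨l, rfl⟩)
  have hpiece : u ∈ piece k A.toBiBasis (1 - c) (-n) := by
    refine Submodule.sum_mem _ fun l hl => Submodule.smul_mem _ _ ?_
    obtain ⟨-, rfl, rfl⟩ := Finset.mem_filter.1 hl
    exact x_mem_piece l
  have hint : u ∈ cspan k (intSet A.toBiBasis n) := by
    rw [piece_eq] at hpiece
    simpa using cspan_mono (biSet_subset_intSet _ _) hpiece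
  have hd : A.d u = 0 := by
    have h3 := hA.d_mem_lenEq (by rwa [linear_eq] at hlin : u ∈ cspan k (lenEq A.toBiBasis 1))
    rw [eq_sum_of_mem_lenEq_two (cspan_intSet_le h3 (A.d_mem_intSet hint) le_rfl)]
    refine smul_eq_zero_of_right _ (Finset.sum_eq_zero fun a _ => Finset.sum_eq_zero fun b _ => ?_)
    have h4 : A.pair (A.brBasis a b) u = 0 := by
      by_cases hab : (A.coh a + A.coh b, A.int a + A.int b) = (c, n)
      · obtain ⟨h5, h6⟩ := Prod.mk.inj hab
        rw [h1 _ (by have := A.brBasis_mem a b; rwa [h5, h6] at this), hf' a b h6]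
      · exact h2 _ _ hab _ (A.brBasis_mem a b)
    rw [pair_brBasis hlin, brCoef, neg_eq_zero] at h4
    rw [(mul_eq_zero.1 h4).resolve_left (ksign_ne_zero k _), zero_smul]
  exact hf (by rw [← h1 y hy, h u ⟨⟨hd, hlin⟩, hpiece⟩])

section Universal

variable {V : ℤ → ℤ → Type w} [∀ c n, AddCommGroup (V c n)] [∀ c n, Module k (V c n)]
  {B' : BiBasis.{v}} (L' : BiLie k B') (j : ∀ c n, V c n →ₗ[k] (A.ι →₀ k))
  (f : ∀ c n, V c n →ₗ[k] (B'.ι →₀ k))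

/-- A linear map that is a Lie algebra homomorphism extending `f` in internal degrees less
than `N`. -/
structure IsPartialHom (N : ℤ) (φ : (A.ι →₀ k) →ₗ[k] (B'.ι →₀ k)) : Prop where
  map_e : ∀ i, φ (A.e k i) ∈ B'.component k (A.coh i) (A.int i)
  map_br : ∀ a b, A.int a + A.int b < N →
    φ (A.brBasis a b) = L'.br (φ (A.e k a)) (φ (A.e k b))
  map_j : ∀ c n a, n < N → φ (j c n a) = f c n a

variable {L' j f}

/-- Every homogeneous vector is the image of a generator plus a sum of brackets of vectors of
smaller internal degree: choose the generator with the same pairing with linear cocycles, and the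
difference is a sum of brackets. On those the two maps agree by induction. -/
theorem IsPartialHom.eqOn [CharZero k] (hA : A.IsQuadratic)
    (θ : ∀ c n, V c n ≃ₗ[k] Module.Dual k (A.linCocycles (1 - c) (-n)))
    (hj : ∀ c n a, j c n a ∈ A.component k c n)
    (hθ : ∀ c n a (u : A.linCocycles (1 - c) (-n)), A.pair (j c n a) u = θ c n a u)
    {N : ℤ} {φ φ' : (A.ι →₀ k) →ₗ[k] (B'.ι →₀ k)} (h : IsPartialHom L' j f N φ)
    (h' : IsPartialHom L' j f N φ') (m : ℕ) : ∀ c n, n < N → n ≤ m →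
    ∀ y ∈ A.component k c n, φ y = φ' y := by
  induction m with
  | zero =>
    intro c n _ hn y hy
    rw [component_eq_zero (by simpa using hn) hy, map_zero, map_zero]
  | succ m ih =>
    intro c n hN hn y hy
    -- The generator having the same class as `y` modulo brackets.
    set a := (θ c n).symm (A.pair y ∘ₗ (A.linCocycles (1 - c) (-n)).subtype) with ha
    have h1 : y - j c n a ∈ Submodule.span k {z | ∃ a b, A.int a + A.int b = n ∧
        z = A.brBasis a b} := by
      refine hA.mem_span_brBasis (Submodule.sub_mem _ hy (hj c n a)) fun u hu => ?_
      rw [map_sub, LinearMap.sub_apply, hθ c n a ⟨u, hu⟩, ha, LinearEquiv.apply_symm_apply]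
      exact sub_self _
    have h2 : φ (y - j c n a) = φ' (y - j c n a) := by
      refine LinearMap.eqOn_span' (f := φ) (g := φ') ?_ h1
      rintro _ ⟨a, b, hab, rfl⟩
      have ha := A.int_pos a
      have hb := A.int_pos b
      rw [h.map_br a b (by omega), h'.map_br a b (by omega),
        ih _ _ (by omega) (by push_cast at hn; omega) _ (BiBasis.e_mem a),
        ih _ _ (by omega) (by push_cast at hn; omega) _ (BiBasis.e_mem b)]
    rw [map_sub, map_sub, h.map_j c n a hN, h'.map_j c n a hN] at h2
    exact sub_left_injective h2

end Universal

end LInf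

/-! ### The universal property -/

namespace LInf

open Cochain

variable {k : Type u} [Field k] {A : LInf.{u, v} k}

/-- Serves to replace a primitive of a quadratic cocycle by its linear part. -/
theorem IsQuadratic.d_cproj_lenEq (hA : A.IsQuadratic) (m : ℕ) (a : Cochain k A.toBiBasis) :
    A.d (cproj (lenEq A.toBiBasis m) a) = cproj (lenEq A.toBiBasis (m + 1)) (A.d a) := by
  refine LinearMap.congr_fun (f := A.d ∘ₗ cproj (lenEq A.toBiBasis m))
    (g := cproj (lenEq A.toBiBasis (m + 1)) ∘ₗ A.d) (ext_word fun l => ?_) a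
  simp only [LinearMap.comp_apply]
  have h := hA.d_mem_lenEq (word_mem_cspan (k := k) (show (l : Multiset A.ι) ∈ lenEq _ l.length
    from rfl))
  rw [cproj_word]
  split_ifs with hl
  · have hl : l.length = m := hl
    rw [hl] at h
    rw [cproj_of_mem h]
  · rw [map_zero, cproj_eq_zero _ h]
    rw [Set.disjoint_left]
    intro s h1 h2
    have h1 : s.card = m + 1 := h1
    have h2 : s.card = l.length + 1 := h2
    exact hl (by change l.length = m; omega)

section Universal

variable {V : ℤ → ℤ → Type w} [∀ c n, AddCommGroup (V c n)] [∀ c n, Module k (V c n)]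
  {B' : BiBasis.{v}} {L' : BiLie k B'} {j : ∀ c n, V c n →ₗ[k] (A.ι →₀ k)}
  {f : ∀ c n, V c n →ₗ[k] (B'.ι →₀ k)} {N : ℤ} {φ : (A.ι →₀ k) →ₗ[k] (B'.ι →₀ k)}

open Classical in
/-- A coordinate of the brackets of the images of basis vectors whose internal degrees add up
to `N`. -/
def imageBr (A : LInf.{u, v} k) (L' : BiLie k B') (φ : (A.ι →₀ k) →ₗ[k] (B'.ι →₀ k)) (N : ℤ)
    (m : B'.ι) (a b : A.ι) : k :=
  if A.int a + A.int b = N then L'.br (φ (A.e k a)) (φ (A.e k b)) m else 0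

theorem IsPartialHom.brCoef_swap (h : IsPartialHom L' j f N φ) (m : B'.ι) (a b : A.ι) :
    A.brCoef (imageBr A L' φ N m) b a =
      ksign k ((1 - A.tot a) * (1 - A.tot b)) * A.brCoef (imageBr A L' φ N m) a b := by
  have h1 : imageBr A L' φ N m a b = -(ksign k (A.tot a * A.tot b) * imageBr A L' φ N m b a) := by
    simp only [imageBr, add_comm (A.int b)]
    split_ifs
    · rw [L'.antisymm_of_mem (h.map_e a) (h.map_e b)]
      rfl
    · simp
  rw [brCoef, brCoef, h1]
  generalize A.tot a = ta
  generalize A.tot b = tb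
  by_cases ha : Even ta <;> by_cases hb : Even tb <;>
    simp only [ksign_eq, ha, hb, Int.even_add, Int.even_sub, Int.even_mul, Int.not_even_one,
      iff_true, iff_false, not_true_eq_false, or_true, or_false, or_self, iff_self,
      if_true, if_false] <;> ring

theorem IsPartialHom.map_mem (h : IsPartialHom L' j f N φ) {c n : ℤ} {y : A.ι →₀ k}
    (hy : y ∈ A.component k c n) : φ y ∈ B'.component k c n := by
  refine BiBasis.map_component (fun i hi hi' => ?_) y hy
  subst hi hi'
  exact h.map_e i

/-- When the three internal degrees add up to `N`, the inner bracket has internal degree below `N`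
because `int a` is positive, so `φ` already respects it. This is how the Jacobi identity of the
target reaches the structure constants of the source. -/
theorem IsPartialHom.sum_brCoef (h : IsPartialHom L' j f N φ) (m : B'.ι) (a b n : A.ι) :
    ∑ l ∈ A.idx N, A.brCoef (A.kap l) b n * imageBr A L' φ N m a l =
      if A.int a + (A.int b + A.int n) = N then
        L'.br (φ (A.e k a)) (L'.br (φ (A.e k b)) (φ (A.e k n))) m else 0 := by
  have ha := A.int_pos a
  split_ifs with hN
  · rw [← h.map_br b n (by omega), brBasis_eq_sum (N := N) (by omega)]
    simp only [map_sum, map_smul, Finsupp.finsetSum_apply, Finsupp.smul_apply, smul_eq_mul]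
    refine Finset.sum_congr rfl fun l _ => ?_
    by_cases h0 : A.brCoef (A.kap l) b n = 0
    · rw [h0, zero_mul, zero_mul]
    · rw [imageBr, if_pos]
      rw [(degree_of_kap_ne_zero (brCoef_kap_ne_zero h0)).2, hN]
  · refine Finset.sum_eq_zero fun l _ => ?_
    by_cases h0 : A.brCoef (A.kap l) b n = 0
    · rw [h0, zero_mul]
    · rw [imageBr, if_neg, mul_zero]
      rwa [(degree_of_kap_ne_zero (brCoef_kap_ne_zero h0)).2]

theorem IsPartialHom.sum_brCoef' (h : IsPartialHom L' j f N φ) (m : B'.ι) (a b n : A.ι) :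
    ∑ l ∈ A.idx N, A.brCoef (A.kap l) a b * imageBr A L' φ N m l n =
      if A.int a + (A.int b + A.int n) = N then
        L'.br (L'.br (φ (A.e k a)) (φ (A.e k b))) (φ (A.e k n)) m else 0 := by
  have hn := A.int_pos n
  split_ifs with hN
  · rw [← h.map_br a b (by omega), brBasis_eq_sum (N := N) (by omega)]
    simp only [map_sum, map_smul, LinearMap.sum_apply, LinearMap.smul_apply,
      Finsupp.finsetSum_apply, Finsupp.smul_apply, smul_eq_mul]
    refine Finset.sum_congr rfl fun l _ => ?_
    by_cases h0 : A.brCoef (A.kap l) a b = 0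
    · rw [h0, zero_mul, zero_mul]
    · rw [imageBr, if_pos]
      rw [(degree_of_kap_ne_zero (brCoef_kap_ne_zero h0)).2, ← hN]
      ring
  · refine Finset.sum_eq_zero fun l _ => ?_
    by_cases h0 : A.brCoef (A.kap l) a b = 0
    · rw [h0, zero_mul]
    · rw [imageBr, if_neg, mul_zero]
      rw [(degree_of_kap_ne_zero (brCoef_kap_ne_zero h0)).2]
      omega

theorem coef₂_sum [CharZero k] {s : Finset A.ι} {τ : A.ι → A.ι → k}
    (hτ : ∀ a b, τ b a = ksign k ((1 - A.tot a) * (1 - A.tot b)) * τ a b) {a b : A.ι}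
    (ha : a ∈ s) (hb : b ∈ s) :
    coef₂ a b ((2 : k)⁻¹ • ∑ a ∈ s, ∑ b ∈ s, τ a b • (A.x a * A.x b)) = τ a b := by
  classical
  simp only [map_sum, map_smul, coef₂_x_mul_x, smul_eq_mul, mul_add, mul_ite, mul_one, mul_zero,
    Finset.sum_add_distrib, ite_and, Finset.sum_ite_eq', Finset.sum_ite_irrel,
    Finset.sum_const_zero, ha, hb, if_true]
  rw [hτ a b]
  have := ksign_mul_self k ((1 - A.tot a) * (1 - A.tot b))
  rw [mul_comm (1 - A.tot b)]
  linear_combination (2 : k)⁻¹ * τ a b * this + τ a b * inv_mul_cancel₀ (two_ne_zero (α := k))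

/-- Vanishing cyclic sums say that the quadratic cochain with coefficients `τ` is a cocycle. It is
exact, its primitive may be taken linear, and by duality between bracket and differential `τ` is
then a function of the bracket alone. -/
theorem IsQuadratic.exists_pair [CharZero k] (hA : A.IsQuadratic) (hex : A.DecomposableExact)
    {τ : A.ι → A.ι → k}
    (hτ : ∀ a b, τ b a = ksign k ((1 - A.tot a) * (1 - A.tot b)) * τ a b)
    (hcyc : ∀ a b n, cyclicSum k A.toBiBasis
      (fun a b n => ∑ m ∈ A.idx N, τ m n * A.kap m a b) a b n = 0) :
    ∃ w, ∀ a b, A.int a ≤ N → A.int b ≤ N → A.brCoef τ a b = A.pair (A.brBasis a b) w := by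
  have hdq := hA.d_sum_eq N τ hτ
  rw [cubic_eq_zero _ _ hcyc, smul_zero] at hdq
  have hq2 : (2 : k)⁻¹ • ∑ m ∈ A.idx N, ∑ n ∈ A.idx N, τ m n • (A.x m * A.x n) ∈
      cspan k (lenEq A.toBiBasis 2) :=
    Submodule.smul_mem _ _ (Submodule.sum_mem _ fun a _ => Submodule.sum_mem _ fun b _ =>
      Submodule.smul_mem _ _ (mul_mem_lenEq (m := 1) (n := 1) (x_mem_lenEq a) (x_mem_lenEq b)))
  generalize hq : (2 : k)⁻¹ • ∑ m ∈ A.idx N, ∑ n ∈ A.idx N, τ m n • (A.x m * A.x n) = q at hdq hq2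
  obtain ⟨w, hw⟩ := hex q (lenEq_le 2 hq2) hdq
  refine ⟨cproj (lenEq A.toBiBasis 1) w, fun a b ha hb => ?_⟩
  have hlin : cproj (lenEq A.toBiBasis 1) w ∈ linear k A.toBiBasis := by
    rw [linear_eq]; exact cproj_mem _ _
  rw [pair_brBasis hlin, hA.d_cproj_lenEq, hw, cproj_of_mem hq2, ← hq]
  rw [brCoef, brCoef, coef₂_sum hτ (mem_idx.2 ha) (mem_idx.2 hb)]

/-- Each coordinate of the bracket of images is a two-cocycle, by antisymmetry and the Jacobi
identity in the target; since it is exact, it factors linearly through the bracket of the source. -/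
theorem IsPartialHom.exists_pair [CharZero k] (hA : A.IsQuadratic) (hex : A.DecomposableExact)
    (h : IsPartialHom L' j f N φ) (m : B'.ι) :
    ∃ w, ∀ a b, A.int a + A.int b = N →
      L'.br (φ (A.e k a)) (φ (A.e k b)) m = A.pair (A.brBasis a b) w := by
  obtain ⟨w, hw⟩ := hA.exists_pair (N := N) hex (h.brCoef_swap m) fun a b n => by
    refine (jacobi_iff (A.idx N) _ (h.brCoef_swap m) a b n).1 ?_
    rw [brCoef_brCoef, h.sum_brCoef, h.sum_brCoef, h.sum_brCoef',
      show A.int b + (A.int a + A.int n) = A.int a + (A.int b + A.int n) by ring]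
    split_ifs
    · rw [L'.jacobi_of_mem (h.map_e a) (h.map_e b) (h.map_e n)]
      rfl
    · simp
  refine ⟨w, fun a b hab => ?_⟩
  have ha := A.int_pos a
  have hb := A.int_pos b
  rw [← hw a b (by omega) (by omega), brCoef_brCoef, imageBr, if_pos hab]

/-- Any linear relation between brackets of internal degree `N` also holds between the brackets of
images, because each coordinate of the latter factors through the former. The map is thus well
defined on the span of the brackets, and is extended to all vectors by an arbitrary linear
splitting. -/
theorem IsPartialHom.exists_lift [CharZero k] (hA : A.IsQuadratic) (hex : A.DecomposableExact)
    (h : IsPartialHom L' j f N φ) : ∃ g : (A.ι →₀ k) →ₗ[k] (B'.ι →₀ k),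
      ∀ a b, A.int a + A.int b = N →
        g (A.brBasis a b) = L'.br (φ (A.e k a)) (φ (A.e k b)) := by
  set P := {ab : A.ι × A.ι // A.int ab.1 + A.int ab.2 = N}
  set β : (P →₀ k) →ₗ[k] (A.ι →₀ k) :=
    Finsupp.linearCombination k fun ab : P => A.brBasis ab.1.1 ab.1.2 with hβ
  set T : (P →₀ k) →ₗ[k] (B'.ι →₀ k) :=
    Finsupp.linearCombination k fun ab : P => L'.br (φ (A.e k ab.1.1)) (φ (A.e k ab.1.2)) with hT
  have hker : ∀ z, β z = 0 → T z = 0 := by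
    intro z hz
    ext m
    obtain ⟨w, hw⟩ := h.exists_pair hA hex m
    have : Finsupp.lapply m ∘ₗ T = A.pair.flip w ∘ₗ β := by
      ext ab
      simpa [hT, hβ] using hw _ _ ab.2
    have h1 := LinearMap.congr_fun this z
    rw [LinearMap.comp_apply, LinearMap.comp_apply, hz, map_zero] at h1
    exact h1
  obtain ⟨s, hs⟩ := LinearMap.exists_leftInverse_of_injective
    ((LinearMap.ker β).liftQ β le_rfl) (Submodule.ker_liftQ_eq_bot' _ _ rfl)
  refine ⟨(LinearMap.ker β).liftQ T hker ∘ₗ s, fun a b hab => ?_⟩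
  have h1 : ∀ z, ((LinearMap.ker β).liftQ T hker ∘ₗ s) (β z) = T z := by
    intro z
    have h2 : s (β z) = Submodule.Quotient.mk z :=
      LinearMap.congr_fun hs (Submodule.Quotient.mk z)
    rw [LinearMap.comp_apply, h2]
    rfl
  have := h1 (Finsupp.single ⟨(a, b), hab⟩ 1)
  simpa [hβ, hT] using this

/-- The projection onto a homogeneous component. -/
def _root_.BiBasis.compProj (k : Type u) [Field k] (B : BiBasis.{v}) (c n : ℤ) :
    (B.ι →₀ k) →ₗ[k] (B.ι →₀ k) :=
  (B.component k c n).subtype ∘ₗ Finsupp.restrictDom k k {i | B.coh i = c ∧ B.int i = n}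

theorem _root_.BiBasis.compProj_mem {B : BiBasis.{v}} {c n : ℤ} (y : B.ι →₀ k) :
    B.compProj k c n y ∈ B.component k c n :=
  (Finsupp.restrictDom k k {i | B.coh i = c ∧ B.int i = n} y).2

theorem _root_.BiBasis.compProj_of_mem {B : BiBasis.{v}} {c n : ℤ} {y : B.ι →₀ k}
    (hy : y ∈ B.component k c n) : B.compProj k c n y = y :=
  congrArg Subtype.val (LinearMap.congr_fun
    (Finsupp.restrictDom_comp_subtype (M := k) (R := k) {i | B.coh i = c ∧ B.int i = n}) ⟨y, hy⟩)

open Classical in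
-- In internal degree `N` the new map is prescribed on brackets by the homomorphism condition and on
-- generators by `f`. The two prescriptions are compatible because `res`, the class modulo brackets,
-- vanishes on brackets and inverts `j`.
theorem IsPartialHom.exists_succ [CharZero k] (hA : A.IsQuadratic) (hex : A.DecomposableExact)
    (θ : ∀ c n, V c n ≃ₗ[k] Module.Dual k (A.linCocycles (1 - c) (-n)))
    (hj : ∀ c n a, j c n a ∈ A.component k c n)
    (hf : ∀ c n a, f c n a ∈ B'.component k c n)
    (hθ : ∀ c n a (u : A.linCocycles (1 - c) (-n)), A.pair (j c n a) u = θ c n a u)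
    (h : IsPartialHom L' j f N φ) : ∃ φ', IsPartialHom L' j f (N + 1) φ' := by
  obtain ⟨g, hg⟩ := h.exists_lift hA hex
  set res : ∀ c n, (A.ι →₀ k) →ₗ[k] V c n := fun c n => (θ c n).symm.toLinearMap ∘ₗ
    LinearMap.lcomp k k (A.linCocycles (1 - c) (-n)).subtype ∘ₗ A.pair with hres
  set ψ : ∀ c, (A.ι →₀ k) →ₗ[k] (B'.ι →₀ k) := fun c =>
    -- Equal to `g` on brackets and to `f` on generators. The projection is needed because `g` was
    -- extended without regard to bidegree.
    B'.compProj k c N ∘ₗ (g + (f c N - g ∘ₗ j c N) ∘ₗ res c N) with hψ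
  set φ' : (A.ι →₀ k) →ₗ[k] (B'.ι →₀ k) := Finsupp.linearCombination k fun i =>
    if A.int i = N then ψ (A.coh i) (A.e k i) else φ (A.e k i) with hφ'
  have he : ∀ i, φ' (A.e k i) = if A.int i = N then ψ (A.coh i) (A.e k i) else φ (A.e k i) := by
    intro i
    simp [hφ', BiBasis.e]
  have hlow : ∀ c n, n < N → ∀ y ∈ A.component k c n, φ' y = φ y := by
    intro c n hn
    refine BiBasis.eqOn_component fun i hi hi' => ?_
    rw [he, if_neg (by omega)]
  have htop : ∀ c, ∀ y ∈ A.component k c N, φ' y = ψ c y := by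
    intro c
    refine BiBasis.eqOn_component fun i hi hi' => ?_
    rw [he, if_pos hi', hi]
  have hresbr : ∀ c n a b, res c n (A.brBasis a b) = 0 := by
    intro c n a b
    rw [hres]
    simp only [LinearMap.comp_apply, LinearEquiv.coe_coe]
    rw [LinearEquiv.map_eq_zero_iff]
    ext u
    change A.pair (A.brBasis a b) u = 0
    rw [pair_brBasis u.2.1.2]
    have : A.d u = 0 := u.2.1.1
    simp [this, brCoef]
  have hresj : ∀ c n a, res c n (j c n a) = a := by
    intro c n a
    rw [hres]
    simp only [LinearMap.comp_apply, LinearEquiv.coe_coe]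
    rw [LinearEquiv.symm_apply_eq]
    ext u
    exact hθ c n a u
  refine ⟨φ', ⟨fun i => ?_, fun a b hab => ?_, fun c n a hn => ?_⟩⟩
  · rw [he]
    split_ifs with hi
    · rw [hi]
      exact BiBasis.compProj_mem _
    · exact h.map_e i
  · have ha := A.int_pos a
    have hb := A.int_pos b
    rw [hlow _ _ (by omega) _ (BiBasis.e_mem a), hlow _ _ (by omega) _ (BiBasis.e_mem b)]
    have hmem := L'.br_mem_of_mem (h.map_e a) (h.map_e b)
    rcases (Int.lt_add_one_iff.1 hab).lt_or_eq with hab | hab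
    · rw [hlow _ _ hab _ (A.brBasis_mem a b), h.map_br a b hab]
    · have h1 := A.brBasis_mem a b
      rw [hab] at h1 hmem
      rw [htop _ _ h1, hψ]
      simp only [LinearMap.comp_apply, LinearMap.add_apply, hresbr, map_zero, add_zero, hg a b hab]
      exact BiBasis.compProj_of_mem hmem
  · rcases (Int.lt_add_one_iff.1 hn).lt_or_eq with hn | rfl
    · rw [hlow _ _ hn _ (hj c n a), h.map_j c n a hn]
    · rw [htop _ _ (hj c n a), hψ]
      simp only [LinearMap.comp_apply, LinearMap.add_apply, LinearMap.sub_apply, hresj,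
        add_sub_cancel]
      exact BiBasis.compProj_of_mem (hf c n a)

theorem exists_isPartialHom [CharZero k] (hA : A.IsQuadratic) (hex : A.DecomposableExact)
    (θ : ∀ c n, V c n ≃ₗ[k] Module.Dual k (A.linCocycles (1 - c) (-n)))
    (hj : ∀ c n a, j c n a ∈ A.component k c n)
    (hf : ∀ c n a, f c n a ∈ B'.component k c n)
    (hθ : ∀ c n a (u : A.linCocycles (1 - c) (-n)), A.pair (j c n a) u = θ c n a u) (N : ℕ) :
    ∃ φ, IsPartialHom L' j f (N + 1) φ := by
  induction N with
  | zero =>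
    refine ⟨0, ⟨fun i => by simp, fun a b hab => ?_, fun c n a hn => ?_⟩⟩
    · have ha := A.int_pos a
      have hb := A.int_pos b
      omega
    -- Nothing lives in nonpositive internal degree, so `V c n` vanishes there and the zero map
    -- starts the induction.
    · have h1 : a = 0 := by
        apply (θ c n).injective
        ext u
        rw [← hθ, component_eq_zero (by push_cast at hn; omega) (hj c n a)]
        simp
      simp [h1]
  | succ N ih =>
    obtain ⟨φ, h⟩ := ih
    push_cast
    exact h.exists_succ hA hex θ hj hf hθ

/-- The partial homomorphisms agree, by uniqueness, in the degrees where both are constrained, so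
they glue: on a basis vector use any one defined beyond its internal degree. -/
theorem IsQuadratic.isFreeOn [CharZero k] (hA : A.IsQuadratic) (hex : A.DecomposableExact)
    (θ : ∀ c n, V c n ≃ₗ[k] Module.Dual k (A.linCocycles (1 - c) (-n)))
    (hj : ∀ c n a, j c n a ∈ A.component k c n)
    (hθ : ∀ c n a (u : A.linCocycles (1 - c) (-n)), A.pair (j c n a) u = θ c n a u) :
    hA.lie.IsFreeOn V j := by
  refine ⟨hj, fun B' L' f hf => ?_⟩
  choose Φ hΦ using exists_isPartialHom (L' := L') (f := f) hA hex θ hj hf hθ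
  set φ : (A.ι →₀ k) →ₗ[k] (B'.ι →₀ k) :=
    Finsupp.linearCombination k fun i => Φ (A.int i).toNat (A.e k i) with hφ
  have hunique : ∀ (M N : ℕ) (c n : ℤ), n ≤ M → n ≤ N → ∀ y ∈ A.component k c n,
      Φ M y = Φ N y := by
    intro M N c n hM hN y hy
    have weaken : ∀ M : ℕ, n ≤ M → IsPartialHom L' j f (n + 1) (Φ M) := fun M hM =>
      ⟨(hΦ M).map_e, fun a b hab => (hΦ M).map_br a b (by omega),
        fun c m a hm => (hΦ M).map_j c m a (by omega)⟩
    exact (weaken M hM).eqOn hA θ hj hθ (weaken N hN) n.toNat c n (by omega)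
      (Int.self_le_toNat n) y hy
  have hφN : ∀ (N : ℕ) (c n : ℤ), n ≤ N → ∀ y ∈ A.component k c n, φ y = Φ N y := by
    intro N c n hN
    refine BiBasis.eqOn_component fun i hi hi' => ?_
    subst hi hi'
    have : φ (A.e k i) = Φ (A.int i).toNat (A.e k i) := by simp [hφ, BiBasis.e]
    rw [this]
    exact hunique _ _ _ _ (Int.self_le_toNat _) hN _ (BiBasis.e_mem i)
  have hhom : hA.lie.IsHom L' φ := by
    refine ⟨fun c n y hy => ?_, fun a b => ?_⟩
    · rw [hφN n.toNat c n (Int.self_le_toNat n) y hy]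
      exact (hΦ _).map_mem hy
    · have : hA.lie.br.compr₂ φ = L'.br.compl₁₂ φ φ := by
        ext a b : 4
        change φ (A.lieBr (A.e k a) (A.e k b)) = L'.br (φ (A.e k a)) (φ (A.e k b))
        have ha := A.int_pos a
        have hb := A.int_pos b
        have hN := Int.self_le_toNat (A.int a + A.int b)
        rw [lieBr_e, hφN _ _ _ hN _ (A.brBasis_mem a b), (hΦ _).map_br a b (by omega),
          hφN (A.int a + A.int b).toNat _ _ (by omega) _ (BiBasis.e_mem a),
          hφN (A.int a + A.int b).toNat _ _ (by omega) _ (BiBasis.e_mem b)]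
      exact LinearMap.congr_fun₂ this a b
  refine ⟨φ, ⟨hhom, fun c n a => ?_⟩, ?_⟩
  · have hN := Int.self_le_toNat n
    rw [hφN n.toNat c n hN _ (hj c n a), (hΦ _).map_j c n a (by omega)]
  · rintro φ' ⟨h1, h2⟩
    refine Finsupp.lhom_ext' fun i => LinearMap.ext_ring ?_
    change φ' (A.e k i) = φ (A.e k i)
    have weaken : ∀ φ' : (A.ι →₀ k) →ₗ[k] (B'.ι →₀ k), hA.lie.IsHom L' φ' →
        (∀ c n a, φ' (j c n a) = f c n a) → IsPartialHom L' j f (A.int i + 1) φ' :=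
      fun φ' h h' => ⟨fun l => h.map_component _ _ _ (BiBasis.e_mem l), fun a b _ => by
        rw [← lieBr_e]; exact h.map_br _ _, fun c n a _ => h' c n a⟩
    refine (weaken φ' h1 h2).eqOn hA θ hj hθ (weaken φ hhom fun c n a => ?_) (A.int i).toNat _ _
      (by omega) (Int.self_le_toNat _) _ (BiBasis.e_mem i)
    have hN := Int.self_le_toNat n
    rw [hφN n.toNat c n hN _ (hj c n a), (hΦ _).map_j c n a (by omega)]

/-- A functional on the linear cocycles extends to all linear cochains through a retraction `ρ`, and
a functional on linear cochains of fixed bidegree is a vector because there are finitely many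
generators. The choice of `ρ` is the choice of a complement to the brackets. -/
theorem IsQuadratic.exists_isFreeOn [CharZero k] (hA : A.IsQuadratic) (hex : A.DecomposableExact)
    (θ : ∀ c n, V c n ≃ₗ[k] Module.Dual k (A.linCocycles (1 - c) (-n))) :
    ∃ j : ∀ c n, V c n →ₗ[k] (A.ι →₀ k), hA.lie.IsFreeOn V j := by
  classical
  have hρ : ∀ p q, ∃ ρ : Cochain k A.toBiBasis →ₗ[k] A.linCocycles p q,
      ρ ∘ₗ (A.linCocycles p q).subtype = LinearMap.id := fun p q =>
    LinearMap.exists_leftInverse_of_injective _ (Submodule.ker_subtype _)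
  choose ρ hρ using hρ
  set j : ∀ c n, V c n →ₗ[k] (A.ι →₀ k) := fun c n =>
    ∑ l ∈ A.idx n with A.coh l = c ∧ A.int l = n, (LinearMap.toSpanSingleton k _ (A.e k l)) ∘ₗ
      (Module.Dual.eval k _ (ρ (1 - c) (-n) (A.x l))) ∘ₗ (θ c n).toLinearMap with hjdef
  have hj : ∀ c n a, j c n a = ∑ l ∈ A.idx n with A.coh l = c ∧ A.int l = n,
      θ c n a (ρ (1 - c) (-n) (A.x l)) • A.e k l := by
    intro c n a
    simp [hjdef, LinearMap.sum_apply]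
  refine ⟨j, hA.isFreeOn hex θ (fun c n a => ?_) fun c n a u => ?_⟩
  · rw [hj]
    refine Submodule.sum_mem _ fun l hl => Submodule.smul_mem _ _ ?_
    obtain ⟨-, rfl, rfl⟩ := Finset.mem_filter.1 hl
    exact BiBasis.e_mem l
  · rw [hj]
    simp only [map_sum, map_smul, LinearMap.sum_apply, LinearMap.smul_apply, pair_e, smul_eq_mul]
    have hu : (u : Cochain k A.toBiBasis) = ∑ l ∈ A.idx n with A.coh l = c ∧ A.int l = n,
        coef l (u : Cochain k A.toBiBasis) • A.x l := by
      have h1 := u.2.1.2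
      rw [linear_eq] at h1
      have h2 : (u : Cochain k A.toBiBasis) ∈ cspan k (biSet A.toBiBasis (1 - c) (-n)) := by
        rw [← piece_eq]; exact u.2.2
      refine eq_sum_of_mem_lenEq_one h1 fun i hi => ?_
      by_contra hi'
      refine hi (coef_of_mem (fun h => hi' ?_) _ h2)
      have h3 : 1 - A.coh i = 1 - c := by simpa [biSet] using h.1
      have h4 : -A.int i = -n := by simpa [biSet] using h.2
      exact Finset.mem_filter.2 ⟨mem_idx.2 (by omega), by omega, by omega⟩
    have h5 : ρ (1 - c) (-n) (u : Cochain k A.toBiBasis) = u := LinearMap.congr_fun (hρ _ _) u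
    conv_rhs => rw [← h5, hu]
    simp only [map_sum, map_smul, smul_eq_mul]
    exact Finset.sum_congr rfl fun l _ => mul_comm _ _

/-- An `L_∞` algebra that is isomorphic to one with quadratic differential in which decomposable
cocycles are exact is free. -/
theorem isFreeLie_of_isomorphic [CharZero k] {A' : LInf.{u, v} k} (h : A'.Isomorphic A)
    (hA : A.IsQuadratic) (hex : A.DecomposableExact)
    (θ : ∀ c n, V c n ≃ₗ[k] Module.Dual k (A.linCocycles (1 - c) (-n))) : A'.IsFreeLie V := by
  obtain ⟨j, hj⟩ := hA.exists_isFreeOn hex θ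
  exact ⟨A, hA.lie, j, hA.isStrict, hj, h⟩

end Universal

end LInf

/-! ### The augmentation of the Tate resolution -/

namespace Cochain

variable {k : Type u} [Field k] {B : BiBasis.{v}}

/-- A cochain has finitely many nonzero components. Stability under enlarging the finite set allows
the sets for two summands to be merged. -/
theorem exists_sum_cproj {M : Type*} [DecidableEq M] (g : Multiset B.ι → M) (z : Cochain k B) :
    ∃ F : Finset M, ∀ F', F ⊆ F' → z = ∑ n ∈ F', cproj {m | g m = n} z := by
  have hz : z ∈ Submodule.span k (Set.range (word k B)) := by rw [span_words]; trivial
  induction hz using Submodule.span_induction with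
  | mem z h =>
    obtain ⟨l, rfl⟩ := h
    refine ⟨{g l}, fun F' hF => ?_⟩
    simp only [cproj_word, Set.mem_ofPred_eq]
    rw [Finset.sum_eq_single_of_mem (g l) (hF (Finset.mem_singleton_self _)), if_pos rfl]
    exact fun n _ hn => if_neg hn.symm
  | zero => exact ⟨∅, fun F' _ => by simp⟩
  | add a b _ _ ha hb =>
    obtain ⟨F, hF⟩ := ha
    obtain ⟨G, hG⟩ := hb
    refine ⟨F ∪ G, fun F' h => ?_⟩
    simp only [map_add, Finset.sum_add_distrib]
    rw [← hF F' (Finset.union_subset_left h), ← hG F' (Finset.union_subset_right h)]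
  | smul r a _ ha =>
    obtain ⟨F, hF⟩ := ha
    refine ⟨F, fun F' h => ?_⟩
    simp only [map_smul, ← Finset.smul_sum]
    rw [← hF F' h]

end Cochain

namespace TateResolution

open Cochain LInf

variable {k : Type u} [Field k] {t : Supertranslation k} (T : TateResolution.{u, v} t)

/-- The generator `λ^α`. -/
abbrev lamX (α : Fin t.dim₁) : Cochain k T.toBiBasis := T.toLInf.x (T.lam α).1

/-- The generator `v^a`. -/
abbrev vX (a : Fin t.dim₂) : Cochain k T.toBiBasis := T.toLInf.x (T.vv a).1

theorem stage_lam (α : Fin t.dim₁) : T.toLInf.stage (T.lam α).1 = 0 := (T.lam α).2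

theorem stage_vv (a : Fin t.dim₂) : T.toLInf.stage (T.vv a).1 = 1 := (T.vv a).2

theorem tot_eq (i : T.ι) : T.toBiBasis.tot i = T.toLInf.stage i + 1 := by
  simp only [LInf.stage]; ring

theorem tot_lam (α : Fin t.dim₁) : T.toBiBasis.tot (T.lam α).1 = 1 := by
  rw [tot_eq, stage_lam, zero_add]

theorem tot_vv (a : Fin t.dim₂) : T.toBiBasis.tot (T.vv a).1 = 2 := by
  rw [tot_eq, stage_vv]; rfl

theorem sum_stage (m : Multiset T.ι) :
    (m.map fun i => 1 - T.toBiBasis.tot i).sum = -(m.map T.toLInf.stage).sum := by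
  induction m using Multiset.induction_on with
  | empty => simp
  | cons i m ih => rw [Multiset.map_cons, Multiset.sum_cons, ih, tot_eq, Multiset.map_cons,
      Multiset.sum_cons]; ring

theorem mem_totSet_iff {n : ℤ} {m : Multiset T.ι} :
    m ∈ totSet T.toBiBasis n ↔ (m.map T.toLInf.stage).sum = -n := by
  change (m.map fun i => 1 - T.toBiBasis.tot i).sum = n ↔ _
  rw [sum_stage]
  constructor <;> intro h <;> omega

theorem sum_stage_nonneg (m : Multiset T.ι) : 0 ≤ (m.map T.toLInf.stage).sum :=
  Multiset.sum_nonneg fun x hx => by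
    obtain ⟨i, -, rfl⟩ := Multiset.mem_map.1 hx
    exact T.stage_nonneg i

theorem stage_le_of_mem {m : Multiset T.ι} {i : T.ι} (hi : i ∈ m) :
    T.toLInf.stage i ≤ (m.map T.toLInf.stage).sum := by
  obtain ⟨m', rfl⟩ := Multiset.exists_cons_of_mem hi
  rw [Multiset.map_cons, Multiset.sum_cons]
  have := T.sum_stage_nonneg m'
  omega

theorem stagePart_eq (s n : ℤ) : T.toLInf.stagePart s n =
    cspan k {m : Multiset T.ι | (∀ i ∈ m, T.toLInf.stage i ≤ s) ∧
      (m.map T.toLInf.stage).sum = n} := by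
  rw [LInf.stagePart, cspan]
  congr 1
  ext y
  constructor
  · rintro ⟨l, h1, h2, rfl⟩
    exact ⟨l, ⟨by simpa using h1, by simpa using h2⟩, rfl⟩
  · rintro ⟨l, ⟨h1, h2⟩, rfl⟩
    exact ⟨l, by simpa using h1, by simpa using h2, rfl⟩

/-- Stages are nonnegative, so no letter of a word can have a stage exceeding the total `n`: in this
range of degrees the subalgebra of stage at most `s` is already everything. -/
theorem stagePart_eq_totSet {s n : ℤ} (h : n ≤ s) :
    T.toLInf.stagePart s n = cspan k (totSet T.toBiBasis (-n)) := by
  rw [stagePart_eq]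
  congr 1
  ext m
  rw [mem_totSet_iff, neg_neg]
  constructor
  · exact fun h => h.2
  · rintro h'
    refine ⟨fun i hi => ?_, h'⟩
    have := T.stage_le_of_mem hi
    omega

theorem eq_zero_of_mem_totSet_pos {n : ℤ} (hn : 0 < n) {z : Cochain k T.toBiBasis}
    (hz : z ∈ cspan k (totSet T.toBiBasis n)) : z = 0 := by
  have h : totSet T.toBiBasis n = ∅ := by
    ext m
    rw [mem_totSet_iff]
    have := T.sum_stage_nonneg m
    simp only [Set.mem_empty_iff_false, iff_false]
    omega
  rwa [h, cspan_empty, Submodule.mem_bot] at hz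

theorem d_of_mem_totSet_zero {z : Cochain k T.toBiBasis}
    (hz : z ∈ cspan k (totSet T.toBiBasis 0)) : T.d z = 0 :=
  T.eq_zero_of_mem_totSet_pos (n := 0 + 1) (by norm_num) (T.toLInf.d_mem_totSet hz)

theorem d_mul_of_mem_zero {r : Cochain k T.toBiBasis}
    (hr : r ∈ cspan k (totSet T.toBiBasis 0)) (z : Cochain k T.toBiBasis) :
    T.d (r * z) = r * T.d z := by
  rw [T.toLInf.d_mul_of_mem hr, T.d_of_mem_totSet_zero hr, zero_mul, zero_add, ksign_zero, one_smul]

theorem lamX_mem (α : Fin t.dim₁) : T.lamX α ∈ cspan k (totSet T.toBiBasis 0) := by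
  have h := x_mem_totSet (k := k) (T.lam α).1
  rwa [tot_lam, sub_self] at h

theorem commute_of_mem_zero {r : Cochain k T.toBiBasis}
    (hr : r ∈ cspan k (totSet T.toBiBasis 0)) (z : Cochain k T.toBiBasis) : z * r = r * z := by
  refine LinearMap.congr_fun (f := LinearMap.mulRight k r) (g := LinearMap.mulLeft k r)
    (ext_word fun l => ?_) z
  have h := graded_comm (word_mem_cspan (k := k) (S := totSet T.toBiBasis _) (l := l) rfl) hr
  rw [mul_zero, ksign_zero, one_smul] at h
  exact h

/-- The inclusion of `R` in the Tate resolution. -/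
def ofR : t.R →ₐ[k] Cochain k T.toBiBasis :=
  (Subalgebra.center k (Cochain k T.toBiBasis)).val.comp (MvPolynomial.aeval fun α =>
    ⟨T.lamX α, Subalgebra.mem_center_iff.2 fun z => T.commute_of_mem_zero (T.lamX_mem α) z⟩)

theorem ofR_X (α : Fin t.dim₁) : T.ofR (MvPolynomial.X α) = T.lamX α := by simp [ofR]

theorem ofR_mem (f : t.R) : T.ofR f ∈ cspan k (totSet T.toBiBasis 0) := by
  induction f using MvPolynomial.induction_on with
  | C a =>
    rw [← MvPolynomial.algebraMap_eq, AlgHom.commutes, Algebra.algebraMap_eq_smul_one]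
    exact Submodule.smul_mem _ _ one_mem_totSet
  | add p q hp hq => rw [map_add]; exact Submodule.add_mem _ hp hq
  | mul_X p α hp =>
    rw [map_mul, ofR_X]
    have h := mul_mem_totSet hp (T.lamX_mem α)
    rwa [add_zero] at h

theorem exists_ofR_eq {z : Cochain k T.toBiBasis} (hz : z ∈ cspan k (totSet T.toBiBasis 0)) :
    ∃ f, T.ofR f = z := by
  refine (mem_comap_of_word LinearMap.id (LinearMap.range T.ofR.toLinearMap) (fun l hl => ?_)) z hz
  rw [mem_totSet_iff, neg_zero] at hl
  induction l with
  | nil => exact ⟨1, map_one T.ofR⟩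
  | cons i l ih =>
    rw [← Multiset.cons_coe, Multiset.map_cons, Multiset.sum_cons] at hl
    have h1 := T.stage_nonneg i
    have h2 := T.sum_stage_nonneg l
    obtain ⟨f, hf⟩ := ih (by omega)
    have h3 : T.toLInf.stage i = 0 := by omega
    refine ⟨MvPolynomial.X (T.lam.symm ⟨i, h3⟩) * f, ?_⟩
    rw [AlgHom.toLinearMap_apply, map_mul, ofR_X, lamX, Equiv.apply_symm_apply]
    change _ = word k T.toBiBasis (i :: l)
    rw [word_cons]
    congr 1

open Classical in
/-- The projection of the Tate resolution to `R`. -/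
def toR : Cochain k T.toBiBasis →ₐ[k] t.R :=
  lift (fun i => if h : T.toLInf.stage i = 0 then MvPolynomial.X (T.lam.symm ⟨i, h⟩) else 0) (by
    intro i j
    by_cases hi : T.toLInf.stage i = 0 <;> by_cases hj : T.toLInf.stage j = 0 <;>
      simp only [hi, hj, dite_true, dite_false, zero_mul, mul_zero, smul_zero]
    have h : ksign k ((1 - T.toBiBasis.tot i) * (1 - T.toBiBasis.tot j)) = 1 := by
      rw [tot_eq, tot_eq, hi, hj, zero_add, sub_self, zero_mul, ksign_zero]
    rw [h, one_smul, mul_comm])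

theorem toR_lamX (α : Fin t.dim₁) : T.toR (T.lamX α) = MvPolynomial.X α := by
  rw [toR, lift_x, dif_pos (T.stage_lam α)]
  simp

theorem toR_x {i : T.ι} (h : T.toLInf.stage i ≠ 0) : T.toR (T.toLInf.x i) = 0 := by
  rw [toR, lift_x, dif_neg h]

theorem toR_ofR (f : t.R) : T.toR (T.ofR f) = f := by
  have : T.toR.comp T.ofR = AlgHom.id k t.R := by
    ext α
    simp only [AlgHom.comp_apply, ofR_X, toR_lamX, AlgHom.id_apply]
  exact AlgHom.congr_fun this f

theorem toR_of_mem {n : ℤ} (hn : n ≠ 0) {z : Cochain k T.toBiBasis}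
    (hz : z ∈ cspan k (totSet T.toBiBasis n)) : T.toR z = 0 := by
  refine eqOn_cspan (f := T.toR.toLinearMap) (g := 0) (fun l hl => ?_) z hz
  rw [mem_totSet_iff] at hl
  rw [AlgHom.toLinearMap_apply, LinearMap.zero_apply]
  clear hz
  induction l generalizing n with
  | nil => simp at hl; omega
  | cons i l ih =>
    rw [word_cons, map_mul]
    by_cases hi : T.toLInf.stage i = 0
    · rw [← Multiset.cons_coe, Multiset.map_cons, Multiset.sum_cons, hi, zero_add] at hl
      rw [ih hn hl, mul_zero]
    · rw [show T.toR (Cochain.x k T.toBiBasis i) = 0 from T.toR_x hi, zero_mul]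

/-- The projection of the Tate resolution to `S`. -/
def toS : Cochain k T.toBiBasis →ₐ[k] t.S := (Ideal.Quotient.mkₐ k t.quadrics).comp T.toR

theorem toS_apply (z : Cochain k T.toBiBasis) : T.toS z = Ideal.Quotient.mk t.quadrics (T.toR z) :=
  rfl

theorem toS_of_mem {n : ℤ} (hn : n ≠ 0) {z : Cochain k T.toBiBasis}
    (hz : z ∈ cspan k (totSet T.toBiBasis n)) : T.toS z = 0 := by
  rw [toS_apply, T.toR_of_mem hn hz, map_zero]

/-- The quadric with index `a`. -/
def _root_.Supertranslation.quadric (t : Supertranslation k) (a : Fin t.dim₂) : t.R :=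
  ∑ α, ∑ β, t.γ a α β • (MvPolynomial.X α * MvPolynomial.X β : t.R)

theorem d_vX (a : Fin t.dim₂) : T.d (T.vX a) = -((2 : k)⁻¹ • T.ofR (t.quadric a)) := by
  rw [T.d_vv, Supertranslation.quadric]
  simp only [map_sum, map_smul, map_mul, ofR_X]

theorem toS_d_x (i : T.ι) : T.toS (T.d (T.toLInf.x i)) = 0 := by
  have h0 := T.stage_nonneg i
  have h := T.toLInf.d_mem_totSet (x_mem_totSet (k := k) i)
  rcases h0.eq_or_lt with h1 | h1
  · rw [T.d_of_mem_totSet_zero, map_zero]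
    have := x_mem_totSet (k := k) i
    rwa [tot_eq, ← h1, zero_add, sub_self] at this
  · by_cases h2 : T.toLInf.stage i = 1
    · obtain ⟨a, ha⟩ := T.vv.surjective ⟨i, h2⟩
      have : i = (T.vv a).1 := by rw [ha]
      rw [this]
      change T.toS (T.d (T.vX a)) = 0
      rw [d_vX, toS_apply, map_neg, map_smul, toR_ofR, map_neg, neg_eq_zero,
        Ideal.Quotient.eq_zero_iff_mem]
      exact Submodule.smul_of_tower_mem _ _ (Ideal.subset_span ⟨a, rfl⟩)
    · rw [toS_apply, T.toR_of_mem _ h, map_zero]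
      rw [tot_eq]
      omega

theorem toS_d (z : Cochain k T.toBiBasis) : T.toS (T.d z) = 0 := by
  refine LinearMap.congr_fun (f := T.toS.toLinearMap ∘ₗ T.d) (g := 0) (ext_word fun l => ?_) z
  simp only [LinearMap.comp_apply, AlgHom.toLinearMap_apply, LinearMap.zero_apply]
  induction l with
  | nil => rw [word_nil, d_one, map_zero]
  | cons i l ih =>
    rw [word_cons]
    change T.toS (T.d (T.toLInf.x i * _)) = 0
    rw [T.toLInf.d_x_mul, map_add, map_mul, map_smul, map_mul, ih, toS_d_x]
    simp

theorem mem_dSpan {I : Set T.ι} {z : Cochain k T.toBiBasis} (hz : z ∈ T.toLInf.dSpan I) :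
    ∃ w, T.d w = z := by
  refine (Submodule.span_le (p := LinearMap.range T.d)).2 ?_ hz
  rintro _ ⟨r, hr, i, -, rfl⟩
  rw [T.stagePart_eq_totSet le_rfl, neg_zero] at hr
  exact ⟨r * T.toLInf.x i, T.d_mul_of_mem_zero hr _⟩

theorem exists_d_eq_of_quadrics [CharZero k] {f : t.R} (hf : f ∈ t.quadrics) :
    ∃ w, T.d w = T.ofR f := by
  induction hf using Submodule.span_induction with
  | mem f h =>
    obtain ⟨a, rfl⟩ := h
    refine ⟨(-2 : k) • T.vX a, ?_⟩
    rw [map_smul, d_vX, smul_neg, smul_smul, neg_mul, mul_inv_cancel₀ two_ne_zero, neg_smul, neg_neg,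
      one_smul]
    rfl
  | zero => exact ⟨0, by simp⟩
  | add f g _ _ hf hg =>
    obtain ⟨w, hw⟩ := hf
    obtain ⟨w', hw'⟩ := hg
    exact ⟨w + w', by rw [map_add, map_add, hw, hw']⟩
  | smul g f _ hf =>
    obtain ⟨w, hw⟩ := hf
    exact ⟨T.ofR g * w, by rw [T.d_mul_of_mem_zero (T.ofR_mem g), hw, smul_eq_mul, map_mul]⟩

/-- In total degree `-s` with `s ≥ 1`, every cochain already belongs to stage `s`, and the
generators of stage `s + 1` were adjoined to kill its cohomology there. In degree zero the
coboundaries contain the ideal of quadrics, through the generators `v`; in positive degree there are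
no cochains. -/
theorem exact_of_mem_totSet [CharZero k] {n : ℤ} {z : Cochain k T.toBiBasis}
    (hz : z ∈ cspan k (totSet T.toBiBasis n)) (hd : T.d z = 0) (hS : T.toS z = 0) :
    ∃ w, T.d w = z := by
  rcases lt_trichotomy n 0 with hn | rfl | hn
  · have h := T.generate (-n) (by omega) z
      (by rw [T.stagePart_eq_totSet le_rfl, neg_neg]; exact hz) hd
    obtain ⟨a, ha, b, hb, rfl⟩ := Submodule.mem_sup.1 h
    obtain ⟨w, rfl⟩ := T.mem_dSpan ha
    obtain ⟨w', -, rfl⟩ := hb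
    exact ⟨w + w', map_add _ _ _⟩
  · obtain ⟨f, rfl⟩ := T.exists_ofR_eq hz
    rw [toS_apply, toR_ofR, Ideal.Quotient.eq_zero_iff_mem] at hS
    exact T.exists_d_eq_of_quadrics hS
  · exact ⟨0, by rw [map_zero, T.eq_zero_of_mem_totSet_pos hn hz]⟩

theorem d_cproj_totSet (A : LInf.{u, v} k) (n : ℤ) (a : Cochain k A.toBiBasis) :
    A.d (cproj (totSet A.toBiBasis n) a) = cproj (totSet A.toBiBasis (n + 1)) (A.d a) := by
  refine LinearMap.congr_fun (f := A.d ∘ₗ cproj (totSet A.toBiBasis n))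
    (g := cproj (totSet A.toBiBasis (n + 1)) ∘ₗ A.d) (ext_word fun l => ?_) a
  simp only [LinearMap.comp_apply]
  have h := A.d_mem_totSet (word_mem_cspan (k := k) (S := totSet A.toBiBasis _) (l := l) rfl)
  rw [cproj_word]
  split_ifs with hl
  · have hl' : ((l : Multiset A.ι).map fun i => 1 - A.tot i).sum = n := hl
    rw [hl'] at h
    rw [cproj_of_mem h]
  · rw [map_zero, cproj_eq_zero _ h]
    rw [Set.disjoint_left]
    intro s h1 h2
    exact hl (add_right_cancel (h2.symm.trans h1))

/-- The cochains of the Tate resolution are a resolution of `S`. -/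
theorem exists_d_eq [CharZero k] {z : Cochain k T.toBiBasis} (hd : T.d z = 0) (hS : T.toS z = 0) :
    ∃ w, T.d w = z := by
  classical
  have h : ∀ n, ∃ w, T.d w = cproj (totSet T.toBiBasis n) z := by
    intro n
    refine T.exact_of_mem_totSet (n := n) (cproj_mem _ _) ?_ ?_
    · rw [d_cproj_totSet, hd, map_zero]
    · by_cases hn : n = 0
      · subst hn
        obtain ⟨F, hF⟩ := exists_sum_cproj
          (fun m : Multiset T.ι => (m.map fun i => 1 - T.toBiBasis.tot i).sum) z
        have h1 := congrArg T.toS (hF (insert 0 F) (Finset.subset_insert _ _))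
        rw [hS, map_sum, Finset.sum_eq_single_of_mem 0 (Finset.mem_insert_self _ _)] at h1
        · exact h1.symm
        · intro n _ hn
          exact T.toS_of_mem hn (cproj_mem (totSet T.toBiBasis n) z)
      · exact T.toS_of_mem hn (cproj_mem _ _)
  choose w hw using h
  obtain ⟨F, hF⟩ := exists_sum_cproj
    (fun m : Multiset T.ι => (m.map fun i => 1 - T.toBiBasis.tot i).sum) z
  refine ⟨∑ n ∈ F, w n, ?_⟩
  rw [map_sum]
  conv_rhs => rw [hF F le_rfl]
  exact Finset.sum_congr rfl fun n _ => hw n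

end TateResolution

/-! ### Minimality of the Tate resolution -/

namespace TateResolution

open Cochain LInf

variable {k : Type u} [Field k] {t : Supertranslation k} (T : TateResolution.{u, v} t)

theorem int_lam {i : T.ι} (hi : T.toLInf.stage i = 0) : T.int i = 1 := by
  obtain ⟨α, hα⟩ := T.lam.surjective ⟨i, hi⟩
  have := (T.lam_deg α).2
  rwa [hα] at this

theorem int_vv {i : T.ι} (hi : T.toLInf.stage i = 1) : T.int i = 2 := by
  obtain ⟨a, ha⟩ := T.vv.surjective ⟨i, hi⟩
  have := (T.vv_deg a).2
  rwa [ha] at this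

theorem ofR_injective : Function.Injective T.ofR :=
  Function.LeftInverse.injective T.toR_ofR

/-- In internal degrees at most two there are no generators besides `λ^α` and `v^a` if the
quadrics are linearly independent. -/
theorem three_le_int_of_linearIndependent [CharZero k] (h : LinearIndependent k t.quadric) (s : ℕ) :
    ∀ i, T.toLInf.stage i = s + 2 → 3 ≤ T.int i := by
  induction s using Nat.strong_induction_on with
  | _ s ih =>
  intro i hi
  by_contra hlt
  have hpos := T.int_pos i
  have hmem : T.d (T.toLInf.x i) ∈ cspan k
      (totSet T.toBiBasis (1 - T.toBiBasis.tot i + 1) ∩ intSet T.toBiBasis (T.int i)) :=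
    mem_cspan_inter (T.toLInf.d_mem_totSet (x_mem_totSet i)) (T.toLInf.d_mem_intSet (x_mem_intSet i))
  -- Each word of `d x^i` has positive total stage, so it contains a letter of positive stage. By
  -- induction that letter has stage one, since higher stages have internal degree at least three;
  -- it is a `v` of internal degree two, which leaves no room for further letters.
  have hv : T.d (T.toLInf.x i) ∈ Submodule.span k (Set.range T.vX) := by
    refine mem_comap_of_word LinearMap.id _ (fun l hl => ?_) _ hmem
    obtain ⟨h1, h2⟩ := hl
    rw [mem_totSet_iff, tot_eq, hi] at h1
    have h2 : ((l : Multiset T.ι).map T.int).sum = T.int i := h2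
    obtain ⟨j, hj, hj1⟩ : ∃ j ∈ (l : Multiset T.ι), T.toLInf.stage j ≠ 0 := by
      by_contra hc
      push Not at hc
      rw [Multiset.map_congr rfl hc] at h1
      simp at h1
      omega
    obtain ⟨m, hm⟩ := Multiset.exists_cons_of_mem hj
    have h3 := T.stage_le_of_mem hj
    have h4 := T.toLInf.int_le_of_mem hj
    have h5 := T.stage_nonneg j
    have h6 : T.toLInf.stage j = 1 := by
      by_contra h7
      have := ih (T.toLInf.stage j - 2).toNat (by omega) j (by omega)
      omega
    have h7 := T.int_vv h6
    have h8 : m = 0 := by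
      rw [hm, Multiset.map_cons, Multiset.sum_cons] at h2
      have := T.toLInf.card_le_sum_int m
      exact Multiset.card_eq_zero.1 (by omega)
    rw [h8, Multiset.cons_zero, Multiset.coe_eq_singleton] at hm
    rw [hm, word_singleton, LinearMap.id_apply]
    obtain ⟨a, ha⟩ := T.vv.surjective ⟨j, h6⟩
    exact Submodule.subset_span ⟨a, by rw [vX, ha]⟩
  rw [Submodule.mem_span_range_iff_exists_fun] at hv
  obtain ⟨c, hc⟩ := hv
  -- `d (d x^i) = 0` turns the coefficients into a linear relation between the quadrics. By
  -- independence `d x^i` vanishes, which minimality forbids.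
  have h1 : ∑ a, c a • t.quadric a = 0 := by
    apply T.ofR_injective
    have h2 := T.d_d (T.toLInf.x i)
    rw [← hc] at h2
    simp only [map_sum, map_smul, d_vX, smul_neg, Finset.sum_neg_distrib, neg_eq_zero] at h2
    simp only [smul_comm _ (2 : k)⁻¹, ← Finset.smul_sum] at h2
    rw [map_zero]
    simpa using (smul_eq_zero.1 h2).resolve_left (inv_ne_zero two_ne_zero)
  have h2 := Fintype.linearIndependent_iff.1 h c h1
  refine T.minimal (s + 1) (by omega) i (by rw [hi]; ring) ?_
  rw [← hc]
  simp [h2]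

/-- The bounds on the degrees of the generators of the Tate resolution. -/
def IsNondegenerate : Prop := ∀ i, 2 ≤ T.toLInf.stage i ↔ 3 ≤ T.int i

theorem isNondegenerate_of_linearIndependent [CharZero k] (h : LinearIndependent k t.quadric) :
    T.IsNondegenerate := by
  intro i
  constructor
  · intro hi
    exact T.three_le_int_of_linearIndependent h (T.toLInf.stage i - 2).toNat i (by omega)
  · intro hi
    by_contra hlt
    have h0 := T.stage_nonneg i
    by_cases h1 : T.toLInf.stage i = 0
    · have := T.int_lam h1; omega
    · have := T.int_vv (i := i) (by omega); omega

variable {T}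

theorem coef_truncRes (A : LInf.{u, v} k) (m : ℤ) (j : (A.truncBasis m).ι)
    (z : Cochain k A.toBiBasis) : coef j (A.truncRes m z) = coef j.1 z := by
  refine LinearMap.congr_fun (f := coef j ∘ₗ (A.truncRes m).toLinearMap) (g := coef j.1)
    (ext_word fun l => ?_) z
  rw [LinearMap.comp_apply, AlgHom.toLinearMap_apply]
  match l with
  | [] => rw [word_nil, map_one, coef, coef, LinearMap.comp_apply, LinearMap.comp_apply, pd_one,
      pd_one, map_zero, map_zero]
  | [i] =>
    rw [word_singleton]
    by_cases hi : m ≤ A.int i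
    · rw [show A.truncRes m (Cochain.x k A.toBiBasis i) = _ from truncRes_x_of_le hi, coef_x, coef_x]
      by_cases hij : i = j.1
      · rw [if_pos hij, if_pos (Subtype.ext hij)]
      · rw [if_neg hij, if_neg (fun h => hij (congrArg Subtype.val h))]
    · rw [show A.truncRes m (Cochain.x k A.toBiBasis i) = _ from truncRes_x_of_lt (not_le.1 hi),
        map_zero, coef_x, if_neg]
      rintro rfl
      exact hi j.2
  | i :: i' :: l =>
    have h1 : ∀ {B : BiBasis.{v}} (j : B.ι) (l : List B.ι), 2 ≤ l.length →
        coef j (word k B l) = 0 := by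
      intro B j l hl
      refine coef_of_mem (S := lenSet B 2) ?_ _ (word_mem_cspan hl)
      simp [lenSet]
    rw [h1 j.1 _ (by simp)]
    rcases truncRes_word (m := m) (i :: i' :: l) with h | ⟨l', hl', h⟩
    · rw [h, map_zero]
    · rw [h]
      refine h1 j _ ?_
      have := congrArg List.length hl'
      simp at this
      omega

theorem coef_trunc_d_x (A : LInf.{u, v} k) (m : ℤ) (i j : (A.truncBasis m).ι) :
    coef j (A.truncRes m (A.d (A.truncExt m (Cochain.x k (A.truncBasis m) i)))) =
      coef j.1 (A.d (A.x i.1)) := by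
  rw [coef_truncRes, truncExt_x]

/-- If `x^j`, of stage `s ≥ 2`, occurred linearly in `d x^i`, then `x^i` would have stage `s + 1`.
Applying `d` once more would express `d x^j` through the differentials of the other generators of
stage `s` and of elements of lower stages, against minimality. -/
theorem coef_d_x_eq_zero {i j : T.ι} (hj : 2 ≤ T.toLInf.stage j) :
    coef j (T.d (T.toLInf.x i)) = 0 := by
  classical
  have hmem : T.d (T.toLInf.x i) ∈ cspan k
      (totSet T.toBiBasis (1 - T.toBiBasis.tot i + 1) ∩ intSet T.toBiBasis (T.int i)) :=
    mem_cspan_inter (T.toLInf.d_mem_totSet (x_mem_totSet i)) (T.toLInf.d_mem_intSet (x_mem_intSet i))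
  by_contra hne
  have hji : T.toLInf.stage j = T.toLInf.stage i - 1 ∧ T.int j = T.int i := by
    by_contra hc
    refine hne (coef_of_mem (fun h => hc ?_) _ hmem)
    obtain ⟨h1, h2⟩ := h
    rw [mem_totSet_iff, tot_eq] at h1
    have h2 : (({j} : Multiset T.ι).map T.int).sum = T.int i := h2
    rw [Multiset.map_singleton, Multiset.sum_singleton] at h1 h2
    exact ⟨by omega, h2⟩
  obtain ⟨hs, hint⟩ := hji
  set s := T.toLInf.stage j with hsdef
  -- The possible remaining terms: `R`-multiples of other generators of stage `s`, or words in
  -- generators of lower stages. The generator `x^j` cannot occur in a longer word, since its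
  -- internal degree equals that of `x^i`.
  set W : Submodule k (Cochain k T.toBiBasis) :=
    Submodule.span k {y | ∃ r ∈ T.toLInf.stagePart 0 0, ∃ l ∈ {l | T.toLInf.stage l = s ∧ l ≠ j},
      y = r * T.toLInf.x l} ⊔ T.toLInf.stagePart (s - 1) s with hW
  have hdW : ∀ y ∈ W, T.d y ∈ T.toLInf.dSpan {l | T.toLInf.stage l = s ∧ l ≠ j} ⊔
      (T.toLInf.stagePart (s - 1) s).map T.d := by
    intro y hy
    obtain ⟨a, ha, b, hb, rfl⟩ := Submodule.mem_sup.1 hy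
    rw [map_add]
    refine Submodule.add_mem_sup ?_ (Submodule.mem_map_of_mem hb)
    refine (Submodule.span_le (p := (T.toLInf.dSpan _).comap T.d)).2 ?_ ha
    rintro _ ⟨r, hr, l, hl, rfl⟩
    refine Submodule.subset_span ⟨r, hr, l, hl, T.d_mul_of_mem_zero ?_ _⟩
    rwa [T.stagePart_eq_totSet le_rfl, neg_zero] at hr
  have hsub : T.d (T.toLInf.x i) - coef j (T.d (T.toLInf.x i)) • T.toLInf.x j ∈ W := by
    refine mem_comap_of_word (LinearMap.id - (coef j).smulRight (T.toLInf.x j)) W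
      (fun l hl => ?_) _ hmem
    obtain ⟨h1, h2⟩ := hl
    rw [mem_totSet_iff, tot_eq] at h1
    have h2 : ((l : Multiset T.ι).map T.int).sum = T.int i := h2
    rw [LinearMap.sub_apply, LinearMap.id_apply, LinearMap.smulRight_apply]
    by_cases hjl : j ∈ (l : Multiset T.ι)
    · obtain ⟨m, hm⟩ := Multiset.exists_cons_of_mem hjl
      have h8 : m = 0 := by
        rw [hm, Multiset.map_cons, Multiset.sum_cons] at h2
        have := T.toLInf.card_le_sum_int m
        exact Multiset.card_eq_zero.1 (by omega)
      rw [h8, Multiset.cons_zero, Multiset.coe_eq_singleton] at hm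
      rw [hm, word_singleton, coef_x, if_pos rfl, one_smul, sub_self]
      exact Submodule.zero_mem _
    · rw [coef_of_mem (S := {(l : Multiset T.ι)}) (fun h => hjl (by rw [← h]; simp)) _
        (word_mem_cspan rfl), zero_smul, sub_zero]
      by_cases hex : ∃ i' ∈ l, T.toLInf.stage i' = s
      · obtain ⟨i', hi', hst⟩ := hex
        refine Submodule.mem_sup_left (Submodule.subset_span ?_)
        obtain ⟨l₁, l₂, rfl⟩ := List.append_of_mem hi'
        rw [Multiset.map_coe, Multiset.sum_coe, List.map_append, List.map_cons, List.sum_append,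
          List.sum_cons] at h1
        have h3 := T.sum_stage_nonneg l₁
        have h4 := T.sum_stage_nonneg l₂
        rw [Multiset.map_coe, Multiset.sum_coe] at h3 h4
        have h5 : word k T.toBiBasis l₁ ∈ cspan k (totSet T.toBiBasis 0) :=
          word_mem_cspan (T.mem_totSet_iff.2 (by
            rw [Multiset.map_coe, Multiset.sum_coe]; omega))
        have h6 : word k T.toBiBasis l₂ ∈ cspan k (totSet T.toBiBasis 0) :=
          word_mem_cspan (T.mem_totSet_iff.2 (by
            rw [Multiset.map_coe, Multiset.sum_coe]; omega))
        refine ⟨word k T.toBiBasis l₁ * word k T.toBiBasis l₂, ?_, i', ⟨hst, ?_⟩, ?_⟩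
        · rw [T.stagePart_eq_totSet le_rfl, neg_zero]
          have := mul_mem_totSet h5 h6
          rwa [add_zero] at this
        · rintro rfl
          exact hjl hi'
        · rw [word_append, word_cons, mul_assoc, T.commute_of_mem_zero h6]
      · refine Submodule.mem_sup_right ?_
        rw [T.stagePart_eq]
        refine word_mem_cspan ⟨fun i' hi' => ?_, by omega⟩
        have h3 := T.stage_le_of_mem hi'
        have h4 : T.toLInf.stage i' ≠ s := fun h => hex ⟨i', hi', h⟩
        omega
  have h1 := hdW _ hsub
  rw [map_sub, T.d_d, map_smul, zero_sub, Submodule.neg_mem_iff] at h1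
  have h2 := (Submodule.smul_mem_iff _ hne).1 h1
  have h3 := T.minimal (s - 1) (by omega) j (by omega)
  rw [sub_add_cancel] at h3
  exact h3 h2

/-- Nondegeneracy identifies the generators of `𝔫` with those of stage at least two, none of which
occurs linearly in a differential. -/
theorem isMinimal_n (hT : T.IsNondegenerate) : T.n.IsMinimal := by
  intro i
  have h3 : 3 ≤ T.int i.1 := i.2
  refine mem_lenSet_two (S := intSet _ (T.int i.1)) ?_ (T.n.d_mem_intSet (x_mem_intSet i))
    fun j => ?_
  · intro h
    have : (0 : ℤ) = T.int i.1 := h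
    omega
  · refine (coef_trunc_d_x T.toLInf 3 i j).trans ?_
    exact coef_d_x_eq_zero ((hT j.1).2 j.2)

end TateResolution

/-! ### Functions on superspace -/

namespace Supertranslation

variable {k : Type u} [Field k] (t : Supertranslation k)

/-- The algebra of polynomial functions on superspace. -/
abbrev OT : Type u := t.Odd ⊗[k] t.Even

theorem ι_eq_sum (m : Fin t.dim₁ → k) : ExteriorAlgebra.ι k m = ∑ α, m α • t.θ α := by
  conv_lhs => rw [pi_eq_sum_univ' m]
  rw [map_sum]
  refine Finset.sum_congr rfl fun α _ => ?_
  rw [map_smul, θ]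

theorem θ_mul_θ (α β : Fin t.dim₁) : t.θ α * t.θ β = -(t.θ β * t.θ α) :=
  eq_neg_of_add_eq_zero_left (ExteriorAlgebra.ι_add_mul_swap _ _)

theorem dθ_ι_mul (α : Fin t.dim₁) (m : Fin t.dim₁ → k) (ω : t.Odd) :
    t.dθ α (ExteriorAlgebra.ι k m * ω) = m α • ω - ExteriorAlgebra.ι k m * t.dθ α ω :=
  CliffordAlgebra.contractLeft_ι_mul _ _ _

theorem dθ_one (α : Fin t.dim₁) : t.dθ α 1 = 0 := CliffordAlgebra.contractLeft_one _ _

theorem dθ_θ_mul (α β : Fin t.dim₁) (ω : t.Odd) :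
    t.dθ α (t.θ β * ω) = (if α = β then ω else 0) - t.θ β * t.dθ α ω := by
  rw [θ, dθ_ι_mul, Pi.single_apply, ite_smul, one_smul, zero_smul]

theorem dθ_dθ (α β : Fin t.dim₁) (ω : t.Odd) : t.dθ α (t.dθ β ω) = -t.dθ β (t.dθ α ω) :=
  CliffordAlgebra.contractLeft_comm _ _ _

/-- The parity operator on the functions of the odd coordinates. -/
def par : t.Odd →ₐ[k] t.Odd := CliffordAlgebra.involute

theorem par_ι (m : Fin t.dim₁ → k) :
    t.par (ExteriorAlgebra.ι k m) = -ExteriorAlgebra.ι k m := CliffordAlgebra.involute_ι m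

theorem par_θ (α : Fin t.dim₁) : t.par (t.θ α) = -t.θ α := t.par_ι _

theorem par_par (ω : t.Odd) : t.par (t.par ω) = ω := CliffordAlgebra.involute_involute ω

theorem dθ_par (α : Fin t.dim₁) (ω : t.Odd) : t.dθ α (t.par ω) = -t.par (t.dθ α ω) := by
  induction ω using CliffordAlgebra.left_induction with
  | algebraMap r =>
    rw [AlgHom.commutes, Algebra.algebraMap_eq_smul_one, map_smul, dθ_one, smul_zero, map_zero,
      neg_zero]
  | add a b ha hb => rw [map_add, map_add, ha, hb, map_add, map_add, neg_add]
  | ι_mul ω m h =>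
    change t.dθ α (t.par (ExteriorAlgebra.ι k m * ω)) = -t.par (t.dθ α (ExteriorAlgebra.ι k m * ω))
    rw [map_mul, par_ι, neg_mul, map_neg, dθ_ι_mul, h, dθ_ι_mul, map_sub, map_smul, map_mul, par_ι]
    simp

section Degree

variable {t}

theorem ι_mul_mem (m : Fin t.dim₁ → k) {r : ℕ} {ω : t.Odd} (h : ω ∈ ⋀[k]^r (Fin t.dim₁ → k)) :
    ExteriorAlgebra.ι k m * ω ∈ ⋀[k]^(r + 1) (Fin t.dim₁ → k) := by
  change _ ∈ LinearMap.range (ExteriorAlgebra.ι k) ^ (r + 1)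
  rw [pow_succ']
  exact Submodule.mul_mem_mul ⟨m, rfl⟩ h

theorem exteriorPower_induction {r : ℕ} {N : Submodule k t.Odd}
    (h : ∀ m, ∀ ω ∈ ⋀[k]^r (Fin t.dim₁ → k), ExteriorAlgebra.ι k m * ω ∈ N) :
    ∀ ω ∈ ⋀[k]^(r + 1) (Fin t.dim₁ → k), ω ∈ N := by
  intro ω hω
  change ω ∈ LinearMap.range (ExteriorAlgebra.ι k) ^ (r + 1) at hω
  rw [pow_succ'] at hω
  refine (Submodule.mul_le (P := N)).2 ?_ hω
  rintro _ ⟨m, rfl⟩ ω hω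
  exact h m ω hω

theorem mem_exteriorPower_zero {ω : t.Odd} : ω ∈ ⋀[k]^0 (Fin t.dim₁ → k) ↔ ∃ c : k, c • 1 = ω := by
  change ω ∈ LinearMap.range (ExteriorAlgebra.ι k) ^ 0 ↔ _
  rw [pow_zero, Submodule.one_eq_span, Submodule.mem_span_singleton]

theorem dθ_of_mem_zero (α : Fin t.dim₁) {ω : t.Odd} (h : ω ∈ ⋀[k]^0 (Fin t.dim₁ → k)) :
    t.dθ α ω = 0 := by
  obtain ⟨c, rfl⟩ := mem_exteriorPower_zero.1 h
  rw [map_smul, dθ_one, smul_zero]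

theorem dθ_mem (α : Fin t.dim₁) {r : ℕ} :
    ∀ ω ∈ ⋀[k]^(r + 1) (Fin t.dim₁ → k), t.dθ α ω ∈ ⋀[k]^r (Fin t.dim₁ → k) := by
  induction r with
  | zero =>
    refine exteriorPower_induction (N := (⋀[k]^0 (Fin t.dim₁ → k)).comap (t.dθ α)) fun m ω hω => ?_
    rw [Submodule.mem_comap, dθ_ι_mul, dθ_of_mem_zero α hω, mul_zero, sub_zero]
    exact Submodule.smul_mem _ _ hω
  | succ r ih =>
    refine exteriorPower_induction (N := (⋀[k]^(r + 1) (Fin t.dim₁ → k)).comap (t.dθ α))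
      fun m ω hω => ?_
    rw [Submodule.mem_comap, dθ_ι_mul]
    exact Submodule.sub_mem _ (Submodule.smul_mem _ _ hω) (ι_mul_mem m (ih ω hω))

theorem par_mem {r : ℕ} : ∀ ω ∈ ⋀[k]^r (Fin t.dim₁ → k), t.par ω ∈ ⋀[k]^r (Fin t.dim₁ → k) := by
  induction r with
  | zero =>
    intro ω hω
    obtain ⟨c, rfl⟩ := mem_exteriorPower_zero.1 hω
    rwa [map_smul, map_one]
  | succ r ih =>
    refine exteriorPower_induction (N := (⋀[k]^(r + 1) (Fin t.dim₁ → k)).comap t.par.toLinearMap)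
      fun m ω hω => ?_
    rw [Submodule.mem_comap, AlgHom.toLinearMap_apply, map_mul, par_ι, neg_mul]
    exact Submodule.neg_mem _ (ι_mul_mem m (ih ω hω))

theorem sum_θ_mul_dθ {r : ℕ} :
    ∀ ω ∈ ⋀[k]^r (Fin t.dim₁ → k), ∑ α, t.θ α * t.dθ α ω = (r : k) • ω := by
  induction r with
  | zero =>
    intro ω hω
    simp [dθ_of_mem_zero _ hω]
  | succ r ih =>
    intro ω hω
    have h : ω ∈ LinearMap.eqLocus (∑ α, LinearMap.mulLeft k (t.θ α) ∘ₗ t.dθ α)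
        (((r + 1 : ℕ) : k) • LinearMap.id) := by
      refine exteriorPower_induction (fun m ω hω => ?_) ω hω
      rw [LinearMap.mem_eqLocus]
      simp only [LinearMap.sum_apply, LinearMap.comp_apply, LinearMap.mulLeft_apply, dθ_ι_mul,
        LinearMap.smul_apply, LinearMap.id_apply, mul_sub, mul_smul_comm, Finset.sum_sub_distrib]
      have h1 : ∑ α, t.θ α * (ExteriorAlgebra.ι k m * t.dθ α ω) =
          -(ExteriorAlgebra.ι k m * ∑ α, t.θ α * t.dθ α ω) := by
        rw [Finset.mul_sum, ← Finset.sum_neg_distrib]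
        refine Finset.sum_congr rfl fun α _ => ?_
        rw [← mul_assoc, ← mul_assoc, ← neg_mul]
        congr 1
        exact eq_neg_of_add_eq_zero_left (ExteriorAlgebra.ι_add_mul_swap _ _)
      rw [h1, ih ω hω, sub_neg_eq_add, mul_smul_comm, ι_eq_sum, Finset.sum_mul]
      simp only [smul_mul_assoc]
      push_cast
      rw [add_smul, one_smul, add_comm]
    simpa using h

end Degree

/-! ### Operators on functions on superspace -/

/-- The operator `∂/∂θ^α`. -/
def dT (α : Fin t.dim₁) : t.OT →ₗ[k] t.OT := TensorProduct.map (t.dθ α) LinearMap.id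

/-- Multiplication by `θ^α`. -/
def θT (α : Fin t.dim₁) : t.OT →ₗ[k] t.OT :=
  TensorProduct.map (LinearMap.mulLeft k (t.θ α)) LinearMap.id

/-- The operator `∂/∂x^a`. -/
def pT (a : Fin t.dim₂) : t.OT →ₗ[k] t.OT :=
  TensorProduct.map LinearMap.id (MvPolynomial.pderiv a).toLinearMap

/-- Multiplication by `x^a`. -/
def xT (a : Fin t.dim₂) : t.OT →ₗ[k] t.OT :=
  TensorProduct.map LinearMap.id (LinearMap.mulLeft k (MvPolynomial.X a))

/-- The parity operator. -/
def σT : t.OT →ₗ[k] t.OT := TensorProduct.map t.par.toLinearMap LinearMap.id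

theorem dT_tmul (α : Fin t.dim₁) (ω : t.Odd) (f : t.Even) :
    t.dT α (ω ⊗ₜ f) = t.dθ α ω ⊗ₜ f := rfl

theorem θT_tmul (α : Fin t.dim₁) (ω : t.Odd) (f : t.Even) :
    t.θT α (ω ⊗ₜ f) = (t.θ α * ω) ⊗ₜ f := rfl

theorem pT_tmul (a : Fin t.dim₂) (ω : t.Odd) (f : t.Even) :
    t.pT a (ω ⊗ₜ f) = ω ⊗ₜ MvPolynomial.pderiv a f := rfl

theorem xT_tmul (a : Fin t.dim₂) (ω : t.Odd) (f : t.Even) :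
    t.xT a (ω ⊗ₜ f) = ω ⊗ₜ (MvPolynomial.X a * f) := rfl

theorem σT_tmul (ω : t.Odd) (f : t.Even) : t.σT (ω ⊗ₜ f) = t.par ω ⊗ₜ f := rfl

variable {t}

theorem OT_congr {N : Type*} [AddCommGroup N] [Module k N] {A B : t.OT →ₗ[k] N}
    (h : ∀ ω f, A (ω ⊗ₜ f) = B (ω ⊗ₜ f)) (o : t.OT) : A o = B o :=
  LinearMap.congr_fun (TensorProduct.ext' h) o

theorem dT_dT (α β : Fin t.dim₁) (o : t.OT) : t.dT α (t.dT β o) = -t.dT β (t.dT α o) := by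
  refine OT_congr (A := t.dT α ∘ₗ t.dT β) (B := -(t.dT β ∘ₗ t.dT α)) (fun ω f => ?_) o
  change t.dθ α (t.dθ β ω) ⊗ₜ[k] f = -(t.dθ β (t.dθ α ω) ⊗ₜ[k] f)
  rw [dθ_dθ, TensorProduct.neg_tmul]

theorem dT_θT (α β : Fin t.dim₁) (o : t.OT) :
    t.dT α (t.θT β o) = (if α = β then o else 0) - t.θT β (t.dT α o) := by
  refine eq_sub_of_add_eq ?_
  induction o using TensorProduct.induction_on with
  | zero => simp
  | tmul ω f =>
    rw [θT_tmul, dT_tmul, dT_tmul, θT_tmul, ← TensorProduct.add_tmul, dθ_θ_mul, sub_add_cancel]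
    split_ifs
    · rfl
    · rw [TensorProduct.zero_tmul]
  | add a b ha hb =>
    rw [map_add, map_add, map_add, map_add, add_add_add_comm, ha, hb]
    split_ifs <;> simp

theorem θT_θT (α β : Fin t.dim₁) (o : t.OT) : t.θT α (t.θT β o) = -t.θT β (t.θT α o) := by
  refine OT_congr (A := t.θT α ∘ₗ t.θT β) (B := -(t.θT β ∘ₗ t.θT α)) (fun ω f => ?_) o
  change (t.θ α * (t.θ β * ω)) ⊗ₜ[k] f = -((t.θ β * (t.θ α * ω)) ⊗ₜ[k] f)
  rw [← mul_assoc, θ_mul_θ, neg_mul, mul_assoc, TensorProduct.neg_tmul]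

theorem pT_xT (a b : Fin t.dim₂) (o : t.OT) :
    t.pT a (t.xT b o) = t.xT b (t.pT a o) + if a = b then o else 0 := by
  induction o using TensorProduct.induction_on with
  | zero => simp
  | tmul ω f =>
    rw [xT_tmul, pT_tmul, pT_tmul, xT_tmul, Derivation.leibniz, MvPolynomial.pderiv_X,
      TensorProduct.tmul_add, smul_eq_mul]
    congr 1
    split_ifs with h
    · subst h
      simp
    · rw [Pi.single_eq_of_ne (Ne.symm h), smul_zero, TensorProduct.tmul_zero]
  | add c d hc hd =>
    rw [map_add, map_add, map_add, map_add, hc, hd, add_add_add_comm]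
    split_ifs <;> simp

theorem pT_pT (a b : Fin t.dim₂) (o : t.OT) : t.pT a (t.pT b o) = t.pT b (t.pT a o) := by
  refine OT_congr (A := t.pT a ∘ₗ t.pT b) (B := t.pT b ∘ₗ t.pT a) (fun ω f => ?_) o
  change ω ⊗ₜ[k] MvPolynomial.pderiv a (MvPolynomial.pderiv b f) =
    ω ⊗ₜ[k] MvPolynomial.pderiv b (MvPolynomial.pderiv a f)
  congr 1
  have h : ⁅(MvPolynomial.pderiv a : Derivation k t.Even t.Even),
      (MvPolynomial.pderiv b : Derivation k t.Even t.Even)⁆ = 0 := by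
    refine MvPolynomial.derivation_ext fun i => ?_
    rw [Derivation.commutator_apply, MvPolynomial.pderiv_X, MvPolynomial.pderiv_X]
    by_cases h1 : i = a <;> by_cases h2 : i = b <;> simp [Pi.single_apply, h1, h2] <;>
      split_ifs <;> simp
  have := Derivation.congr_fun h f
  rw [Derivation.commutator_apply] at this
  exact sub_eq_zero.1 this

theorem pT_θT (a : Fin t.dim₂) (α : Fin t.dim₁) (o : t.OT) :
    t.pT a (t.θT α o) = t.θT α (t.pT a o) :=
  OT_congr (A := t.pT a ∘ₗ t.θT α) (B := t.θT α ∘ₗ t.pT a) (fun _ _ => rfl) o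

theorem pT_dT (a : Fin t.dim₂) (α : Fin t.dim₁) (o : t.OT) :
    t.pT a (t.dT α o) = t.dT α (t.pT a o) :=
  OT_congr (A := t.pT a ∘ₗ t.dT α) (B := t.dT α ∘ₗ t.pT a) (fun _ _ => rfl) o

theorem xT_θT (a : Fin t.dim₂) (α : Fin t.dim₁) (o : t.OT) :
    t.xT a (t.θT α o) = t.θT α (t.xT a o) :=
  OT_congr (A := t.xT a ∘ₗ t.θT α) (B := t.θT α ∘ₗ t.xT a) (fun _ _ => rfl) o

theorem xT_dT (a : Fin t.dim₂) (α : Fin t.dim₁) (o : t.OT) :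
    t.xT a (t.dT α o) = t.dT α (t.xT a o) :=
  OT_congr (A := t.xT a ∘ₗ t.dT α) (B := t.dT α ∘ₗ t.xT a) (fun _ _ => rfl) o

theorem σT_σT (o : t.OT) : t.σT (t.σT o) = o := by
  refine OT_congr (A := t.σT ∘ₗ t.σT) (B := LinearMap.id) (fun ω f => ?_) o
  change t.par (t.par ω) ⊗ₜ[k] f = ω ⊗ₜ f
  rw [par_par]

theorem σT_pT (a : Fin t.dim₂) (o : t.OT) : t.σT (t.pT a o) = t.pT a (t.σT o) :=
  OT_congr (A := t.σT ∘ₗ t.pT a) (B := t.pT a ∘ₗ t.σT) (fun _ _ => rfl) o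

theorem σT_xT (a : Fin t.dim₂) (o : t.OT) : t.σT (t.xT a o) = t.xT a (t.σT o) :=
  OT_congr (A := t.σT ∘ₗ t.xT a) (B := t.xT a ∘ₗ t.σT) (fun _ _ => rfl) o

theorem σT_θT (α : Fin t.dim₁) (o : t.OT) : t.σT (t.θT α o) = -t.θT α (t.σT o) := by
  refine OT_congr (A := t.σT ∘ₗ t.θT α) (B := -(t.θT α ∘ₗ t.σT)) (fun ω f => ?_) o
  change t.par (t.θ α * ω) ⊗ₜ[k] f = -((t.θ α * t.par ω) ⊗ₜ[k] f)
  rw [map_mul, par_θ, neg_mul, TensorProduct.neg_tmul]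

theorem σT_dT (α : Fin t.dim₁) (o : t.OT) : t.σT (t.dT α o) = -t.dT α (t.σT o) := by
  refine OT_congr (A := t.σT ∘ₗ t.dT α) (B := -(t.dT α ∘ₗ t.σT)) (fun ω f => ?_) o
  change t.par (t.dθ α ω) ⊗ₜ[k] f = -(t.dθ α (t.par ω) ⊗ₜ[k] f)
  rw [dθ_par, TensorProduct.neg_tmul, neg_neg]

variable (t) in
/-- The second part of the covariant derivative. -/
def shear (α : Fin t.dim₁) : t.OT →ₗ[k] t.OT :=
  (2 : k)⁻¹ • ∑ a, ∑ β, t.γ a α β • (t.θT β ∘ₗ t.pT a)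

theorem shear_apply (α : Fin t.dim₁) (o : t.OT) :
    t.shear α o = (2 : k)⁻¹ • ∑ a, ∑ β, t.γ a α β • t.θT β (t.pT a o) := by
  simp only [shear, LinearMap.smul_apply, LinearMap.sum_apply, LinearMap.comp_apply]

theorem covD_apply (α : Fin t.dim₁) (o : t.OT) : t.covD α o = t.dT α o + t.shear α o := by
  have h : ∀ (β : Fin t.dim₁) (a : Fin t.dim₂), t.θT β ∘ₗ t.pT a =
      TensorProduct.map (LinearMap.mulLeft k (t.θ β)) (MvPolynomial.pderiv a).toLinearMap :=
    fun β a => TensorProduct.ext' fun _ _ => rfl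
  simp only [covD, shear, h]
  rfl

theorem pT_shear (a : Fin t.dim₂) (α : Fin t.dim₁) (o : t.OT) :
    t.pT a (t.shear α o) = t.shear α (t.pT a o) := by
  simp only [shear_apply, map_smul, map_sum, pT_θT, pT_pT a]

theorem θT_shear (α β : Fin t.dim₁) (o : t.OT) :
    t.θT α (t.shear β o) = -t.shear β (t.θT α o) := by
  simp only [shear_apply, map_smul, map_sum, θT_θT α, pT_θT, smul_neg, Finset.sum_neg_distrib]

theorem σT_shear (α : Fin t.dim₁) (o : t.OT) : t.σT (t.shear α o) = -t.shear α (t.σT o) := by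
  simp only [shear_apply, map_smul, map_sum, σT_θT, σT_pT, smul_neg, Finset.sum_neg_distrib]

theorem dT_shear (α β : Fin t.dim₁) (o : t.OT) : t.dT α (t.shear β o) =
    (2 : k)⁻¹ • ∑ a, t.γ a β α • t.pT a o - t.shear β (t.dT α o) := by
  simp only [shear_apply, map_smul, map_sum, dT_θT, pT_dT, smul_sub, Finset.sum_sub_distrib,
    smul_ite, smul_zero, Finset.sum_ite_eq, Finset.mem_univ, if_true]

theorem shear_shear (α β : Fin t.dim₁) (o : t.OT) :
    t.shear α (t.shear β o) = -t.shear β (t.shear α o) := by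
  rw [shear_apply α, shear_apply α]
  simp only [pT_shear, θT_shear, map_smul, map_sum, smul_neg, Finset.sum_neg_distrib]

theorem shear_xT (α : Fin t.dim₁) (b : Fin t.dim₂) (o : t.OT) : t.shear α (t.xT b o) =
    t.xT b (t.shear α o) + (2 : k)⁻¹ • ∑ β, t.γ b α β • t.θT β o := by
  simp only [shear_apply, map_smul, map_sum, pT_xT, xT_θT, map_add, smul_add,
    Finset.sum_add_distrib, apply_ite (t.θT _), map_zero, smul_ite, smul_zero]
  rw [Finset.sum_comm (f := fun a β => if a = b then t.γ a α β • t.θT β o else 0)]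
  simp only [Finset.sum_ite_eq', Finset.mem_univ, if_true]

/-- Each of the two mixed anticommutators of `∂/∂θ` with the shear contributes half of the
translation. -/
theorem covD_covD [CharZero k] (α β : Fin t.dim₁) (o : t.OT) :
    t.covD α (t.covD β o) + t.covD β (t.covD α o) = ∑ a, t.γ a α β • t.pT a o := by
  refine Eq.trans (b := (2 : k)⁻¹ • ∑ a, t.γ a α β • t.pT a o +
    (2 : k)⁻¹ • ∑ a, t.γ a α β • t.pT a o) ?_ ?_
  · simp only [covD_apply, map_add, dT_shear, dT_dT α β, shear_shear α β, t.symm _ β α]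
    abel
  · rw [← add_smul, ← two_mul, mul_inv_cancel₀ two_ne_zero, one_smul]

theorem pT_covD (a : Fin t.dim₂) (α : Fin t.dim₁) (o : t.OT) :
    t.pT a (t.covD α o) = t.covD α (t.pT a o) := by
  rw [covD_apply, covD_apply, map_add, pT_dT, pT_shear]

theorem σT_covD (α : Fin t.dim₁) (o : t.OT) : t.σT (t.covD α o) = -t.covD α (t.σT o) := by
  rw [covD_apply, covD_apply, map_add, σT_dT, σT_shear, neg_add]

theorem covD_θT (α β : Fin t.dim₁) (o : t.OT) :
    t.covD α (t.θT β o) = (if α = β then o else 0) - t.θT β (t.covD α o) := by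
  rw [covD_apply, covD_apply, map_add, dT_θT, θT_shear]
  abel

theorem covD_xT (α : Fin t.dim₁) (b : Fin t.dim₂) (o : t.OT) : t.covD α (t.xT b o) =
    t.xT b (t.covD α o) + (2 : k)⁻¹ • ∑ β, t.γ b α β • t.θT β o := by
  rw [covD_apply, covD_apply, map_add, xT_dT, shear_xT, add_assoc]

/-- The structure constants are symmetric in the two odd indices while `θ^α θ^β` is antisymmetric.
-/
theorem sum_θT_shear [CharZero k] (o : t.OT) : ∑ α, t.θT α (t.shear α o) = 0 := by
  have h : ∀ a, ∑ α, ∑ β, t.γ a α β • t.θT α (t.θT β (t.pT a o)) = 0 := by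
    intro a
    have h1 : ∑ α, ∑ β, t.γ a α β • t.θT α (t.θT β (t.pT a o)) =
        -∑ α, ∑ β, t.γ a α β • t.θT α (t.θT β (t.pT a o)) := by
      conv_lhs => rw [Finset.sum_comm]
      rw [← Finset.sum_neg_distrib]
      refine Finset.sum_congr rfl fun α _ => ?_
      rw [← Finset.sum_neg_distrib]
      refine Finset.sum_congr rfl fun β _ => ?_
      rw [θT_θT, t.symm, smul_neg]
    have h2 : (2 : k) • ∑ α, ∑ β, t.γ a α β • t.θT α (t.θT β (t.pT a o)) = 0 := by
      rw [two_smul]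
      nth_rewrite 1 [h1]
      exact neg_add_cancel _
    exact (smul_eq_zero.1 h2).resolve_left two_ne_zero
  simp only [shear_apply, map_smul, map_sum]
  rw [← Finset.smul_sum, Finset.sum_comm]
  simp only [h, Finset.sum_const_zero, smul_zero]

end Supertranslation

/-! ### Linear functions and the quadrics -/

theorem BiCohomology.mem_of_subsingleton {k : Type u} [Field k] {X : Type w} [AddCommGroup X]
    [Module k X] {P : ℤ → ℤ → Submodule k X} {d : X →ₗ[k] X} {N : Submodule k X} {p q : ℤ}
    (h0 : Subsingleton (BiCohomology P d N p q)) {y : X} (hy : y ∈ LinearMap.ker d ⊓ P p q) :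
    y ∈ (P (p - 1) q).map d ⊔ N := by
  have h : (Submodule.Quotient.mk ⟨y, hy⟩ : BiCohomology P d N p q) = 0 := h0.elim _ _
  rwa [Submodule.Quotient.mk_eq_zero] at h

namespace Supertranslation

variable {k : Type u} [Field k] {t : Supertranslation k}

variable (t) in
/-- Evaluation of functions at the origin of superspace. -/
def evalT : t.OT →ₗ[k] k :=
  (TensorProduct.lid k k).toLinearMap ∘ₗ
    TensorProduct.map (ExteriorAlgebra.algebraMapInv (R := k) (M := Fin t.dim₁ → k)).toLinearMap
      (MvPolynomial.aeval (R := k) fun _ : Fin t.dim₂ => (0 : k)).toLinearMap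

theorem evalT_tmul (ω : t.Odd) (f : t.Even) : t.evalT (ω ⊗ₜ f) =
    ExteriorAlgebra.algebraMapInv ω * MvPolynomial.aeval (R := k) (fun _ => (0 : k)) f := rfl

theorem evalT_one : t.evalT (1 ⊗ₜ 1) = 1 := by
  rw [evalT_tmul, map_one, map_one, mul_one]

theorem evalT_θT (α : Fin t.dim₁) (o : t.OT) : t.evalT (t.θT α o) = 0 := by
  refine OT_congr (A := t.evalT ∘ₗ t.θT α) (B := 0) (fun ω f => ?_) o
  change t.evalT (t.θT α (ω ⊗ₜ f)) = 0
  rw [θT_tmul, evalT_tmul, map_mul, θ]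
  have : ExteriorAlgebra.algebraMapInv
      (ExteriorAlgebra.ι k (Pi.single α (1 : k) : Fin t.dim₁ → k)) = 0 := by
    simp [ExteriorAlgebra.algebraMapInv]
  rw [this, zero_mul, zero_mul]

theorem evalT_xT (a : Fin t.dim₂) (o : t.OT) : t.evalT (t.xT a o) = 0 := by
  refine OT_congr (A := t.evalT ∘ₗ t.xT a) (B := 0) (fun ω f => ?_) o
  change t.evalT (t.xT a (ω ⊗ₜ f)) = 0
  rw [xT_tmul, evalT_tmul, map_mul, MvPolynomial.aeval_X, zero_mul, mul_zero]

theorem evalT_σT (o : t.OT) : t.evalT (t.σT o) = t.evalT o := by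
  refine OT_congr (A := t.evalT ∘ₗ t.σT) (B := t.evalT) (fun ω f => ?_) o
  change t.evalT (t.σT (ω ⊗ₜ f)) = _
  rw [σT_tmul, evalT_tmul, evalT_tmul]
  congr 1
  have : (ExteriorAlgebra.algebraMapInv (R := k) (M := Fin t.dim₁ → k)).comp t.par =
      ExteriorAlgebra.algebraMapInv := by
    ext m
    change ExteriorAlgebra.algebraMapInv (t.par (ExteriorAlgebra.ι k _)) =
      ExteriorAlgebra.algebraMapInv (ExteriorAlgebra.ι k _)
    rw [par_ι, map_neg]
    simp [ExteriorAlgebra.algebraMapInv]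
  exact AlgHom.congr_fun this ω

theorem dT_one (α : Fin t.dim₁) : t.dT α (1 ⊗ₜ 1) = 0 := by
  rw [dT_tmul, dθ_one, TensorProduct.zero_tmul]

theorem pT_one (a : Fin t.dim₂) : t.pT a (1 ⊗ₜ 1) = 0 := by
  rw [pT_tmul, Derivation.map_one_eq_zero, TensorProduct.tmul_zero]

theorem σT_one : t.σT (1 ⊗ₜ 1) = 1 ⊗ₜ 1 := by
  rw [σT_tmul, map_one]

theorem covD_one (α : Fin t.dim₁) : t.covD α (1 ⊗ₜ 1) = 0 := by
  rw [covD_apply, dT_one, shear_apply]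
  simp [pT_one]

variable (t) in
/-- Evaluation at the origin of the pure spinor scheme. -/
def evalS : t.S →ₐ[k] k :=
  Ideal.Quotient.liftₐ t.quadrics (MvPolynomial.aeval fun _ => (0 : k)) (by
    intro f hf
    induction hf using Submodule.span_induction with
    | mem f h =>
      obtain ⟨a, rfl⟩ := h
      simp
    | zero => exact map_zero _
    | add f g _ _ hf hg => rw [map_add, hf, hg, add_zero]
    | smul r f _ hf => rw [smul_eq_mul, map_mul, hf, mul_zero])

theorem piece_of_neg {p : ℤ} (hp : p < 0) (q : ℤ) : t.piece p q = ⊥ := by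
  rw [piece, Submodule.span_eq_bot]
  rintro _ ⟨r, b, l, ω, f, g, -, -, -, h, -, -⟩
  omega

theorem D_tmul (o : t.OT) (s : t.S) : t.D (o ⊗ₜ s) =
    ∑ α, t.covD α o ⊗ₜ[k] (Ideal.Quotient.mk t.quadrics (MvPolynomial.X α) * s) := by
  simp only [D, LinearMap.sum_apply, TensorProduct.map_tmul, mulLam, LinearMap.mulLeft_apply]

/-- Polarisation: a symmetric form whose quadratic form vanishes is zero when two is invertible. -/
theorem sum_γ_eq_zero [CharZero k] {c : Fin t.dim₂ → k} (h : ∑ a, c a • t.quadric a = 0)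
    (α β : Fin t.dim₁) : ∑ a, c a * t.γ a α β = 0 := by
  set g : Fin t.dim₁ → Fin t.dim₁ → k := fun α β => ∑ a, c a * t.γ a α β with hg
  have hsymm : ∀ α β, g α β = g β α := fun α β => by simp only [hg, t.symm _ α β]
  have h1 : ∀ x : Fin t.dim₁ → k, ∑ α, ∑ β, g α β * (x α * x β) = 0 := by
    intro x
    have h2 := congrArg (MvPolynomial.aeval x) h
    simp only [quadric, map_sum, map_smul, map_mul, MvPolynomial.aeval_X, map_zero, smul_eq_mul,
      Finset.mul_sum] at h2
    rw [Finset.sum_comm] at h2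
    rw [← h2]
    refine Finset.sum_congr rfl fun α _ => ?_
    rw [Finset.sum_comm]
    refine Finset.sum_congr rfl fun β _ => ?_
    rw [hg, Finset.sum_mul]
    exact Finset.sum_congr rfl fun a _ => by ring
  have h2 : ∀ x y : Fin t.dim₁ → k, ∑ α, ∑ β, g α β * (x α * y β) +
      ∑ α, ∑ β, g α β * (y α * x β) = 0 := by
    intro x y
    have h3 := h1 (x + y)
    simp only [Pi.add_apply, add_mul, mul_add, Finset.sum_add_distrib] at h3
    have hx := h1 x
    have hy := h1 y
    linear_combination h3 - hx - hy
  have h3 := h2 (Pi.single α 1) (Pi.single β 1)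
  simp only [Pi.single_apply, mul_ite, mul_one, mul_zero, Finset.sum_ite_eq', Finset.mem_univ,
    if_true] at h3
  have h4 : (2 : k) * g α β = 0 := by
    rw [two_mul]
    nth_rewrite 2 [hsymm α β]
    exact h3
  exact (mul_eq_zero.1 h4).resolve_left two_ne_zero

/-- The pairing of a function on superspace tensor `S` with `∂/∂x^a` at the origin. -/
def evalA (a : Fin t.dim₂) : t.A →ₗ[k] k :=
  (TensorProduct.lid k k).toLinearMap ∘ₗ
    TensorProduct.map (t.evalT ∘ₗ t.pT a) t.evalS.toLinearMap

theorem evalA_tmul (a : Fin t.dim₂) (o : t.OT) (s : t.S) :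
    evalA a (o ⊗ₜ s) = t.evalT (t.pT a o) * t.evalS s := rfl

theorem evalA_one (a : Fin t.dim₂) : evalA a (1 : t.A) = 0 := by
  have : (1 : t.A) = ((1 : t.Odd) ⊗ₜ[k] (1 : t.Even)) ⊗ₜ[k] (1 : t.S) := rfl
  rw [this, evalA_tmul, pT_one, map_zero, zero_mul]

variable (t) in
/-- The linear function `∑ c a • x a` on superspace. -/
def linearT (c : Fin t.dim₂ → k) : t.OT := ∑ a, c a • t.xT a (1 ⊗ₜ 1)

theorem evalA_linearT (c : Fin t.dim₂ → k) (a : Fin t.dim₂) :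
    evalA a (t.linearT c ⊗ₜ[k] (1 : t.S)) = c a := by
  rw [evalA_tmul, map_one, mul_one, linearT, map_sum, map_sum]
  simp only [map_smul, pT_xT, pT_one, map_zero, zero_add, apply_ite t.evalT, evalT_one, smul_eq_mul,
    mul_ite, mul_one, mul_zero, Finset.sum_ite_eq, Finset.mem_univ, if_true]

/-- The covariant derivative of `∑ c a x^a` is half of `∑ c a γ^a_{αβ} θ^β`, which a relation
between the quadrics makes zero. -/
theorem covD_linearT [CharZero k] {c : Fin t.dim₂ → k} (hc : ∑ a, c a • t.quadric a = 0)
    (α : Fin t.dim₁) : t.covD α (t.linearT c) = 0 := by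
  have hγ := sum_γ_eq_zero hc
  rw [linearT, map_sum]
  simp only [map_smul, covD_xT, covD_one, map_zero, zero_add]
  simp only [smul_comm _ (2 : k)⁻¹, ← Finset.smul_sum]
  refine smul_eq_zero_of_right _ ?_
  simp only [Finset.smul_sum, smul_smul]
  rw [Finset.sum_comm]
  simp only [← Finset.sum_smul, hγ, zero_smul, Finset.sum_const_zero]

theorem linearT_mem (c : Fin t.dim₂ → k) : t.linearT c ⊗ₜ[k] (1 : t.S) ∈ t.piece 0 (-2) := by
  rw [linearT, TensorProduct.sum_tmul]
  refine Submodule.sum_mem _ fun a _ => ?_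
  rw [← TensorProduct.smul_tmul']
  refine Submodule.smul_mem _ _ (Submodule.subset_span ⟨0, 1, 0, 1, MvPolynomial.X a, 1, ?_,
    MvPolynomial.isHomogeneous_X k a, MvPolynomial.isHomogeneous_one _ _, by norm_num, by norm_num,
    ?_⟩)
  · exact mem_exteriorPower_zero.2 ⟨1, one_smul _ _⟩
  · rw [xT_tmul, mul_one, map_one]

/-- The quadrics are linearly independent if the coordinates of weight two do not contribute to the
multiplet. -/
theorem linearIndependent_quadric [CharZero k] (h0 : Subsingleton (t.Multiplet 0 (-2))) :
    LinearIndependent k t.quadric := by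
  rw [Fintype.linearIndependent_iff]
  intro c hc a
  have hy : t.linearT c ⊗ₜ[k] (1 : t.S) ∈ LinearMap.ker t.D ⊓ t.piece 0 (-2) := by
    refine ⟨?_, linearT_mem c⟩
    change t.D _ = 0
    simp [D_tmul, covD_linearT hc]
  have h1 := BiCohomology.mem_of_subsingleton h0 hy
  -- There are no coboundaries in cohomological degree zero, so the linear function would have to be
  -- a constant; its derivatives at the origin then vanish.
  rw [piece_of_neg (by norm_num), Submodule.map_bot, bot_sup_eq,
    Submodule.mem_span_singleton] at h1
  obtain ⟨r, hr⟩ := h1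
  rw [← evalA_linearT c a, ← hr, map_smul, evalA_one, smul_zero]

end Supertranslation

/-! ### Functions on superspace with values in the Tate resolution -/

namespace Supertranslation

variable {k : Type u} [Field k] {t : Supertranslation k}

variable (t) in
/-- Functions on superspace of weight less than `n`, where `θ` has weight one and `x` has weight
two. -/
def weightLT (n : ℕ) : Submodule k t.OT :=
  Submodule.span k {o | ∃ (r b : ℕ) (ω : t.Odd) (f : t.Even), ω ∈ ⋀[k]^r (Fin t.dim₁ → k) ∧
    f.IsHomogeneous b ∧ r + 2 * b < n ∧ o = ω ⊗ₜ[k] f}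

theorem tmul_mem_weightLT {n r b : ℕ} {ω : t.Odd} {f : t.Even}
    (hω : ω ∈ ⋀[k]^r (Fin t.dim₁ → k)) (hf : f.IsHomogeneous b) (h : r + 2 * b < n) :
    ω ⊗ₜ[k] f ∈ t.weightLT n :=
  Submodule.subset_span ⟨r, b, ω, f, hω, hf, h, rfl⟩

theorem weightLT_mono : Monotone t.weightLT := by
  intro m n h
  refine Submodule.span_mono ?_
  rintro _ ⟨r, b, ω, f, hω, hf, hr, rfl⟩
  exact ⟨r, b, ω, f, hω, hf, by omega, rfl⟩

theorem weightLT_zero : t.weightLT 0 = ⊥ := by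
  rw [weightLT, Submodule.span_eq_bot]
  rintro _ ⟨r, b, ω, f, -, -, h, -⟩
  omega

theorem pderiv_eq_zero_of_isHomogeneous_zero {f : t.Even} (hf : f.IsHomogeneous 0)
    (a : Fin t.dim₂) : MvPolynomial.pderiv a f = 0 := by
  rw [MvPolynomial.totalDegree_eq_zero_iff_eq_C.1
    ((MvPolynomial.totalDegree_zero_iff_isHomogeneous _).2 hf), MvPolynomial.pderiv_C]

theorem map_mem_of_weightLT {X : Type*} [AddCommGroup X] [Module k X] {A : t.OT →ₗ[k] X}
    {N : Submodule k X} {n : ℕ} (h : ∀ (r b : ℕ) (ω : t.Odd) (f : t.Even),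
      ω ∈ ⋀[k]^r (Fin t.dim₁ → k) → f.IsHomogeneous b → r + 2 * b < n → A (ω ⊗ₜ f) ∈ N)
    {o : t.OT} (ho : o ∈ t.weightLT n) : A o ∈ N := by
  induction ho using Submodule.span_induction with
  | mem o h' =>
    obtain ⟨r, b, ω, f, hω, hf, hr, rfl⟩ := h'
    exact h r b ω f hω hf hr
  | zero => rw [map_zero]; exact Submodule.zero_mem _
  | add o o' _ _ ho ho' => rw [map_add]; exact Submodule.add_mem _ ho ho'
  | smul r o _ ho => rw [map_smul]; exact Submodule.smul_mem _ _ ho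

theorem dT_mem_weightLT {n : ℕ} (α : Fin t.dim₁) {o : t.OT} (ho : o ∈ t.weightLT (n + 1)) :
    t.dT α o ∈ t.weightLT n := by
  refine map_mem_of_weightLT (fun r b ω f hω hf hr => ?_) ho
  rw [dT_tmul]
  cases r with
  | zero => rw [dθ_of_mem_zero α hω, TensorProduct.zero_tmul]; exact Submodule.zero_mem _
  | succ r => exact tmul_mem_weightLT (dθ_mem α ω hω) hf (by omega)

theorem σT_mem_weightLT {n : ℕ} {o : t.OT} (ho : o ∈ t.weightLT n) :
    t.σT o ∈ t.weightLT n := by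
  refine map_mem_of_weightLT (fun r b ω f hω hf hr => ?_) ho
  rw [σT_tmul]
  exact tmul_mem_weightLT (par_mem ω hω) hf hr

theorem θT_mem_weightLT {n : ℕ} (α : Fin t.dim₁) {o : t.OT} (ho : o ∈ t.weightLT n) :
    t.θT α o ∈ t.weightLT (n + 1) := by
  refine map_mem_of_weightLT (fun r b ω f hω hf hr => ?_) ho
  rw [θT_tmul]
  exact tmul_mem_weightLT (ι_mul_mem _ hω) hf (by omega)

theorem pT_mem_weightLT {n : ℕ} (a : Fin t.dim₂) {o : t.OT} (ho : o ∈ t.weightLT (n + 1)) :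
    t.pT a o ∈ t.weightLT (n - 1) := by
  refine map_mem_of_weightLT (fun r b ω f hω hf hr => ?_) ho
  rw [pT_tmul]
  cases b with
  | zero =>
    rw [pderiv_eq_zero_of_isHomogeneous_zero hf, TensorProduct.tmul_zero]
    exact Submodule.zero_mem _
  | succ b => exact tmul_mem_weightLT hω (by simpa using hf.pderiv) (by omega)

theorem covD_mem_weightLT {n : ℕ} (α : Fin t.dim₁) {o : t.OT} (ho : o ∈ t.weightLT (n + 1)) :
    t.covD α o ∈ t.weightLT n := by
  rw [covD_apply, shear_apply]
  refine Submodule.add_mem _ (dT_mem_weightLT α ho) (Submodule.smul_mem _ _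
    (Submodule.sum_mem _ fun a _ => Submodule.sum_mem _ fun β _ => Submodule.smul_mem _ _ ?_))
  have h := pT_mem_weightLT a ho
  cases n with
  | zero =>
    rw [weightLT_zero, Submodule.mem_bot] at h
    rw [h, map_zero]
    exact Submodule.zero_mem _
  | succ n => exact θT_mem_weightLT β h

theorem iSup_weightLT : ⨆ n, t.weightLT n = ⊤ := by
  rw [eq_top_iff]
  rintro o -
  induction o using TensorProduct.induction_on with
  | zero => exact Submodule.zero_mem _
  | add o o' ho ho' => exact Submodule.add_mem _ ho ho'
  | tmul ω f =>
    have hω : ω ∈ ⨆ r, ⋀[k]^r (Fin t.dim₁ → k) := by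
      rw [(DirectSum.Decomposition.isInternal
        fun r : ℕ => ⋀[k]^r (Fin t.dim₁ → k)).submodule_iSup_eq_top]
      trivial
    rw [← MvPolynomial.sum_homogeneousComponent f, TensorProduct.tmul_sum]
    refine Submodule.sum_mem _ fun b _ => ?_
    induction hω using Submodule.iSup_induction' with
    | zero => rw [TensorProduct.zero_tmul]; exact Submodule.zero_mem _
    | add ω ω' _ _ h h' => rw [TensorProduct.add_tmul]; exact Submodule.add_mem _ h h'
    | mem r ω h =>
      exact Submodule.mem_iSup_of_mem (r + 2 * b + 1) (tmul_mem_weightLT h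
        (MvPolynomial.homogeneousComponent_isHomogeneous b f) (by omega))

end Supertranslation

/-! ### The total complex between the multiplet and `𝔫` -/

namespace TateResolution

open Supertranslation Cochain

variable {k : Type u} [Field k] {t : Supertranslation k} (T : TateResolution.{u, v} t)

/-- The canonical multiplet of the Tate resolution: functions on superspace with values in the
cochains of `𝔱^(∞)`. -/
abbrev E : Type (max u v) := t.OT ⊗[k] Cochain k T.toBiBasis

/-- The total differential on functions on superspace with values in the Tate resolution. -/
def totD : T.E →ₗ[k] T.E :=
  -- The parity operator is the Koszul sign for moving the odd `v^a` and `d` past functions; `λ^α`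
  -- is even and needs none.
  ∑ α, TensorProduct.map (t.covD α) (LinearMap.mulLeft k (T.lamX α)) +
    ∑ a, TensorProduct.map (t.σT ∘ₗ t.pT a) (LinearMap.mulLeft k (T.vX a)) +
    TensorProduct.map t.σT T.d

theorem totD_tmul (o : t.OT) (c : Cochain k T.toBiBasis) : T.totD (o ⊗ₜ c) =
    ∑ α, t.covD α o ⊗ₜ[k] (T.lamX α * c) + ∑ a, t.σT (t.pT a o) ⊗ₜ[k] (T.vX a * c) +
      t.σT o ⊗ₜ[k] T.d c := by
  simp only [totD, LinearMap.add_apply, LinearMap.sum_apply, TensorProduct.map_tmul,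
    LinearMap.mulLeft_apply, LinearMap.comp_apply]

theorem vX_mul_vX (a b : Fin t.dim₂) : T.vX a * T.vX b = -(T.vX b * T.vX a) := by
  have h := Cochain.x_comm (k := k) (B := T.toBiBasis) (T.vv a).1 (T.vv b).1
  rw [tot_vv, tot_vv] at h
  refine h.trans ?_
  rw [show ksign k ((1 - 2) * (1 - 2)) = -1 by simp [ksign], neg_one_smul]

theorem lamX_mul (α : Fin t.dim₁) (c : Cochain k T.toBiBasis) : c * T.lamX α = T.lamX α * c :=
  T.commute_of_mem_zero (T.lamX_mem α) c

theorem d_lamX_mul (α : Fin t.dim₁) (c : Cochain k T.toBiBasis) :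
    T.d (T.lamX α * c) = T.lamX α * T.d c :=
  T.d_mul_of_mem_zero (T.lamX_mem α) c

theorem d_vX_mul (a : Fin t.dim₂) (c : Cochain k T.toBiBasis) :
    T.d (T.vX a * c) = T.d (T.vX a) * c - T.vX a * T.d c := by
  have h := T.toLInf.d_mul _ _ _ (Cochain.x_mem_piece (k := k) (B := T.toBiBasis) (T.vv a).1) c
  rw [(T.vv_deg a).1, (T.vv_deg a).2] at h
  refine h.trans ?_
  rw [show ksign k (1 - 0 + -2) = -1 by simp [ksign], neg_one_smul, sub_eq_add_neg]

variable {T}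

theorem E_congr {N : Type*} [AddCommMonoid N] [Module k N] {A B : T.E →ₗ[k] N}
    (h : ∀ o c, A (o ⊗ₜ c) = B (o ⊗ₜ c)) (y : T.E) : A y = B y := by
  induction y using TensorProduct.induction_on with
  | zero => rw [map_zero, map_zero]
  | add y y' hy hy' => rw [map_add, map_add, hy, hy']
  | tmul o c => exact h o c

theorem sum_sum_eq_zero {X ι : Type*} [AddCommMonoid X] [Module k X] [CharZero k] [Fintype ι]
    {F : ι → ι → X} (h : ∀ a b, F a b + F b a = 0) : ∑ a, ∑ b, F a b = 0 := by
  have h2 : (2 : k) • ∑ a, ∑ b, F a b = 0 := by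
    rw [two_smul]
    nth_rewrite 2 [Finset.sum_comm]
    simp only [← Finset.sum_add_distrib, h, Finset.sum_const_zero]
  have h3 := congrArg ((2 : k)⁻¹ • ·) h2
  simpa [smul_smul] using h3

/-- As the `λ` commute, only the anticommutators of the covariant derivatives contribute: they give
one half of `γ λ λ ∂/∂x`, which `d v = -½ γ λ λ` cancels. -/
theorem sum_covD_covD [CharZero k] (o : t.OT) (c : Cochain k T.toBiBasis) :
    ∑ α, ∑ β, t.covD β (t.covD α o) ⊗ₜ[k] (T.lamX β * (T.lamX α * c)) +
      ∑ a, t.pT a o ⊗ₜ[k] (T.d (T.vX a) * c) = 0 := by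
  have h1 : ∑ α, ∑ β, t.covD β (t.covD α o) ⊗ₜ[k] (T.lamX β * (T.lamX α * c)) =
      (2 : k)⁻¹ • ∑ α, ∑ β, (∑ a, t.γ a α β • t.pT a o) ⊗ₜ[k] (T.lamX α * (T.lamX β * c)) := by
    rw [eq_inv_smul_iff₀ two_ne_zero, two_smul]
    nth_rewrite 2 [Finset.sum_comm]
    simp only [← Finset.sum_add_distrib]
    refine Finset.sum_congr rfl fun α _ => Finset.sum_congr rfl fun β _ => ?_
    rw [← covD_covD, TensorProduct.add_tmul, ← mul_assoc, ← mul_assoc, T.lamX_mul α, add_comm]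
  have h2 : ∀ a, (2 : k)⁻¹ •
      ∑ α, ∑ β, (t.γ a α β • t.pT a o) ⊗ₜ[k] (T.lamX α * (T.lamX β * c)) +
        t.pT a o ⊗ₜ[k] (T.d (T.vX a) * c) = 0 := by
    intro a
    have h3 : (2 : k)⁻¹ • ∑ α, ∑ β, (t.γ a α β • t.pT a o) ⊗ₜ[k] (T.lamX α * (T.lamX β * c)) =
        t.pT a o ⊗ₜ[k] ((2 : k)⁻¹ • T.ofR (t.quadric a) * c) := by
      rw [smul_mul_assoc, TensorProduct.tmul_smul, quadric]
      congr 1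
      simp only [map_sum, map_smul, map_mul, ofR_X, Finset.sum_mul, TensorProduct.tmul_sum,
        smul_mul_assoc, TensorProduct.tmul_smul, TensorProduct.smul_tmul', mul_assoc]
    rw [h3, ← TensorProduct.tmul_add, ← add_mul, d_vX, add_neg_cancel, zero_mul,
      TensorProduct.tmul_zero]
  rw [h1, ← Finset.sum_eq_zero fun a _ => h2 a, Finset.sum_add_distrib, ← Finset.smul_sum]
  congr 2
  simp only [TensorProduct.sum_tmul]
  rw [Finset.sum_congr rfl fun α _ => Finset.sum_comm, Finset.sum_comm]

theorem sum_vX_vX [CharZero k] (o : t.OT) (c : Cochain k T.toBiBasis) :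
    ∑ a, ∑ b, t.σT (t.pT b (t.σT (t.pT a o))) ⊗ₜ[k] (T.vX b * (T.vX a * c)) = 0 := by
  have h : ∀ a b, t.σT (t.pT b (t.σT (t.pT a o))) = t.pT b (t.pT a o) := fun a b => by
    rw [← σT_pT, σT_σT]
  simp only [h]
  refine sum_sum_eq_zero (k := k) fun a b => ?_
  rw [pT_pT b a, ← TensorProduct.tmul_add, ← mul_assoc, ← mul_assoc, vX_mul_vX, neg_mul,
    neg_add_cancel, TensorProduct.tmul_zero]

/-- The square of the `λ` part cancels against `d v`, and the remaining cross terms cancel in pairs,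
by parity and because `∂/∂x` commutes with the covariant derivatives. -/
theorem totD_totD [CharZero k] (y : T.E) : T.totD (T.totD y) = 0 := by
  refine E_congr (A := T.totD ∘ₗ T.totD) (B := 0) (fun o c => ?_) y
  change T.totD (T.totD (o ⊗ₜ c)) = 0
  rw [totD_tmul]
  simp only [map_add, map_sum, totD_tmul, Finset.sum_add_distrib, T.toLInf.d_d, d_lamX_mul,
    d_vX_mul, sum_vX_vX, TensorProduct.tmul_zero, add_zero]
  rw [← sum_covD_covD (T := T) o c]
  have h1 : ∑ α, ∑ a, t.σT (t.pT a (t.covD α o)) ⊗ₜ[k] (T.vX a * (T.lamX α * c)) +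
      ∑ a, ∑ α, t.covD α (t.σT (t.pT a o)) ⊗ₜ[k] (T.lamX α * (T.vX a * c)) = 0 := by
    rw [Finset.sum_comm]
    simp only [← Finset.sum_add_distrib]
    refine Finset.sum_eq_zero fun a _ => Finset.sum_eq_zero fun α _ => ?_
    rw [pT_covD, σT_covD, ← mul_assoc, ← mul_assoc, T.lamX_mul α, ← TensorProduct.add_tmul,
      neg_add_cancel, TensorProduct.zero_tmul]
  have h2 : ∑ α, t.σT (t.covD α o) ⊗ₜ[k] (T.lamX α * T.d c) +
      ∑ α, t.covD α (t.σT o) ⊗ₜ[k] (T.lamX α * T.d c) = 0 := by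
    rw [← Finset.sum_add_distrib]
    refine Finset.sum_eq_zero fun α _ => ?_
    rw [σT_covD, ← TensorProduct.add_tmul, neg_add_cancel, TensorProduct.zero_tmul]
  have h3 : ∑ a, t.σT (t.σT (t.pT a o)) ⊗ₜ[k] (T.d (T.vX a) * c - T.vX a * T.d c) +
      ∑ a, t.σT (t.pT a (t.σT o)) ⊗ₜ[k] (T.vX a * T.d c) =
        ∑ a, t.pT a o ⊗ₜ[k] (T.d (T.vX a) * c) := by
    rw [← Finset.sum_add_distrib]
    refine Finset.sum_congr rfl fun a _ => ?_
    rw [← σT_pT, σT_σT, ← TensorProduct.tmul_add, sub_add_cancel]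
  rw [← h3]
  generalize ∑ α, ∑ β, t.covD β (t.covD α o) ⊗ₜ[k] (T.lamX β * (T.lamX α * c)) = X₁ at *
  generalize ∑ α, ∑ a, t.σT (t.pT a (t.covD α o)) ⊗ₜ[k] (T.vX a * (T.lamX α * c)) = X₂ at *
  generalize ∑ a, ∑ α, t.covD α (t.σT (t.pT a o)) ⊗ₜ[k] (T.lamX α * (T.vX a * c)) = X₃ at *
  generalize ∑ α, t.σT (t.covD α o) ⊗ₜ[k] (T.lamX α * T.d c) = X₄ at *
  generalize ∑ α, t.covD α (t.σT o) ⊗ₜ[k] (T.lamX α * T.d c) = X₅ at *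
  generalize ∑ a, t.σT (t.σT (t.pT a o)) ⊗ₜ[k] (T.d (T.vX a) * c - T.vX a * T.d c) = X₆ at *
  generalize ∑ a, t.σT (t.pT a (t.σT o)) ⊗ₜ[k] (T.vX a * T.d c) = X₇ at *
  trans X₁ + (X₆ + X₇) + (X₂ + X₃) + (X₄ + X₅)
  · ac_rfl
  · rw [h1, h2, add_zero, add_zero]

/-- The comparison map from the multiplet of the Tate resolution to the canonical multiplet. -/
def toA : T.E →ₗ[k] t.A := TensorProduct.map LinearMap.id T.toS.toLinearMap

theorem toA_tmul (o : t.OT) (c : Cochain k T.toBiBasis) : toA (o ⊗ₜ c : T.E) = o ⊗ₜ T.toS c := rfl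

theorem toA_totD (y : T.E) : toA (T.totD y) = t.D (toA y) := by
  refine E_congr (A := toA ∘ₗ T.totD) (B := t.D ∘ₗ toA) (fun o c => ?_) y
  change toA (T.totD (o ⊗ₜ c)) = t.D (toA (o ⊗ₜ c))
  have hv : ∀ a, T.toS (T.vX a) = 0 := fun a => by
    rw [toS_apply, T.toR_x (by rw [stage_vv]; exact one_ne_zero), map_zero]
  have hl : ∀ α, T.toS (T.lamX α) = Ideal.Quotient.mk t.quadrics (MvPolynomial.X α) := fun α => by
    rw [toS_apply, toR_lamX]
  rw [totD_tmul, toA_tmul, D_tmul, map_add, map_add, map_sum, map_sum]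
  simp only [toA_tmul, map_mul, hv, hl, toS_d, zero_mul, TensorProduct.tmul_zero,
    Finset.sum_const_zero, add_zero]

theorem toS_surjective : Function.Surjective T.toS := by
  intro s
  obtain ⟨f, rfl⟩ := Ideal.Quotient.mk_surjective s
  exact ⟨T.ofR f, by rw [toS_apply, toR_ofR]⟩

theorem toA_surjective : Function.Surjective (toA (T := T)) :=
  TensorProduct.map_surjective Function.surjective_id toS_surjective

variable (T) in
/-- Restriction of cochains to `𝔫`. -/
def resN : Cochain k T.toBiBasis →ₐ[k] Cochain k T.n.toBiBasis := T.toLInf.truncRes 3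

theorem resN_lamX (α : Fin t.dim₁) : T.resN (T.lamX α) = 0 :=
  LInf.truncRes_x_of_lt (by rw [(T.lam_deg α).2]; norm_num)

theorem resN_vX (a : Fin t.dim₂) : T.resN (T.vX a) = 0 :=
  LInf.truncRes_x_of_lt (by rw [(T.vv_deg a).2]; norm_num)

theorem resN_d (c : Cochain k T.toBiBasis) : T.resN (T.d c) = T.n.d (T.resN c) :=
  LInf.truncRes_d c

variable (T) in
/-- Evaluation at the origin of superspace, and restriction of the cochains to `𝔫`. -/
def toN : T.E →ₗ[k] Cochain k T.n.toBiBasis :=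
  (TensorProduct.lid k _).toLinearMap ∘ₗ TensorProduct.map t.evalT T.resN.toLinearMap

theorem toN_tmul (o : t.OT) (c : Cochain k T.toBiBasis) :
    T.toN (o ⊗ₜ c) = t.evalT o • T.resN c := rfl

/-- Every term of the total differential except `d` carries a factor `λ` or `v`, which restricts to
zero on `𝔫`. -/
theorem toN_totD (y : T.E) : T.toN (T.totD y) = T.n.d (T.toN y) := by
  refine E_congr (A := T.toN ∘ₗ T.totD) (B := T.n.d ∘ₗ T.toN) (fun o c => ?_) y
  change T.toN (T.totD (o ⊗ₜ c)) = T.n.d (T.toN (o ⊗ₜ c))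
  rw [totD_tmul, toN_tmul, map_add, map_add, map_sum, map_sum, map_smul]
  simp only [toN_tmul, map_mul, resN_lamX, resN_vX, resN_d, zero_mul, smul_zero,
    Finset.sum_const_zero, zero_add, evalT_σT]

/-! ### The kernel of the comparison map is acyclic -/

theorem exists_generalizedInverse {X : Type*} [AddCommGroup X] [Module k X] (d : X →ₗ[k] X) :
    ∃ g : X →ₗ[k] X, ∀ z, d (g (d z)) = d z := by
  obtain ⟨g₀, hg₀⟩ := d.rangeRestrict.exists_rightInverse_of_surjective
    (LinearMap.range_rangeRestrict d)
  obtain ⟨g, hg⟩ := g₀.exists_extend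
  refine ⟨g, fun z => ?_⟩
  have h1 := LinearMap.congr_fun hg ⟨d z, LinearMap.mem_range_self d z⟩
  have h2 := congrArg Subtype.val (LinearMap.congr_fun hg₀ ⟨d z, LinearMap.mem_range_self d z⟩)
  change g (d z) = _ at h1
  change d (g₀ _) = d z at h2
  rw [h1, h2]

variable (T) in
/-- The Tate resolution contracts onto `S`. -/
theorem exists_contraction [CharZero k] :
    ∃ (j : t.S →ₗ[k] Cochain k T.toBiBasis) (s : Cochain k T.toBiBasis →ₗ[k] Cochain k T.toBiBasis),
      (∀ z, T.toS (s z) = 0) ∧ ∀ z, T.d (s z) + s (T.d z) + j (T.toS z) = z := by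
  obtain ⟨j₀, hj₀⟩ := (Ideal.Quotient.mkₐ k t.quadrics).toLinearMap.exists_rightInverse_of_surjective
    (LinearMap.range_eq_top.2 Ideal.Quotient.mk_surjective)
  obtain ⟨g, hg⟩ := exists_generalizedInverse T.d
  set j : t.S →ₗ[k] Cochain k T.toBiBasis := T.ofR.toLinearMap ∘ₗ j₀ with hj
  have hSj : ∀ x, T.toS (j x) = x := fun x => by
    change T.toS (T.ofR (j₀ x)) = x
    rw [toS_apply, toR_ofR]
    exact LinearMap.congr_fun hj₀ x
  have hdj : ∀ x, T.d (j x) = 0 := fun x => T.d_of_mem_totSet_zero (T.ofR_mem (j₀ x))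
  -- The generalised inverse of `d` is corrected by cocycles in the image of `j`, so that it takes
  -- values in the kernel of the augmentation.
  let g₁ : Cochain k T.toBiBasis →ₗ[k] Cochain k T.toBiBasis := g - j ∘ₗ T.toS.toLinearMap ∘ₗ g
  have hg₁ : ∀ z, g₁ z = g z - j (T.toS (g z)) := fun z => rfl
  have hSg : ∀ z, T.toS (g₁ z) = 0 := fun z => by rw [hg₁, map_sub, hSj, sub_self]
  have hdg : ∀ z, T.d (g₁ (T.d z)) = T.d z := fun z => by
    rw [hg₁, map_sub, hdj, hg, sub_zero]
  -- The argument of the outer `g₁` is a cocycle in the kernel of the augmentation, hence exact, so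
  -- `g₁` picks a primitive of it.
  let s : Cochain k T.toBiBasis →ₗ[k] Cochain k T.toBiBasis :=
    g₁ ∘ₗ (LinearMap.id - j ∘ₗ T.toS.toLinearMap - g₁ ∘ₗ T.d)
  have hs : ∀ z, s z = g₁ (z - j (T.toS z) - g₁ (T.d z)) := fun z => rfl
  refine ⟨j, s, fun z => hSg _, fun z => ?_⟩
  have h1 : T.d (z - j (T.toS z) - g₁ (T.d z)) = 0 := by
    rw [map_sub, map_sub, hdj, hdg, sub_zero, sub_self]
  have h2 : T.toS (z - j (T.toS z) - g₁ (T.d z)) = 0 := by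
    rw [map_sub, map_sub, hSj, hSg, sub_zero, sub_self]
  obtain ⟨w, hw⟩ := T.exists_d_eq h1 h2
  have h3 : T.d (s z) = z - j (T.toS z) - g₁ (T.d z) := by
    rw [hs, ← hw, hdg]
  have h4 : s (T.d z) = g₁ (T.d z) := by
    rw [hs, toS_d, map_zero, T.toLInf.d_d, map_zero, sub_zero, sub_zero]
  rw [h3, h4]
  abel

variable (T) in
/-- Elements of weight less than `n` with respect to the coordinates of superspace. -/
def weightLT (n : ℕ) : Submodule k T.E :=
  Submodule.span k {y | ∃ o ∈ t.weightLT n, ∃ c : Cochain k T.toBiBasis, y = o ⊗ₜ[k] c}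

theorem tmul_mem_weightLT {n : ℕ} {o : t.OT} (ho : o ∈ t.weightLT n) (c : Cochain k T.toBiBasis) :
    o ⊗ₜ[k] c ∈ T.weightLT n :=
  Submodule.subset_span ⟨o, ho, c, rfl⟩

theorem E_mem_of_weightLT {X : Type*} [AddCommMonoid X] [Module k X] {A : T.E →ₗ[k] X}
    {N : Submodule k X} {n : ℕ} (h : ∀ o ∈ t.weightLT n, ∀ c, A (o ⊗ₜ c) ∈ N) {y : T.E}
    (hy : y ∈ T.weightLT n) : A y ∈ N := by
  induction hy using Submodule.span_induction with
  | mem y h' =>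
    obtain ⟨o, ho, c, rfl⟩ := h'
    exact h o ho c
  | zero => rw [map_zero]; exact Submodule.zero_mem _
  | add o o' _ _ ho ho' => rw [map_add]; exact Submodule.add_mem _ ho ho'
  | smul r o _ ho => rw [map_smul]; exact Submodule.smul_mem _ _ ho

theorem exists_mem_weightLT (y : T.E) : ∃ n, y ∈ T.weightLT n := by
  have hmono : Monotone T.weightLT := by
    intro m n h
    refine Submodule.span_mono ?_
    rintro _ ⟨o, ho, c, rfl⟩
    exact ⟨o, Supertranslation.weightLT_mono h ho, c, rfl⟩
  suffices y ∈ ⨆ n, T.weightLT n from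
    (Submodule.mem_iSup_of_directed _ hmono.directed_le).1 this
  induction y using TensorProduct.induction_on with
  | zero => exact Submodule.zero_mem _
  | add y y' hy hy' => exact Submodule.add_mem _ hy hy'
  | tmul o c =>
    have ho : o ∈ ⨆ n, t.weightLT n := by rw [iSup_weightLT]; trivial
    obtain ⟨n, hn⟩ := (Submodule.mem_iSup_of_directed _
      Supertranslation.weightLT_mono.directed_le).1 ho
    exact Submodule.mem_iSup_of_mem n (tmul_mem_weightLT hn c)

/-- A closed element of the kernel of the comparison map is exact. -/
theorem exists_totD_eq_of_toA_eq_zero [CharZero k] {y : T.E} (hy : T.totD y = 0)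
    (hA : toA y = 0) : ∃ w, T.totD w = y := by
  obtain ⟨j, s, hS, hs⟩ := T.exists_contraction
  let H : T.E →ₗ[k] T.E := TensorProduct.map t.σT s
  have hH : ∀ o c, H (o ⊗ₜ c) = t.σT o ⊗ₜ s c := fun _ _ => rfl
  -- The error made by extending the contraction `s` to the total complex. Every term contains a
  -- covariant derivative or `∂/∂x`, so it lowers the weight of the superspace function and is
  -- nilpotent on each element.
  let ν : T.E →ₗ[k] T.E :=
    ∑ α, TensorProduct.map (t.covD α ∘ₗ t.σT) (LinearMap.mulLeft k (T.lamX α) ∘ₗ s) +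
    ∑ α, TensorProduct.map (t.σT ∘ₗ t.covD α) (s ∘ₗ LinearMap.mulLeft k (T.lamX α)) +
    (∑ a, TensorProduct.map (t.σT ∘ₗ t.pT a ∘ₗ t.σT) (LinearMap.mulLeft k (T.vX a) ∘ₗ s) +
    ∑ a, TensorProduct.map (t.pT a) (s ∘ₗ LinearMap.mulLeft k (T.vX a)))
  have hν : ∀ o c, ν (o ⊗ₜ c) =
      ∑ α, t.covD α (t.σT o) ⊗ₜ[k] (T.lamX α * s c) +
      ∑ α, t.σT (t.covD α o) ⊗ₜ[k] s (T.lamX α * c) +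
      (∑ a, t.σT (t.pT a (t.σT o)) ⊗ₜ[k] (T.vX a * s c) +
      ∑ a, t.pT a o ⊗ₜ[k] s (T.vX a * c)) := by
    intro o c
    simp only [ν, LinearMap.add_apply, LinearMap.sum_apply, TensorProduct.map_tmul,
      LinearMap.mulLeft_apply, LinearMap.comp_apply]
  have hAH : ∀ y, toA (H y) = 0 := by
    intro y
    refine E_congr (A := toA ∘ₗ H) (B := 0) (fun o c => ?_) y
    change toA (H (o ⊗ₜ c)) = 0
    rw [hH, toA_tmul, hS, TensorProduct.tmul_zero]
  let J : t.A →ₗ[k] T.E := TensorProduct.map LinearMap.id j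
  have hJ : ∀ y : T.E, T.totD (H y) + H (T.totD y) + J (toA y) = y + ν y := by
    intro y
    refine E_congr (A := T.totD ∘ₗ H + H ∘ₗ T.totD + J ∘ₗ toA) (B := LinearMap.id + ν)
      (fun o c => ?_) y
    change T.totD (H (o ⊗ₜ c)) + H (T.totD (o ⊗ₜ c)) + o ⊗ₜ j (T.toS c) = o ⊗ₜ c + ν (o ⊗ₜ c)
    rw [hH, totD_tmul, totD_tmul, hν, map_add, map_add, map_sum, map_sum]
    simp only [hH, σT_σT]
    have e : o ⊗ₜ T.d (s c) + o ⊗ₜ s (T.d c) + o ⊗ₜ j (T.toS c) = o ⊗ₜ[k] c := by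
      rw [← TensorProduct.tmul_add, ← TensorProduct.tmul_add, hs]
    refine Eq.trans ?_ (congrArg (· + _) e)
    have h : ∀ a₁ a₂ b₁ b₂ c₁ c₂ x : T.E, a₁ + b₁ + c₁ + (a₂ + b₂ + c₂) + x =
        c₁ + c₂ + x + (a₁ + a₂ + (b₁ + b₂)) := by
      intros
      ac_rfl
    exact h _ _ _ _ _ _ _
  have hW : ∀ n, ∀ y ∈ T.weightLT (n + 1), ν y ∈ T.weightLT n := by
    intro n y hy
    refine E_mem_of_weightLT (fun o ho c => ?_) hy
    have hp : ∀ o ∈ t.weightLT (n + 1), ∀ a, t.pT a o ∈ t.weightLT n := fun o ho a =>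
      Supertranslation.weightLT_mono (Nat.sub_le n 1) (pT_mem_weightLT a ho)
    rw [hν]
    refine Submodule.add_mem _ (Submodule.add_mem _ ?_ ?_) (Submodule.add_mem _ ?_ ?_) <;>
      refine Submodule.sum_mem _ fun a _ => tmul_mem_weightLT ?_ _
    · exact covD_mem_weightLT a (σT_mem_weightLT ho)
    · exact σT_mem_weightLT (covD_mem_weightLT a ho)
    · exact σT_mem_weightLT (hp _ (σT_mem_weightLT ho) a)
    · exact hp _ ho a
  suffices ∀ n, ∀ y ∈ T.weightLT n, T.totD y = 0 → toA y = 0 → ∃ w, T.totD w = y by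
    obtain ⟨n, hn⟩ := exists_mem_weightLT y
    exact this n y hn hy hA
  intro n
  induction n with
  | zero =>
    intro y hy _ _
    have h0 : T.weightLT 0 = ⊥ := by
      rw [weightLT, Submodule.span_eq_bot]
      rintro _ ⟨o, ho, c, rfl⟩
      rw [Supertranslation.weightLT_zero, Submodule.mem_bot] at ho
      rw [ho, TensorProduct.zero_tmul]
    rw [h0, Submodule.mem_bot] at hy
    exact ⟨0, by rw [map_zero, hy]⟩
  | succ n ih =>
    intro y hy hd hA
    -- It remains to treat `ν y`, which is again closed, again in the kernel, and of smaller weight.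
    have h1 : T.totD (H y) = y + ν y := by
      rw [← hJ y, hd, hA, map_zero, map_zero, add_zero, add_zero]
    have h2 : T.totD (ν y) = 0 := by
      have := congrArg T.totD h1
      rwa [totD_totD, map_add, hd, zero_add, eq_comm] at this
    have h3 : toA (ν y) = 0 := by
      have := congrArg toA h1
      rwa [toA_totD, hAH, map_zero, map_add, hA, zero_add, eq_comm] at this
    obtain ⟨w, hw⟩ := ih _ (hW n y hy) h2 h3
    have h4 : ∀ z : T.E, z + (-1 : k) • z = 0 := fun z => by
      nth_rewrite 1 [← one_smul k z]
      rw [← add_smul, add_neg_cancel, zero_smul]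
    exact ⟨H y + (-1 : k) • w, by rw [map_add, map_smul, h1, hw, add_assoc, h4, add_zero]⟩

end TateResolution

/-! ### Inverting a homotopy Laplacian on a finite filtration -/

section Laplacian

variable {k : Type u} [Field k] [CharZero k] {X : Type w} [AddCommGroup X] [Module k X]

open Polynomial in
-- On each generator of a step of the filtration, `P` is a nonzero scalar modulo the next step. The
-- product of the factors `X - c` met on the way down annihilates `y`, and its value at zero is
-- nonzero since each `c` is. Passing to polynomials avoids asking `P` to preserve the span or the
-- scalars to be uniform.
theorem exists_polynomial_of_filtration {P : X →ₗ[k] X} {J : ℕ → Submodule k X} {G : ℕ → Set X}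
    (hG : ∀ m, J m = Submodule.span k (G m)) {N : ℕ} (hN : J N = ⊥)
    (h : ∀ m, ∀ y ∈ G m, ∃ c : ℕ, c ≠ 0 ∧ ∃ z ∈ J (m + 1), P y = (c : k) • y + z) {y : X}
    (hy : y ∈ J 0) : ∃ Q : k[X], Q.eval 0 ≠ 0 ∧ aeval P Q y = 0 := by
  suffices ∀ n m, m + n = N → ∀ y ∈ J m, ∃ Q : k[X], Q.eval 0 ≠ 0 ∧ aeval P Q y = 0 from
    this N 0 (zero_add N) y hy
  intro n
  induction n with
  | zero =>
    intro m hm y hy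
    rw [add_zero] at hm
    rw [hm, hN, Submodule.mem_bot] at hy
    exact ⟨1, by simp, by rw [hy, map_zero]⟩
  | succ n ih =>
    intro m hm y hy
    rw [hG] at hy
    induction hy using Submodule.span_induction with
    | mem y hy =>
      obtain ⟨c, hc, z, hz, hP⟩ := h m y hy
      obtain ⟨Q, hQ, hQz⟩ := ih (m + 1) (by omega) z hz
      refine ⟨Q * (Polynomial.X - C (c : k)), ?_, ?_⟩
      · simpa [hc] using hQ
      · rw [map_mul, Module.End.mul_apply, map_sub, aeval_X, aeval_C, LinearMap.sub_apply,
          Module.algebraMap_end_apply, hP, add_sub_cancel_left, hQz]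
    | zero => exact ⟨1, by simp, map_zero _⟩
    | add y y' _ _ hy hy' =>
      obtain ⟨Q, hQ, hQy⟩ := hy
      obtain ⟨Q', hQ', hQy'⟩ := hy'
      refine ⟨Q * Q', by rw [eval_mul]; exact mul_ne_zero hQ hQ', ?_⟩
      have h1 : aeval P (Q * Q') y' = 0 := by rw [map_mul, Module.End.mul_apply, hQy', map_zero]
      have h2 : aeval P (Q * Q') y = 0 := by
        rw [mul_comm, map_mul, Module.End.mul_apply, hQy, map_zero]
      rw [map_add, h1, h2, add_zero]
    | smul r y _ hy =>
      obtain ⟨Q, hQ, hQy⟩ := hy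
      exact ⟨Q, hQ, by rw [map_smul, hQy, smul_zero]⟩

open Polynomial in
/-- A closed element of the zeroth step of the filtration is exact. -/
theorem exists_homotopy_of_filtration {D h : X →ₗ[k] X} (hD : ∀ y, D (D y) = 0)
    {J : ℕ → Submodule k X} {G : ℕ → Set X} (hG : ∀ m, J m = Submodule.span k (G m)) {N : ℕ}
    (hN : J N = ⊥) (hP : ∀ m, ∀ y ∈ G m, ∃ c : ℕ, c ≠ 0 ∧
      ∃ z ∈ J (m + 1), D (h y) + h (D y) = (c : k) • y + z)
    {V : Submodule k X} (hV : ∀ y ∈ V, D (h y) + h (D y) ∈ V) {y : X} (hy : y ∈ J 0)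
    (hyV : y ∈ V) (hDy : D y = 0) : ∃ w ∈ V, D (h w) = y := by
  set P : X →ₗ[k] X := D ∘ₗ h + h ∘ₗ D
  -- Writing `Q = X * divX Q + Q(0)` inverts `P` on `y` by a polynomial in `P`. Such a polynomial
  -- preserves `V` and closedness, and on closed elements `P` reduces to `D ∘ h`.
  obtain ⟨Q, hQ, hQy⟩ := exists_polynomial_of_filtration (P := P) hG hN hP hy
  have hQP : aeval P Q y = P (aeval P (divX Q) y) + Q.eval 0 • y := by
    conv_lhs => rw [← X_mul_divX_add Q]
    rw [map_add, map_mul, aeval_X, aeval_C, LinearMap.add_apply, Module.End.mul_apply,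
      Module.algebraMap_end_apply, coeff_zero_eq_eval_zero]
  have hQV : ∀ Q : k[X], aeval P Q y ∈ V ∧ D (aeval P Q y) = 0 := by
    intro Q
    induction Q using Polynomial.induction_on' with
    | add Q Q' h h' =>
      rw [map_add, LinearMap.add_apply, map_add, h.2, h'.2, add_zero]
      exact ⟨Submodule.add_mem _ h.1 h'.1, rfl⟩
    | monomial n a =>
      rw [← C_mul_X_pow_eq_monomial, map_mul, aeval_C, Module.End.mul_apply,
        Module.algebraMap_end_apply, map_pow, aeval_X, map_smul]
      suffices (P ^ n) y ∈ V ∧ D ((P ^ n) y) = 0 by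
        rw [this.2, smul_zero]
        exact ⟨Submodule.smul_mem _ _ this.1, rfl⟩
      induction n with
      | zero => exact ⟨hyV, hDy⟩
      | succ n ih =>
        rw [pow_succ', Module.End.mul_apply]
        refine ⟨hV _ ih.1, ?_⟩
        change D (D _ + h (D _)) = 0
        rw [ih.2, map_zero, add_zero, hD]
  obtain ⟨h1, h2⟩ := hQV (divX Q)
  refine ⟨-((Q.eval 0)⁻¹ • aeval P (divX Q) y),
    Submodule.neg_mem _ (Submodule.smul_mem _ _ h1), ?_⟩
  have h3 : P (aeval P (divX Q) y) = D (h (aeval P (divX Q) y)) := by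
    change D _ + h (D _) = _
    rw [h2, map_zero, add_zero]
  rw [hQy, h3] at hQP
  rw [map_neg, map_smul, map_neg, map_smul, neg_eq_iff_add_eq_zero, ← smul_right_injective X hQ |>.eq_iff]
  rw [smul_add, smul_smul, mul_inv_cancel₀ hQ, one_smul, smul_zero, ← hQP]

end Laplacian

/-! ### The homotopy pairing `θ` with `λ` and `x` with `v` -/

namespace TateResolution

open Supertranslation Cochain

variable {k : Type u} [Field k] {t : Supertranslation k} {T : TateResolution.{u, v} t}

variable (T) in
/-- The contracting homotopy `∑ θ ∂/∂λ + ∑ x ∂/∂v`. -/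
def htpy : T.E →ₗ[k] T.E :=
  ∑ β, TensorProduct.map (t.θT β) (pd (T.lam β).1) +
    ∑ b, TensorProduct.map (t.xT b ∘ₗ t.σT) (pd (T.vv b).1)

theorem htpy_tmul (o : t.OT) (c : Cochain k T.toBiBasis) : T.htpy (o ⊗ₜ c) =
    ∑ β, t.θT β o ⊗ₜ[k] pd (T.lam β).1 c + ∑ b, t.xT b (t.σT o) ⊗ₜ[k] pd (T.vv b).1 c := by
  simp only [htpy, LinearMap.add_apply, LinearMap.sum_apply, TensorProduct.map_tmul,
    LinearMap.comp_apply]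

/-- The homotopy multiplies by `θ` or `x`, which vanish at the origin. Corrections by it therefore
leave the restriction to `𝔫` unchanged. -/
theorem toN_htpy (y : T.E) : T.toN (T.htpy y) = 0 := by
  refine E_congr (A := T.toN ∘ₗ T.htpy) (B := 0) (fun o c => ?_) y
  change T.toN (T.htpy (o ⊗ₜ c)) = 0
  rw [htpy_tmul, map_add, map_sum, map_sum]
  simp only [toN_tmul, evalT_θT, evalT_xT, zero_smul, Finset.sum_const_zero, add_zero]

theorem lam_ne_vv (α : Fin t.dim₁) (a : Fin t.dim₂) : (T.lam α).1 ≠ (T.vv a).1 := by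
  intro h
  have h1 := T.stage_lam α
  rw [h, stage_vv] at h1
  exact one_ne_zero h1

theorem pd_lam_lamX (α β : Fin t.dim₁) (c : Cochain k T.toBiBasis) :
    pd (T.lam β).1 (T.lamX α * c) = (if α = β then c else 0) + T.lamX α * pd (T.lam β).1 c := by
  rw [pd_x_mul, tot_lam, tot_lam]
  simp [Subtype.val_injective.eq_iff, ksign_zero]

theorem pd_lam_vX (a : Fin t.dim₂) (β : Fin t.dim₁) (c : Cochain k T.toBiBasis) :
    pd (T.lam β).1 (T.vX a * c) = T.vX a * pd (T.lam β).1 c := by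
  rw [pd_x_mul, tot_lam, if_neg (lam_ne_vv β a).symm, zero_add, sub_self, zero_mul, ksign_zero,
    one_smul]

theorem pd_vv_lamX (α : Fin t.dim₁) (b : Fin t.dim₂) (c : Cochain k T.toBiBasis) :
    pd (T.vv b).1 (T.lamX α * c) = T.lamX α * pd (T.vv b).1 c := by
  rw [pd_x_mul, tot_lam, if_neg (lam_ne_vv α b), zero_add, sub_self, mul_zero, ksign_zero,
    one_smul]

theorem pd_vv_vX (a b : Fin t.dim₂) (c : Cochain k T.toBiBasis) :
    pd (T.vv b).1 (T.vX a * c) = (if a = b then c else 0) - T.vX a * pd (T.vv b).1 c := by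
  rw [pd_x_mul, tot_vv, tot_vv, show ksign k ((2 - 1) * (1 - 2)) = -1 by simp [ksign],
    neg_one_smul, sub_eq_add_neg]
  simp [Subtype.val_injective.eq_iff]

theorem neg_tmul_eq {X Y : Type*} [AddCommGroup X] [Module k X] [AddCommGroup Y] [Module k Y]
    (a : X) (b : Y) : (-a) ⊗ₜ[k] b = a ⊗ₜ[k] (-b) :=
  (TensorProduct.neg_tmul a b).trans (TensorProduct.tmul_neg a b).symm

/-- The Laplacian of the homotopy: the number operator for `θ`, `x`, `λ` and `v`, up to terms that
raise the weight. -/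
theorem laplacian_tmul [CharZero k] (o : t.OT) (c : Cochain k T.toBiBasis) :
    T.totD (T.htpy (o ⊗ₜ c)) + T.htpy (T.totD (o ⊗ₜ c)) =
      o ⊗ₜ[k] (∑ β, T.lamX β * pd (T.lam β).1 c + ∑ b, T.vX b * pd (T.vv b).1 c) +
      (∑ α, t.θT α (t.dT α o) + ∑ a, t.xT a (t.pT a o)) ⊗ₜ[k] c +
      (∑ β, t.θT β (t.σT o) ⊗ₜ[k] (pd (T.lam β).1 (T.d c) - T.d (pd (T.lam β).1 c)) +
      (∑ b, ∑ α, ((2 : k)⁻¹ • ∑ β, t.γ b α β • t.θT β (t.σT o)) ⊗ₜ[k]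
        (T.lamX α * pd (T.vv b).1 c) +
      ∑ b, t.xT b o ⊗ₜ[k] (T.d (pd (T.vv b).1 c) + pd (T.vv b).1 (T.d c)))) := by
  -- The pair `θ`, `λ`: the canonical anticommutation relations give `λ ∂/∂λ + θ ∂/∂θ`; the shear
  -- drops out by `sum_θT_shear`.
  have e1 : ∑ β, ∑ α, t.covD α (t.θT β o) ⊗ₜ[k] (T.lamX α * pd (T.lam β).1 c) +
      ∑ α, ∑ β, t.θT β (t.covD α o) ⊗ₜ[k] pd (T.lam β).1 (T.lamX α * c) =
      o ⊗ₜ[k] (∑ β, T.lamX β * pd (T.lam β).1 c) + (∑ α, t.θT α (t.dT α o)) ⊗ₜ[k] c := by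
    have h1 : ∑ α, t.θT α (t.covD α o) = ∑ α, t.θT α (t.dT α o) := by
      simp only [covD_apply, map_add, Finset.sum_add_distrib, sum_θT_shear, add_zero]
    have h2 : ∀ β α, t.covD α (t.θT β o) ⊗ₜ[k] (T.lamX α * pd (T.lam β).1 c) +
        t.θT β (t.covD α o) ⊗ₜ[k] pd (T.lam β).1 (T.lamX α * c) =
        (if α = β then o else 0) ⊗ₜ[k] (T.lamX α * pd (T.lam β).1 c) +
          t.θT β (t.covD α o) ⊗ₜ[k] (if α = β then c else 0) := fun β α => by
      rw [pd_lam_lamX, TensorProduct.tmul_add, add_left_comm, add_comm, ← TensorProduct.add_tmul,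
        covD_θT, sub_add_cancel]
    rw [← h1]
    nth_rewrite 2 [Finset.sum_comm]
    simp only [← Finset.sum_add_distrib, h2]
    simp only [Finset.sum_add_distrib, TensorProduct.ite_tmul, TensorProduct.tmul_ite,
      Finset.sum_ite_eq', Finset.mem_univ, if_true, TensorProduct.tmul_sum, TensorProduct.sum_tmul]
  have e2 : ∑ β, ∑ a, t.σT (t.pT a (t.θT β o)) ⊗ₜ[k] (T.vX a * pd (T.lam β).1 c) +
      ∑ a, ∑ β, t.θT β (t.σT (t.pT a o)) ⊗ₜ[k] pd (T.lam β).1 (T.vX a * c) = 0 := by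
    nth_rewrite 2 [Finset.sum_comm]
    simp only [← Finset.sum_add_distrib]
    refine Finset.sum_eq_zero fun β _ => Finset.sum_eq_zero fun a _ => ?_
    rw [pd_lam_vX, pT_θT, σT_θT, ← TensorProduct.add_tmul, neg_add_cancel, TensorProduct.zero_tmul]
  have e3 : ∑ β, t.σT (t.θT β o) ⊗ₜ[k] T.d (pd (T.lam β).1 c) +
      ∑ β, t.θT β (t.σT o) ⊗ₜ[k] pd (T.lam β).1 (T.d c) =
      ∑ β, t.θT β (t.σT o) ⊗ₜ[k] (pd (T.lam β).1 (T.d c) - T.d (pd (T.lam β).1 c)) := by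
    rw [← Finset.sum_add_distrib]
    refine Finset.sum_congr rfl fun β _ => ?_
    rw [σT_θT, neg_tmul_eq, ← TensorProduct.tmul_add, neg_add_eq_sub]
  have e4 : ∑ b, ∑ α, t.covD α (t.xT b (t.σT o)) ⊗ₜ[k] (T.lamX α * pd (T.vv b).1 c) +
      ∑ α, ∑ b, t.xT b (t.σT (t.covD α o)) ⊗ₜ[k] pd (T.vv b).1 (T.lamX α * c) =
      ∑ b, ∑ α, ((2 : k)⁻¹ • ∑ β, t.γ b α β • t.θT β (t.σT o)) ⊗ₜ[k]
        (T.lamX α * pd (T.vv b).1 c) := by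
    nth_rewrite 2 [Finset.sum_comm]
    simp only [← Finset.sum_add_distrib]
    refine Finset.sum_congr rfl fun b _ => Finset.sum_congr rfl fun α _ => ?_
    rw [pd_vv_lamX, σT_covD, covD_xT, map_neg, ← TensorProduct.add_tmul, add_right_comm,
      add_neg_cancel, zero_add]
  -- The pair `x`, `v`, in the same way, gives `v ∂/∂v + x ∂/∂x`.
  have e5 : ∑ b, ∑ a, t.σT (t.pT a (t.xT b (t.σT o))) ⊗ₜ[k] (T.vX a * pd (T.vv b).1 c) +
      ∑ a, ∑ b, t.xT b (t.σT (t.σT (t.pT a o))) ⊗ₜ[k] pd (T.vv b).1 (T.vX a * c) =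
      o ⊗ₜ[k] (∑ b, T.vX b * pd (T.vv b).1 c) + (∑ a, t.xT a (t.pT a o)) ⊗ₜ[k] c := by
    have h2 : ∀ b a, t.σT (t.pT a (t.xT b (t.σT o))) ⊗ₜ[k] (T.vX a * pd (T.vv b).1 c) +
        t.xT b (t.σT (t.σT (t.pT a o))) ⊗ₜ[k] pd (T.vv b).1 (T.vX a * c) =
        (if a = b then o else 0) ⊗ₜ[k] (T.vX a * pd (T.vv b).1 c) +
          t.xT b (t.pT a o) ⊗ₜ[k] (if a = b then c else 0) := fun b a => by
      rw [pd_vv_vX, ← σT_xT, ← σT_pT, σT_σT, σT_σT, pT_xT, TensorProduct.add_tmul, add_comm,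
        ← add_assoc, ← TensorProduct.tmul_add, sub_add_cancel, add_comm]
    nth_rewrite 2 [Finset.sum_comm]
    simp only [← Finset.sum_add_distrib, h2]
    simp only [Finset.sum_add_distrib, TensorProduct.ite_tmul, TensorProduct.tmul_ite,
      Finset.sum_ite_eq', Finset.mem_univ, if_true, TensorProduct.tmul_sum, TensorProduct.sum_tmul]
  have e6 : ∑ b, t.σT (t.xT b (t.σT o)) ⊗ₜ[k] T.d (pd (T.vv b).1 c) +
      ∑ b, t.xT b (t.σT (t.σT o)) ⊗ₜ[k] pd (T.vv b).1 (T.d c) =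
      ∑ b, t.xT b o ⊗ₜ[k] (T.d (pd (T.vv b).1 c) + pd (T.vv b).1 (T.d c)) := by
    rw [← Finset.sum_add_distrib]
    refine Finset.sum_congr rfl fun b _ => ?_
    rw [σT_xT, σT_σT, ← TensorProduct.tmul_add]
  rw [TensorProduct.tmul_add, TensorProduct.add_tmul, ← e3, ← e4, ← e6]
  have h : ∀ a₁ a₂ b₁ b₂ c₁ c₂ d₁ d₂ f₁ f₂ g₁ g₂ u₁ u₂ u₃ u₄ : T.E,
      a₁ + a₂ = u₁ + u₃ → b₁ + b₂ = 0 → f₁ + f₂ = u₂ + u₄ →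
      (a₁ + b₁ + c₁) + (d₁ + f₁ + g₁) + ((a₂ + d₂) + (b₂ + f₂) + (c₂ + g₂)) =
        (u₁ + u₂) + (u₃ + u₄) + (c₁ + c₂ + (d₁ + d₂ + (g₁ + g₂))) := by
    intro a₁ a₂ b₁ b₂ c₁ c₂ d₁ d₂ f₁ f₂ g₁ g₂ u₁ u₂ u₃ u₄ h1 h2 h3
    trans (a₁ + a₂) + (b₁ + b₂) + (f₁ + f₂) + (c₁ + c₂ + (d₁ + d₂ + (g₁ + g₂)))
    · ac_rfl
    · rw [h1, h2, h3, add_zero]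
      ac_rfl
  rw [← h _ _ _ _ _ _ _ _ _ _ _ _ _ _ _ _ e1 e2 e5]
  rw [htpy_tmul, totD_tmul, map_add, map_add, map_add, map_sum, map_sum, map_sum, map_sum]
  simp only [totD_tmul, htpy_tmul, Finset.sum_add_distrib]

end TateResolution

/-! ### Homogeneous elements -/

namespace TateResolution

open Supertranslation Cochain

variable {k : Type u} [Field k] {t : Supertranslation k} {T : TateResolution.{u, v} t}

variable (T) in
/-- The subspace spanned by the `(ω ⊗ f) ⊗ c`, where `ω` and `f` are homogeneous of degrees `r` and
`b`, and `c` is a combination of words in `S r b`. -/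
def graded (S : ℕ → ℕ → Set (Multiset T.ι)) : Submodule k T.E :=
  Submodule.span k {y | ∃ (r b : ℕ) (ω : t.Odd) (f : t.Even) (l : List T.ι),
    ω ∈ ⋀[k]^r (Fin t.dim₁ → k) ∧ f.IsHomogeneous b ∧ (l : Multiset T.ι) ∈ S r b ∧
      y = (ω ⊗ₜ[k] f) ⊗ₜ[k] word k T.toBiBasis l}

theorem tmul_mem_graded {S : ℕ → ℕ → Set (Multiset T.ι)} {r b : ℕ} {ω : t.Odd} {f : t.Even}
    {c : Cochain k T.toBiBasis} (hω : ω ∈ ⋀[k]^r (Fin t.dim₁ → k)) (hf : f.IsHomogeneous b)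
    (hc : c ∈ cspan k (S r b)) : (ω ⊗ₜ[k] f) ⊗ₜ[k] c ∈ T.graded S := by
  refine mem_comap_of_word (N := T.E)
    (TensorProduct.mk k t.OT (Cochain k T.toBiBasis) (ω ⊗ₜ[k] f)) (T.graded S) ?_ c hc
  intro l hl
  exact Submodule.subset_span ⟨r, b, ω, f, l, hω, hf, hl, rfl⟩

theorem map_mem_of_graded {X : Type*} [AddCommMonoid X] [Module k X] {A : T.E →ₗ[k] X}
    {N : Submodule k X} {S : ℕ → ℕ → Set (Multiset T.ι)}
    (h : ∀ (r b : ℕ) (ω : t.Odd) (f : t.Even) (l : List T.ι), ω ∈ ⋀[k]^r (Fin t.dim₁ → k) →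
      f.IsHomogeneous b → (l : Multiset T.ι) ∈ S r b →
        A ((ω ⊗ₜ[k] f) ⊗ₜ[k] word k T.toBiBasis l) ∈ N) {y : T.E} (hy : y ∈ T.graded S) :
    A y ∈ N := by
  induction hy using Submodule.span_induction with
  | mem y h' =>
    obtain ⟨r, b, ω, f, l, hω, hf, hl, rfl⟩ := h'
    exact h r b ω f l hω hf hl
  | zero => rw [map_zero]; exact Submodule.zero_mem _
  | add o o' _ _ ho ho' => rw [map_add]; exact Submodule.add_mem _ ho ho'
  | smul r o _ ho => rw [map_smul]; exact Submodule.smul_mem _ _ ho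

section

variable {S : ℕ → ℕ → Set (Multiset T.ι)} {r b : ℕ} {ω : t.Odd} {f : t.Even}
  {c : Cochain k T.toBiBasis}

theorem θT_tmul_mem (α : Fin t.dim₁) (hω : ω ∈ ⋀[k]^r (Fin t.dim₁ → k)) (hf : f.IsHomogeneous b)
    (hc : c ∈ cspan k (S (r + 1) b)) : t.θT α (ω ⊗ₜ f) ⊗ₜ[k] c ∈ T.graded S :=
  tmul_mem_graded (ι_mul_mem _ hω) hf hc

theorem xT_tmul_mem (a : Fin t.dim₂) (hω : ω ∈ ⋀[k]^r (Fin t.dim₁ → k)) (hf : f.IsHomogeneous b)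
    (hc : c ∈ cspan k (S r (b + 1))) : t.xT a (ω ⊗ₜ f) ⊗ₜ[k] c ∈ T.graded S :=
  tmul_mem_graded hω (by simpa [add_comm] using (MvPolynomial.isHomogeneous_X k a).mul hf) hc

theorem dT_tmul_mem (α : Fin t.dim₁) (hω : ω ∈ ⋀[k]^r (Fin t.dim₁ → k)) (hf : f.IsHomogeneous b)
    (hc : ∀ r', r' + 1 = r → c ∈ cspan k (S r' b)) : t.dT α (ω ⊗ₜ f) ⊗ₜ[k] c ∈ T.graded S := by
  rw [dT_tmul]
  cases r with
  | zero =>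
    rw [dθ_of_mem_zero α hω, TensorProduct.zero_tmul, TensorProduct.zero_tmul]
    exact Submodule.zero_mem _
  | succ r => exact tmul_mem_graded (dθ_mem α ω hω) hf (hc r rfl)

theorem pderiv_cases {b : ℕ} {f : t.Even} (hf : f.IsHomogeneous b) (a : Fin t.dim₂) :
    MvPolynomial.pderiv a f = 0 ∨ ∃ b', b' + 1 = b ∧ (MvPolynomial.pderiv a f).IsHomogeneous b' := by
  cases b with
  | zero => exact Or.inl (pderiv_eq_zero_of_isHomogeneous_zero hf a)
  | succ b => exact Or.inr ⟨b, rfl, by simpa using hf.pderiv⟩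

theorem covD_tmul_mem (α : Fin t.dim₁) (hω : ω ∈ ⋀[k]^r (Fin t.dim₁ → k)) (hf : f.IsHomogeneous b)
    (hc : ∀ r', r' + 1 = r → c ∈ cspan k (S r' b))
    (hc' : ∀ b', b' + 1 = b → c ∈ cspan k (S (r + 1) b')) :
    t.covD α (ω ⊗ₜ f) ⊗ₜ[k] c ∈ T.graded S := by
  rw [covD_apply, TensorProduct.add_tmul, shear_apply, ← TensorProduct.smul_tmul',
    TensorProduct.sum_tmul]
  refine Submodule.add_mem _ (dT_tmul_mem α hω hf hc) (Submodule.smul_mem _ _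
    (Submodule.sum_mem _ fun a _ => ?_))
  rw [TensorProduct.sum_tmul]
  refine Submodule.sum_mem _ fun β _ => ?_
  rw [← TensorProduct.smul_tmul']
  refine Submodule.smul_mem _ _ ?_
  rw [pT_tmul]
  rcases pderiv_cases hf a with h | ⟨b', hb, h⟩
  · rw [h, TensorProduct.tmul_zero, map_zero, TensorProduct.zero_tmul]
    exact Submodule.zero_mem _
  · exact θT_tmul_mem β hω h (hc' b' hb)

theorem σT_pT_tmul_mem (a : Fin t.dim₂) (hω : ω ∈ ⋀[k]^r (Fin t.dim₁ → k)) (hf : f.IsHomogeneous b)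
    (hc : ∀ b', b' + 1 = b → c ∈ cspan k (S r b')) :
    t.σT (t.pT a (ω ⊗ₜ f)) ⊗ₜ[k] c ∈ T.graded S := by
  rw [pT_tmul]
  rcases pderiv_cases hf a with h | ⟨b', hb, h⟩
  · rw [h, TensorProduct.tmul_zero, map_zero, TensorProduct.zero_tmul]
    exact Submodule.zero_mem _
  · exact tmul_mem_graded (par_mem ω hω) h (hc b' hb)

end

/-! ### The bigrading -/

variable (T) in
/-- The component of bidegree `(p, q)`. -/
def bigraded (p q : ℤ) : Submodule k T.E :=
  T.graded fun r b => biSet T.toBiBasis p (q + r + 2 * b)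

theorem lamX_mul_mem (α : Fin t.dim₁) {p q : ℤ} {c : Cochain k T.toBiBasis}
    (hc : c ∈ cspan k (biSet T.toBiBasis p q)) :
    T.lamX α * c ∈ cspan k (biSet T.toBiBasis (p + 1) (q - 1)) := by
  have h := mul_mem_biSet (x_mem_biSet (k := k) (T.lam α).1) hc
  rw [(T.lam_deg α).1, (T.lam_deg α).2] at h
  convert h using 3 <;> ring

theorem vX_mul_mem (a : Fin t.dim₂) {p q : ℤ} {c : Cochain k T.toBiBasis}
    (hc : c ∈ cspan k (biSet T.toBiBasis p q)) :
    T.vX a * c ∈ cspan k (biSet T.toBiBasis (p + 1) (q - 2)) := by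
  have h := mul_mem_biSet (x_mem_biSet (k := k) (T.vv a).1) hc
  rw [(T.vv_deg a).1, (T.vv_deg a).2] at h
  convert h using 3 <;> ring

theorem pd_lam_mem (α : Fin t.dim₁) {p q : ℤ} {c : Cochain k T.toBiBasis}
    (hc : c ∈ cspan k (biSet T.toBiBasis p q)) :
    pd (T.lam α).1 c ∈ cspan k (biSet T.toBiBasis (p - 1) (q + 1)) := by
  refine pd_mem (fun s hs => ?_) c hc
  obtain ⟨h1, h2⟩ := hs
  rw [Multiset.map_cons, Multiset.sum_cons] at h1 h2
  rw [(T.lam_deg α).1] at h1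
  rw [(T.lam_deg α).2] at h2
  constructor <;> omega

theorem pd_vv_mem (a : Fin t.dim₂) {p q : ℤ} {c : Cochain k T.toBiBasis}
    (hc : c ∈ cspan k (biSet T.toBiBasis p q)) :
    pd (T.vv a).1 c ∈ cspan k (biSet T.toBiBasis (p - 1) (q + 2)) := by
  refine pd_mem (fun s hs => ?_) c hc
  obtain ⟨h1, h2⟩ := hs
  rw [Multiset.map_cons, Multiset.sum_cons] at h1 h2
  rw [(T.vv_deg a).1] at h1
  rw [(T.vv_deg a).2] at h2
  constructor <;> omega

theorem cspan_biSet_congr {B : BiBasis.{v}} {p q p' q' : ℤ} (hp : p = p') (hq : q = q')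
    {c : Cochain k B} (hc : c ∈ cspan k (biSet B p q)) : c ∈ cspan k (biSet B p' q') := by
  rwa [← hp, ← hq]

theorem totD_mem {p q : ℤ} {y : T.E} (hy : y ∈ T.bigraded p q) :
    T.totD y ∈ T.bigraded (p + 1) q := by
  refine map_mem_of_graded (fun r b ω f l hω hf hl => ?_) hy
  have hc := word_mem_cspan (k := k) hl
  rw [totD_tmul]
  refine Submodule.add_mem _ (Submodule.add_mem _ (Submodule.sum_mem _ fun α _ => ?_)
    (Submodule.sum_mem _ fun a _ => ?_)) ?_
  · refine covD_tmul_mem α hω hf (fun r' hr => ?_) (fun b' hb => ?_)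
    · exact cspan_biSet_congr rfl (by rw [← hr]; push_cast; ring) (lamX_mul_mem α hc)
    · exact cspan_biSet_congr rfl (by rw [← hb]; push_cast; ring) (lamX_mul_mem α hc)
  · refine σT_pT_tmul_mem a hω hf (fun b' hb => ?_)
    exact cspan_biSet_congr rfl (by rw [← hb]; push_cast; ring) (vX_mul_mem a hc)
  · exact tmul_mem_graded (par_mem ω hω) hf (T.toLInf.d_mem_biSet hc)

theorem htpy_mem {p q : ℤ} {y : T.E} (hy : y ∈ T.bigraded p q) :
    T.htpy y ∈ T.bigraded (p - 1) q := by
  refine map_mem_of_graded (fun r b ω f l hω hf hl => ?_) hy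
  have hc := word_mem_cspan (k := k) hl
  rw [htpy_tmul]
  refine Submodule.add_mem _ (Submodule.sum_mem _ fun α _ => ?_) (Submodule.sum_mem _ fun a _ => ?_)
  · exact θT_tmul_mem α hω hf (cspan_biSet_congr rfl (by push_cast; ring) (pd_lam_mem α hc))
  · rw [σT_tmul]
    exact xT_tmul_mem a (par_mem ω hω) hf
      (cspan_biSet_congr rfl (by push_cast; ring) (pd_vv_mem a hc))

/-! ### The weight filtration -/

variable (T) in
/-- The number of letters of stage zero or one in a word. -/
def low (s : Multiset T.ι) : ℕ :=
  s.countP (fun i => T.toLInf.stage i = 0) + s.countP (fun i => T.toLInf.stage i = 1)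

theorem sum_map_ite (P : T.ι → Prop) [DecidablePred P] (l : List T.ι) :
    (l.map fun i => if P i then (1 : k) else 0).sum = (((l : Multiset T.ι).countP P : ℕ) : k) := by
  induction l with
  | nil => simp
  | cons i l ih =>
    rw [← Multiset.cons_coe, Multiset.countP_cons, List.map_cons, List.sum_cons, ih]
    split_ifs <;> push_cast <;> ring

theorem sum_x_mul_pd {n : ℕ} {s : ℤ} (e : Fin n ≃ {i : T.ι // T.toLInf.stage i = s})
    (l : List T.ι) : ∑ α, T.toLInf.x (e α).1 * pd (e α).1 (word k T.toBiBasis l) =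
      (((l : Multiset T.ι).countP fun i => T.toLInf.stage i = s : ℕ) : k) • word k T.toBiBasis l := by
  have h := euler_word (Finset.univ.map (e.toEmbedding.trans (Function.Embedding.subtype _)))
    (fun i => if T.toLInf.stage i = s then (1 : k) else 0) l (fun i _ => by
      by_cases hi : T.toLInf.stage i = s
      · left
        rw [Finset.mem_map]
        exact ⟨e.symm ⟨i, hi⟩, Finset.mem_univ _, by simp⟩
      · exact Or.inr (if_neg hi))
  rw [Finset.sum_map, sum_map_ite] at h
  rw [← h]
  refine Finset.sum_congr rfl fun α _ => ?_
  change _ = (if T.toLInf.stage (e α).1 = s then (1 : k) else 0) • _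
  rw [if_pos (e α).2, one_smul]
  rfl

variable (T) in
/-- The elements of internal degree `-M` and weight at least `m`, which involve `θ`, `x`, `λ`
or `v`. -/
def lowSet (M m r b : ℕ) : Set (Multiset T.ι) :=
  {s | m ≤ r + 2 * b ∧ s ∈ intSet T.toBiBasis (M - (r + 2 * b)) ∧ 1 ≤ r + b + T.low s}

theorem mem_cspan_lowSet {M m r b : ℕ} {n : ℤ} {c : Cochain k T.toBiBasis}
    (hc : c ∈ cspan k (intSet T.toBiBasis n)) (hn : n = M - (r + 2 * b)) (hm : m ≤ r + 2 * b)
    (hr : 1 ≤ r + b) : c ∈ cspan k (T.lowSet M m r b) := by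
  subst hn
  refine cspan_mono ?_ hc
  intro s hs
  exact ⟨hm, hs, by omega⟩

/-- A superspace weight above `M` would leave negative internal degree for the word. The filtration
is therefore finite in each internal degree. -/
theorem graded_lowSet_eq_bot (M : ℕ) : T.graded (T.lowSet M (M + 1)) = ⊥ := by
  rw [graded, Submodule.span_eq_bot]
  rintro _ ⟨r, b, ω, f, l, -, -, ⟨h1, h2, -⟩, -⟩
  have h3 := T.toLInf.sum_int_nonneg (l : Multiset T.ι)
  have h4 : ((l : Multiset T.ι).map T.int).sum = M - (r + 2 * b) := h2
  rw [h4] at h3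
  omega

theorem sum_θT_dT {r : ℕ} {ω : t.Odd} (hω : ω ∈ ⋀[k]^r (Fin t.dim₁ → k)) (f : t.Even) :
    ∑ α, t.θT α (t.dT α (ω ⊗ₜ f)) = (r : k) • ω ⊗ₜ[k] f := by
  simp only [dT_tmul, θT_tmul]
  rw [← TensorProduct.sum_tmul, sum_θ_mul_dθ ω hω, TensorProduct.smul_tmul']

theorem sum_xT_pT (ω : t.Odd) {b : ℕ} {f : t.Even} (hf : f.IsHomogeneous b) :
    ∑ a, t.xT a (t.pT a (ω ⊗ₜ f)) = (b : k) • ω ⊗ₜ[k] f := by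
  simp only [pT_tmul, xT_tmul]
  rw [← TensorProduct.tmul_sum, hf.sum_X_mul_pderiv, ← Nat.cast_smul_eq_nsmul k,
    TensorProduct.tmul_smul]

/-- The scalar is the number of letters `θ`, `x`, `λ`, `v`, nonzero by the definition of `lowSet`.
Every other term of the Laplacian gains a factor `θ` or `x`, so it has larger weight. -/
theorem laplacian_of_mem [CharZero k] {M m r b : ℕ} {ω : t.Odd} {f : t.Even} {l : List T.ι}
    (hω : ω ∈ ⋀[k]^r (Fin t.dim₁ → k)) (hf : f.IsHomogeneous b)
    (hl : (l : Multiset T.ι) ∈ T.lowSet M m r b) :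
    ∃ c : ℕ, c ≠ 0 ∧ ∃ z ∈ T.graded (T.lowSet M (m + 1)),
      T.totD (T.htpy ((ω ⊗ₜ[k] f) ⊗ₜ[k] word k T.toBiBasis l)) +
        T.htpy (T.totD ((ω ⊗ₜ[k] f) ⊗ₜ[k] word k T.toBiBasis l)) =
          (c : k) • (ω ⊗ₜ[k] f) ⊗ₜ[k] word k T.toBiBasis l + z := by
  obtain ⟨h1, h2, h3⟩ := hl
  have hc := word_mem_cspan (k := k) h2
  have key := laplacian_tmul (T := T) (ω ⊗ₜ[k] f) (word k T.toBiBasis l)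
  have e0 : ((T.low l : ℕ) : k) + ((r : k) + b) = ((r + b + T.low l : ℕ) : k) := by
    push_cast
    ring
  rw [sum_θT_dT hω, sum_xT_pT ω hf, sum_x_mul_pd (k := k) T.lam l, sum_x_mul_pd (k := k) T.vv l,
    ← add_smul, ← add_smul, TensorProduct.tmul_smul, ← TensorProduct.smul_tmul', ← add_smul,
    ← Nat.cast_add, ← low, e0] at key
  refine ⟨r + b + T.low l, by omega, _, ?_, key⟩
  · refine Submodule.add_mem _ (Submodule.sum_mem _ fun β _ => ?_)
      (Submodule.add_mem _ (Submodule.sum_mem _ fun a _ => Submodule.sum_mem _ fun α _ => ?_)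
        (Submodule.sum_mem _ fun a _ => ?_))
    · rw [σT_tmul]
      refine θT_tmul_mem β (par_mem ω hω) hf (mem_cspan_lowSet (Submodule.sub_mem _
        (pd_mem_intSet _ (T.toLInf.d_mem_intSet hc)) (T.toLInf.d_mem_intSet (pd_mem_intSet _ hc)))
        ?_ (by omega) (by omega))
      rw [(T.lam_deg β).2]
      push_cast
      ring
    · rw [← TensorProduct.smul_tmul', TensorProduct.sum_tmul]
      refine Submodule.smul_mem _ _ (Submodule.sum_mem _ fun β _ => ?_)
      rw [← TensorProduct.smul_tmul', σT_tmul]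
      refine Submodule.smul_mem _ _ (θT_tmul_mem β (par_mem ω hω) hf (mem_cspan_lowSet
        (mul_mem_intSet (x_mem_intSet _) (pd_mem_intSet _ hc)) ?_ (by omega) (by omega)))
      rw [(T.lam_deg α).2, (T.vv_deg a).2]
      push_cast
      ring
    · refine xT_tmul_mem a hω hf (mem_cspan_lowSet (Submodule.add_mem _
        (T.toLInf.d_mem_intSet (pd_mem_intSet _ hc)) (pd_mem_intSet _ (T.toLInf.d_mem_intSet hc)))
        ?_ (by omega) (by omega))
      rw [(T.vv_deg a).2]
      push_cast
      ring

theorem exists_totD_htpy_eq [CharZero k] {M : ℕ} {p q : ℤ} {y : T.E}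
    (hy : y ∈ T.graded (T.lowSet M 0)) (hy' : y ∈ T.bigraded p q) (hD : T.totD y = 0) :
    ∃ w ∈ T.bigraded p q, T.totD (T.htpy w) = y := by
  refine exists_homotopy_of_filtration (X := T.E) (D := T.totD) (h := T.htpy) totD_totD
    (J := fun m => T.graded (T.lowSet M m))
    (G := fun m => {y | ∃ (r b : ℕ) (ω : t.Odd) (f : t.Even) (l : List T.ι),
      ω ∈ ⋀[k]^r (Fin t.dim₁ → k) ∧ f.IsHomogeneous b ∧ (l : Multiset T.ι) ∈ T.lowSet M m r b ∧
        y = (ω ⊗ₜ[k] f) ⊗ₜ[k] word k T.toBiBasis l})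
    (fun m => rfl) (graded_lowSet_eq_bot M) ?_ (V := T.bigraded p q) ?_ hy hy' hD
  · rintro m _ ⟨r, b, ω, f, l, hω, hf, hl, rfl⟩
    exact laplacian_of_mem hω hf hl
  · intro y hy
    have h1 := totD_mem (htpy_mem hy)
    have h2 := htpy_mem (totD_mem hy)
    rw [sub_add_cancel] at h1
    rw [add_sub_cancel_right] at h2
    exact Submodule.add_mem _ h1 h2

/-! ### Lifting cocycles of `𝔫` -/

/-- What restriction to `𝔫` forgets are the words with a letter of internal degree below three;
nondegeneracy says that such a letter is a `λ` or a `v`. -/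
theorem sub_truncExt_truncRes_mem (hT : T.IsNondegenerate) {p q : ℤ} {c : Cochain k T.toBiBasis}
    (hc : c ∈ cspan k (biSet T.toBiBasis p q)) : c - T.toLInf.truncExt 3 (T.toLInf.truncRes 3 c) ∈
      cspan k {s | s ∈ intSet T.toBiBasis (-q) ∧ 1 ≤ T.low s} := by
  refine mem_comap_of_word (LinearMap.id - (T.toLInf.truncExt 3).toLinearMap ∘ₗ
    (T.toLInf.truncRes 3).toLinearMap) _ (fun l hl => ?_) c hc
  change word k T.toBiBasis l -
    T.toLInf.truncExt 3 (T.toLInf.truncRes 3 (word k T.toBiBasis l)) ∈ _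
  by_cases h : ∀ i ∈ l, 3 ≤ T.int i
  · have h1 : T.toLInf.truncExt 3 (T.toLInf.truncRes 3 (word k T.toBiBasis l)) =
        word k T.toBiBasis l := by
      clear hl
      induction l with
      | nil => rw [word_nil, map_one, map_one]
      | cons i l ih =>
        rw [word_cons, map_mul, map_mul, ih fun j hj => h j (List.mem_cons_of_mem _ hj)]
        congr 1
        have := LInf.truncRes_x_of_le (A := T.toLInf) (h i List.mem_cons_self)
        rw [this, LInf.truncExt_x]
    rw [h1, sub_self]
    exact Submodule.zero_mem _
  · push Not at h
    obtain ⟨i, hi, hi3⟩ := h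
    have h1 : T.toLInf.truncRes 3 (word k T.toBiBasis l) = 0 := by
      obtain ⟨l₁, l₂, rfl⟩ := List.append_of_mem hi
      rw [word_append, word_cons, map_mul, map_mul, LInf.truncRes_x_of_lt hi3, zero_mul, mul_zero]
    rw [h1, map_zero, sub_zero]
    refine word_mem_cspan ⟨biSet_subset_intSet p q hl, ?_⟩
    have h2 : ¬ 2 ≤ T.toLInf.stage i := fun h => absurd ((hT i).1 h) (not_le.2 hi3)
    have h3 := T.stage_nonneg i
    have h4 : T.toLInf.stage i = 0 ∨ T.toLInf.stage i = 1 := by omega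
    rw [low]
    rcases h4 with h4 | h4
    · have : 0 < (l : Multiset T.ι).countP fun i => T.toLInf.stage i = 0 :=
        Multiset.countP_pos.2 ⟨i, hi, h4⟩
      omega
    · have : 0 < (l : Multiset T.ι).countP fun i => T.toLInf.stage i = 1 :=
        Multiset.countP_pos.2 ⟨i, hi, h4⟩
      omega

/-- Cocycles of `𝔫` lift to cocycles with values in functions on superspace. -/
theorem exists_lift [CharZero k] (hT : T.IsNondegenerate) {p q : ℤ} (hq : q < 0)
    {z : Cochain k T.n.toBiBasis} (hz : z ∈ piece k T.n.toBiBasis p q) (hd : T.n.d z = 0) :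
    ∃ y ∈ T.bigraded p q, T.totD y = 0 ∧ T.toN y = z := by
  obtain ⟨M, hM⟩ := Int.eq_ofNat_of_zero_le (show 0 ≤ -q by omega)
  set c : Cochain k T.toBiBasis := T.toLInf.truncExt 3 z with hc
  have hcz : T.resN c = z := LInf.truncRes_truncExt z
  have hc1 : c ∈ cspan k (biSet T.toBiBasis p q) := by
    rw [← piece_eq]
    exact LInf.truncExt_piece hz
  have hone : (1 : t.Odd) ∈ ⋀[k]^0 (Fin t.dim₁ → k) := mem_exteriorPower_zero.2 ⟨1, one_smul _ _⟩
  have h0 : ((1 : t.Odd) ⊗ₜ[k] (1 : t.Even)) ⊗ₜ[k] c ∈ T.bigraded p q := by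
    refine tmul_mem_graded hone (MvPolynomial.isHomogeneous_one _ _) ?_
    exact cspan_biSet_congr rfl (by push_cast; ring) hc1
  have h1 : T.totD (((1 : t.Odd) ⊗ₜ[k] (1 : t.Even)) ⊗ₜ[k] c) =
      ((1 : t.Odd) ⊗ₜ[k] (1 : t.Even)) ⊗ₜ[k] T.d c := by
    rw [totD_tmul, σT_one]
    simp only [covD_one, pT_one, map_zero, TensorProduct.zero_tmul, Finset.sum_const_zero, zero_add]
  -- The extension by zero of a cocycle of `𝔫` is closed up to words containing `λ` or `v`. On these
  -- the Laplacian is invertible.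
  have h2 : T.d c ∈ cspan k {s | s ∈ intSet T.toBiBasis (-q) ∧ 1 ≤ T.low s} := by
    have h3 : T.toLInf.truncRes 3 (T.d c) = 0 := by
      have := T.resN_d c
      rw [hcz, hd] at this
      exact this
    have := sub_truncExt_truncRes_mem hT (T.toLInf.d_mem_biSet hc1)
    rwa [h3, map_zero, sub_zero] at this
  have hlow : {s | s ∈ intSet T.toBiBasis (-q) ∧ 1 ≤ T.low s} ⊆ T.lowSet M 0 0 0 := by
    rintro s ⟨hs, hs'⟩
    rw [hM] at hs
    exact ⟨Nat.zero_le _, by simpa using hs, by omega⟩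
  obtain ⟨w, hw, hw'⟩ := exists_totD_htpy_eq (M := M) (p := p + 1) (q := q)
    (y := ((1 : t.Odd) ⊗ₜ[k] (1 : t.Even)) ⊗ₜ[k] T.d c)
    (tmul_mem_graded hone (MvPolynomial.isHomogeneous_one _ _) (cspan_mono hlow h2))
    (h1 ▸ totD_mem h0) (by rw [← h1, totD_totD])
  have h4 := htpy_mem hw
  rw [add_sub_cancel_right] at h4
  -- The correction lies in the image of the homotopy, so it does not change the value under `toN`.
  refine ⟨_ + (-1 : k) • T.htpy w, Submodule.add_mem _ h0 (Submodule.smul_mem _ _ h4), ?_, ?_⟩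
  · rw [map_add, map_smul, hw', h1]
    nth_rewrite 1 [← one_smul k (((1 : t.Odd) ⊗ₜ[k] (1 : t.Even)) ⊗ₜ[k] T.d c)]
    rw [← add_smul, add_neg_cancel, zero_smul]
  · rw [map_add, map_smul, toN_htpy, smul_zero, add_zero, toN_tmul, evalT_one, one_smul, hcz]

end TateResolution

/-! ### Comparison of the cohomologies -/

/-- A correspondence that is onto the cocycles of a second complex, and under which coboundaries
of the first complex yield coboundaries, bounds the cohomology of the second. -/
theorem BiCohomology.finrank_le {k : Type u} [Field k] {X Y E : Type*} [AddCommGroup X]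
    [Module k X] [AddCommGroup Y] [Module k Y] [AddCommGroup E] [Module k E]
    {P : ℤ → ℤ → Submodule k X} {d : X →ₗ[k] X} {N : Submodule k X}
    {P' : ℤ → ℤ → Submodule k Y} {d' : Y →ₗ[k] Y} {N' : Submodule k Y} {p q : ℤ}
    (hfin : Module.Finite k (BiCohomology P d N p q)) (Z : Submodule k E) (f : E →ₗ[k] X)
    (g : E →ₗ[k] Y) (hf : ∀ z ∈ Z, f z ∈ LinearMap.ker d ⊓ P p q)
    (hg : ∀ z ∈ Z, g z ∈ LinearMap.ker d' ⊓ P' p q)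
    (hsurj : ∀ y ∈ LinearMap.ker d' ⊓ P' p q, ∃ z ∈ Z, g z = y)
    (hker : ∀ z ∈ Z, f z ∈ (P (p - 1) q).map d ⊔ N → g z ∈ (P' (p - 1) q).map d' ⊔ N') :
    Module.finrank k (BiCohomology P' d' N' p q) ≤ Module.finrank k (BiCohomology P d N p q) := by
  let F : Z →ₗ[k] BiCohomology P d N p q :=
    Submodule.mkQ _ ∘ₗ (f.restrict hf)
  let G : Z →ₗ[k] BiCohomology P' d' N' p q :=
    Submodule.mkQ _ ∘ₗ (g.restrict hg)
  have hG : Function.Surjective G := by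
    intro y
    obtain ⟨⟨y, hy⟩, rfl⟩ := Submodule.mkQ_surjective _ y
    obtain ⟨z, hz, rfl⟩ := hsurj y hy
    exact ⟨⟨z, hz⟩, rfl⟩
  -- So `G` factors through the image of `F`, a subspace of the cohomology of the first complex.
  have hFG : LinearMap.ker F ≤ LinearMap.ker G := by
    rintro ⟨z, hz⟩ h
    have h1 : (Submodule.Quotient.mk (f.restrict hf ⟨z, hz⟩) : BiCohomology P d N p q) = 0 := h
    rw [Submodule.Quotient.mk_eq_zero] at h1
    refine LinearMap.mem_ker.2 ((Submodule.Quotient.mk_eq_zero _).2 ?_)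
    exact hker z hz h1
  have h1 : Function.Surjective ((LinearMap.ker F).liftQ G hFG ∘ₗ
      F.quotKerEquivRange.symm.toLinearMap) := by
    intro y
    obtain ⟨z, rfl⟩ := hG y
    refine ⟨F.quotKerEquivRange (Submodule.Quotient.mk z), ?_⟩
    rw [LinearMap.comp_apply, LinearEquiv.coe_coe, LinearEquiv.symm_apply_apply]
    rfl
  exact (LinearMap.finrank_le_finrank_of_surjective h1).trans (Submodule.finrank_le _)

/-! ### Linear representatives and exactness of decomposable cocycles -/

namespace LInf

open Cochain

variable {k : Type u} [Field k] {A : LInf.{u, v} k}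

theorem piece_eq_bot (p : ℤ) {q : ℤ} (hq : q ≠ 0) (hA : ∀ i, A.int i ≤ -q → False) :
    piece k A.toBiBasis p q = ⊥ := by
  rw [piece_eq, cspan, Submodule.span_eq_bot]
  rintro _ ⟨l, h, rfl⟩
  exfalso
  have h2 : ((l : Multiset A.ι).map A.int).sum = -q := biSet_subset_intSet p q h
  cases l with
  | nil => simp at h2; exact hq h2
  | cons i l => exact hA i (h2 ▸ A.int_le_of_mem (List.mem_cons_self))

/-- A bihomogeneous decomposable cocycle is cohomologous to a linear one. Coboundaries of a minimal
differential are decomposable, so that linear representative is decomposable too, hence zero. For `q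
≥ 0` there is no nonzero decomposable cochain. -/
theorem IsMinimal.decomposableExact (hmin : A.IsMinimal)
    (h : ∀ p q, q < 0 → A.H1 p q = ⊤) : A.DecomposableExact := by
  intro c hc hd
  obtain ⟨F, hF⟩ := exists_sum_cproj (fun m : Multiset A.ι =>
    ((m.map fun i => 1 - A.coh i).sum, (m.map fun i => -A.int i).sum)) c
  have hset : ∀ n : ℤ × ℤ, {m : Multiset A.ι | ((m.map fun i => 1 - A.coh i).sum,
      (m.map fun i => -A.int i).sum) = n} = biSet A.toBiBasis n.1 n.2 := fun n => by
    ext m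
    simp [biSet, Prod.ext_iff]
  have key : ∀ p q, ∃ w, A.d w = cproj (biSet A.toBiBasis p q) c := by
    intro p q
    have h1 : cproj (biSet A.toBiBasis p q) c ∈ cspan k (lenSet A.toBiBasis 2) :=
      cproj_mem_of_mem hc
    have h2 : A.d (cproj (biSet A.toBiBasis p q) c) = 0 := by
      rw [d_cproj_biSet, hd, map_zero]
    have h3 : cproj (biSet A.toBiBasis p q) c ∈ cspan k (biSet A.toBiBasis p q) := cproj_mem _ _
    generalize cproj (biSet A.toBiBasis p q) c = z at h1 h2 h3
    rcases lt_or_ge q 0 with hq | hq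
    · have h3' : z ∈ piece k A.toBiBasis p q := by rwa [piece_eq]
      have h4 : (Submodule.Quotient.mk ⟨z, h2, h3'⟩ : A.H p q) ∈ A.H1 p q := by
        rw [h p q hq]
        trivial
      obtain ⟨⟨y, hy, hy'⟩, hlin, hyz⟩ := h4
      have h5 := (Submodule.Quotient.eq _).1 hyz
      rw [Submodule.mem_comap, sup_bot_eq] at h5
      obtain ⟨w, -, hw⟩ := h5
      have hw : A.d w = y - z := hw
      have hlin : y ∈ linear k A.toBiBasis := hlin
      have h6 : y ∈ cspan k (lenSet A.toBiBasis 2) := by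
        have := Submodule.add_mem _ (hmin.d_mem_two w) h1
        rwa [hw, sub_add_cancel] at this
      rw [linear_eq] at hlin
      have h7 := eq_zero_of_mem_disjoint (lenEq_disjoint one_lt_two) hlin h6
      exact ⟨-w, by rw [map_neg, hw, h7, zero_sub, neg_neg]⟩
    · refine ⟨0, ?_⟩
      rw [map_zero, eq_zero_of_int_nonpos A (show -q ≤ 0 by omega)
        (cspan_mono (biSet_subset_intSet p q) h3) (lenSet_anti one_le_two h1)]
  choose w hw using key
  refine ⟨∑ n ∈ F, w n.1 n.2, ?_⟩
  rw [map_sum]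
  conv_rhs => rw [hF F subset_rfl]
  refine Finset.sum_congr rfl fun n _ => ?_
  rw [hw, hset]

end LInf

/-! ### The dimension bound for the cohomology of `𝔫` -/

namespace TateResolution

open Supertranslation Cochain

variable {k : Type u} [Field k] {t : Supertranslation k} {T : TateResolution.{u, v} t}

theorem evalT_of_pos {r b : ℕ} {ω : t.Odd} {f : t.Even} (hω : ω ∈ ⋀[k]^r (Fin t.dim₁ → k))
    (hf : f.IsHomogeneous b) (h : 0 < r + b) : t.evalT (ω ⊗ₜ f) = 0 := by
  rw [evalT_tmul]
  cases r with
  | succ r =>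
    have h1 : ∀ ω ∈ ⋀[k]^(r + 1) (Fin t.dim₁ → k), ω ∈ LinearMap.ker
        (ExteriorAlgebra.algebraMapInv (R := k) (M := Fin t.dim₁ → k)).toLinearMap := by
      refine exteriorPower_induction fun m ω _ => ?_
      change ExteriorAlgebra.algebraMapInv (ExteriorAlgebra.ι k m * ω) = 0
      rw [map_mul]
      have : ExteriorAlgebra.algebraMapInv (ExteriorAlgebra.ι k m) = 0 := by
        simp [ExteriorAlgebra.algebraMapInv]
      rw [this, zero_mul]
    have h2 : ExteriorAlgebra.algebraMapInv ω = 0 := h1 ω hω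
    rw [h2, zero_mul]
  | zero =>
    have h2 : MvPolynomial.aeval (R := k) (fun _ : Fin t.dim₂ => (0 : k)) f = 0 := by
      have h3 := MvPolynomial.aeval_zero' (S₁ := k) f
      rw [h3, MvPolynomial.constantCoeff_eq, hf.coeff_eq_zero (by simp; omega), map_zero]
    rw [h2, mul_zero]

theorem toN_mem {p q : ℤ} {y : T.E} (hy : y ∈ T.bigraded p q) :
    T.toN y ∈ piece k T.n.toBiBasis p q := by
  refine map_mem_of_graded (fun r b ω f l hω hf hl => ?_) hy
  rw [toN_tmul]
  rcases Nat.eq_zero_or_pos (r + b) with h | h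
  · obtain ⟨rfl, rfl⟩ := Nat.add_eq_zero_iff.1 h
    refine Submodule.smul_mem _ _ (LInf.truncRes_piece (m := 3) ?_)
    rw [piece_eq]
    exact cspan_biSet_congr rfl (by push_cast; ring) (word_mem_cspan hl)
  · rw [evalT_of_pos hω hf h, zero_smul]
    exact Submodule.zero_mem _

theorem toR_word (l : List T.ι) : T.toR (word k T.toBiBasis l) = 0 ∨
    ((T.toR (word k T.toBiBasis l)).IsHomogeneous l.length ∧ ∀ i ∈ l, T.toLInf.stage i = 0) := by
  induction l with
  | nil =>
    refine Or.inr ⟨?_, by simp⟩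
    rw [word_nil, map_one]
    exact MvPolynomial.isHomogeneous_one _ _
  | cons i l ih =>
    rw [word_cons, map_mul]
    by_cases hi : T.toLInf.stage i = 0
    · rcases ih with ih | ⟨ih, ih'⟩
      · exact Or.inl (by rw [ih, mul_zero])
      · refine Or.inr ⟨?_, ?_⟩
        · have h1 : T.toR (x k T.toBiBasis i) = MvPolynomial.X (T.lam.symm ⟨i, hi⟩) := by
            have := T.toR_lamX (T.lam.symm ⟨i, hi⟩)
            rwa [lamX, Equiv.apply_symm_apply] at this
          rw [h1, List.length_cons, add_comm]
          exact (MvPolynomial.isHomogeneous_X k _).mul ih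
        · rintro j (_ | ⟨_, hj⟩)
          · exact hi
          · exact ih' j hj
    · exact Or.inl (by
        have := T.toR_x hi
        rw [show x k T.toBiBasis i = T.toLInf.x i from rfl, this, zero_mul])

theorem coh_of_stage_zero {i : T.ι} (hi : T.toLInf.stage i = 0) : T.coh i = 0 := by
  have := (T.lam_deg (T.lam.symm ⟨i, hi⟩)).1
  rwa [Equiv.apply_symm_apply] at this

theorem toA_mem {p q : ℤ} {y : T.E} (hy : y ∈ T.bigraded p q) : toA y ∈ t.piece p q := by
  refine map_mem_of_graded (fun r b ω f l hω hf hl => ?_) hy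
  rw [toA_tmul, toS_apply]
  rcases T.toR_word l with h | ⟨h, h'⟩
  · rw [h, map_zero, TensorProduct.tmul_zero]
    exact Submodule.zero_mem _
  · have h1 : ∀ l : List T.ι, (∀ i ∈ l, T.toLInf.stage i = 0) →
        ((l : Multiset T.ι).map fun i => 1 - T.coh i).sum = l.length ∧
        ((l : Multiset T.ι).map fun i => -T.int i).sum = -l.length := by
      intro l hl
      induction l with
      | nil => simp
      | cons i l ih =>
        have h2 := ih fun j hj => hl j (List.mem_cons_of_mem _ hj)
        have h3 := hl i List.mem_cons_self
        rw [← Multiset.cons_coe, Multiset.map_cons, Multiset.map_cons, Multiset.sum_cons,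
          Multiset.sum_cons, h2.1, h2.2, coh_of_stage_zero h3, T.int_lam h3, List.length_cons]
        push_cast
        constructor <;> ring
    obtain ⟨h2, h3⟩ := h1 l h'
    refine Submodule.subset_span ⟨r, b, l.length, ω, f, _, hω, hf, h, ?_, ?_, rfl⟩
    · rw [← h2]
      exact hl.1.symm
    · have h4 := hl.2.symm.trans h3
      linarith

/-- Closed elements of `E` form a correspondence between the two cohomologies. It reaches every
cocycle of `𝔫` by lifting. If the image in `A(S)` is exact modulo constants, then the element is
exact in `E` up to a constant, because the kernel of the comparison map is acyclic and that map is
onto. Only this inequality is needed, not an isomorphism. -/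
theorem finrank_H_le [CharZero k] (hT : T.IsNondegenerate) {p q : ℤ} (hq : q < 0)
    (hfin : Module.Finite k (t.Multiplet p q)) :
    Module.finrank k (T.n.H p q) ≤ Module.finrank k (t.Multiplet p q) := by
  refine BiCohomology.finrank_le (E := T.E) hfin (LinearMap.ker T.totD ⊓ T.bigraded p q) toA T.toN ?_ ?_ ?_ ?_
  · rintro z ⟨hz, hz'⟩
    have hz : T.totD z = 0 := hz
    refine ⟨?_, toA_mem hz'⟩
    change t.D (toA z) = 0
    rw [← toA_totD, hz, map_zero]
  · rintro z ⟨hz, hz'⟩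
    have hz : T.totD z = 0 := hz
    refine ⟨?_, toN_mem hz'⟩
    change T.n.d (T.toN z) = 0
    rw [← toN_totD, hz, map_zero]
  · rintro y ⟨hy, hy'⟩
    obtain ⟨z, hz, hz', rfl⟩ := exists_lift hT hq hy' hy
    exact ⟨z, ⟨hz', hz⟩, rfl⟩
  · rintro z ⟨hz, hz'⟩ h
    have hz : T.totD z = 0 := hz
    obtain ⟨_, ⟨a, -, rfl⟩, _, hc, hac⟩ := Submodule.mem_sup.1 h
    obtain ⟨c, rfl⟩ := Submodule.mem_span_singleton.1 hc
    obtain ⟨a, rfl⟩ := toA_surjective (T := T) a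
    set e : T.E := ((1 : t.Odd) ⊗ₜ[k] (1 : t.Even)) ⊗ₜ[k] (1 : Cochain k T.toBiBasis) with he
    have he1 : T.totD e = 0 := by
      rw [he, totD_tmul, LInf.d_one]
      simp only [covD_one, pT_one, map_zero, TensorProduct.zero_tmul, Finset.sum_const_zero,
        TensorProduct.tmul_zero, add_zero]
    have he2 : toA e = (1 : t.A) := by
      rw [he, toA_tmul, map_one]
      rfl
    have he3 : T.toN e = 1 := by
      rw [he, toN_tmul, evalT_one, map_one, one_smul]
    have h1 : toA (z - (T.totD a + c • e)) = 0 := by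
      rw [map_sub, map_add, map_smul, toA_totD, he2, hac]
      exact sub_self _
    have h2 : T.totD (z - (T.totD a + c • e)) = 0 := by
      rw [map_sub, map_add, map_smul, totD_totD, he1, hz, smul_zero, add_zero]
      exact sub_self _
    obtain ⟨w, hw⟩ := exists_totD_eq_of_toA_eq_zero h2 h1
    have h3 : T.toN z = T.n.d (T.toN w + T.toN a) + c • 1 := by
      have := congrArg T.toN hw
      rw [map_sub, map_add, map_smul, he3, toN_totD, toN_totD] at this
      rw [map_add, add_assoc, this, sub_add_cancel]
    rw [sup_bot_eq]
    have h4 := toN_mem hz'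
    rw [piece_eq] at h4
    -- The primitives found so far need not be homogeneous. Projecting to bidegree `(p - 1, q)`
    -- repairs this and, as `q < 0`, also removes the constant.
    refine ⟨cproj (biSet T.n.toBiBasis (p - 1) q) (T.toN w + T.toN a), ?_, ?_⟩
    · rw [piece_eq]
      exact cproj_mem _ _
    · have h5 : cproj (biSet T.n.toBiBasis p q) (1 : Cochain k T.n.toBiBasis) = 0 := by
        rw [← word_nil, cproj_word, if_neg]
        rintro ⟨-, h⟩
        simp at h
        omega
      rw [LInf.d_cproj_biSet, sub_add_cancel, ← cproj_of_mem h4, h3,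
        (cproj (biSet T.n.toBiBasis p q)).map_add _ (c • 1),
        (cproj (biSet T.n.toBiBasis p q)).map_smul, h5, smul_zero, add_zero]

end TateResolution

/-! ### Models with a quadratic differential -/

namespace LInf

open Cochain

variable {k : Type u} [Field k] {A : LInf.{u, v} k}

theorem linear_inf_piece_eq_bot (p : ℤ) {q : ℤ} (hq : 0 ≤ q) :
    linear k A.toBiBasis ⊓ piece k A.toBiBasis p q = ⊥ := by
  rw [eq_bot_iff]
  rintro a ⟨ha, ha'⟩
  rw [linear_eq] at ha
  rw [piece_eq] at ha'
  exact eq_zero_of_int_nonpos A (show -q ≤ 0 by omega) (cspan_mono (biSet_subset_intSet p q) ha')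
    (lenEq_le 1 ha)

theorem subsingleton_linCocycles (p : ℤ) {q : ℤ} (hq : 0 ≤ q) :
    Subsingleton (A.linCocycles p q) := by
  rw [Submodule.subsingleton_iff_eq_bot, eq_bot_iff, ← linear_inf_piece_eq_bot p hq, linCocycles,
    inf_assoc]
  exact inf_le_right

theorem subsingleton_H1 (p : ℤ) {q : ℤ} (hq : 0 ≤ q) : Subsingleton (A.H1 p q) := by
  rw [Submodule.subsingleton_iff_eq_bot, eq_bot_iff]
  rintro _ ⟨⟨y, hy, hy'⟩, hlin, rfl⟩
  have h : y ∈ linear k A.toBiBasis ⊓ piece k A.toBiBasis p q := ⟨hlin, hy'⟩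
  rw [linear_inf_piece_eq_bot p hq, Submodule.mem_bot] at h
  subst h
  exact (Submodule.mem_bot k).2 (map_zero (Submodule.mkQ _))

instance finite_linCocycles (p q : ℤ) : Module.Finite k (A.linCocycles p q) :=
  Submodule.finiteDimensional_of_le (S₂ := piece k A.toBiBasis p q) inf_le_right

variable (A) in
/-- A bigraded vector space with a basis dual to the linear cocycles. -/
def dualLinCocycles : BiBasis.{v} where
  ι := Σ n : ℤ × ℤ, ULift.{v} (Fin (Module.finrank k (A.linCocycles (1 - n.1) (-n.2))))
  coh i := i.1.1
  int i := i.1.2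

theorem nonempty_component_equiv (c n : ℤ) : Nonempty ((A.dualLinCocycles).component k c n ≃ₗ[k]
    Module.Dual k (A.linCocycles (1 - c) (-n))) := by
  let s : Set A.dualLinCocycles.ι :=
    {i | A.dualLinCocycles.coh i = c ∧ A.dualLinCocycles.int i = n}
  let e : s ≃ Fin (Module.finrank k (A.linCocycles (1 - c) (-n))) :=
    { toFun := fun i => Fin.cast (by
        obtain ⟨⟨⟨c', n'⟩, i⟩, h, h'⟩ := i
        change c' = c at h
        change n' = n at h'
        subst h h'
        rfl) i.1.2.down
      invFun := fun i => ⟨⟨(c, n), ⟨i⟩⟩, rfl, rfl⟩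
      left_inv := by
        rintro ⟨⟨⟨c', n'⟩, i⟩, h, h'⟩
        change c' = c at h
        change n' = n at h'
        subst h h'
        rfl
      right_inv := fun i => rfl }
  have : Finite s := Finite.of_equiv _ e.symm
  have : Fintype s := Fintype.ofFinite s
  let f : (A.dualLinCocycles).component k c n ≃ₗ[k] (s →₀ k) := Finsupp.supportedEquivFinsupp s
  refine ⟨f ≪≫ₗ LinearEquiv.ofFinrankEq (s →₀ k) _ ?_⟩
  rw [Module.finrank_finsupp_self, Subspace.dual_finrank_eq, Fintype.card_congr e,
    Fintype.card_fin]

end LInf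

/-! ### From the hypothesis on the multiplet to a quadratic model -/

namespace TateResolution

open Supertranslation Cochain

variable {k : Type u} [Field k] [CharZero k] {t : Supertranslation k} {T : TateResolution.{u, v} t}

/-- `𝔫` has no cochains of internal degree `-2`, so the hypothesis makes the multiplet vanish in
bidegree `(0, -2)`, which is what independence of the quadrics requires. -/
theorem isNondegenerate_of_equiv (e : t.Multiplet 0 (-2) ≃ₗ[k] T.n.H1 0 (-2)) :
    T.IsNondegenerate := by
  refine T.isNondegenerate_of_linearIndependent (linearIndependent_quadric ?_)
  have h1 : piece k T.n.toBiBasis 0 (-2) = ⊥ := by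
    refine LInf.piece_eq_bot 0 (by norm_num) fun i hi => ?_
    have h3 : 3 ≤ T.int i.1 := i.2
    have hi : T.int i.1 ≤ - -2 := hi
    omega
  have h2 : Subsingleton (T.n.H1 0 (-2)) := by
    rw [Submodule.subsingleton_iff_eq_bot, eq_bot_iff]
    rintro _ ⟨⟨y, hy, hy'⟩, -, rfl⟩
    rw [h1, SetLike.mem_coe, Submodule.mem_bot] at hy'
    subst hy'
    exact (Submodule.mem_bot k).2 (map_zero (Submodule.mkQ _))
  exact e.toEquiv.subsingleton

/-- The chain `dim H ≤ dim M = dim H^(1) ≤ dim H` of finite dimensions collapses. -/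
theorem H1_eq_top (hT : T.IsNondegenerate) {p q : ℤ} (hq : q < 0)
    (e : t.Multiplet p q ≃ₗ[k] T.n.H1 p q) : T.n.H1 p q = ⊤ := by
  have hfin : Module.Finite k (T.n.H p q) := by
    have : Module.Finite k ↥(LinearMap.ker T.n.d ⊓ piece k T.n.toBiBasis p q) :=
      Submodule.finiteDimensional_of_le (S₂ := piece k T.n.toBiBasis p q) inf_le_right
    exact Module.Finite.quotient k _
  have h1 : Module.Finite k (t.Multiplet p q) := Module.Finite.equiv e.symm
  refine Submodule.eq_top_of_finrank_eq (le_antisymm (Submodule.finrank_le _) ?_)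
  rw [← e.finrank_eq]
  exact finrank_H_le hT hq h1

theorem exists_quadratic_model (hM : ∀ p q : ℤ, Nonempty (t.Multiplet p q ≃ₗ[k] T.n.H1 p q)) :
    ∃ F : LInf.{u, v} k, F.IsQuadratic ∧ F.DecomposableExact ∧ T.n.Isomorphic F ∧
      ∀ p q, Nonempty (F.linCocycles p q ≃ₗ[k] t.Multiplet p q) := by
  have hT : T.IsNondegenerate := isNondegenerate_of_equiv (hM 0 (-2)).some
  have hmin := isMinimal_n hT
  have htop : ∀ p q, q < 0 → T.n.H1 p q = ⊤ := fun p q hq => H1_eq_top hT hq (hM p q).some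
  obtain ⟨F, hF, hex, hiso, he⟩ := LInf.exists_quadratic hmin (hmin.decomposableExact htop)
  refine ⟨F, hF, hex, hiso, fun p q => ?_⟩
  obtain ⟨e⟩ := hM p q
  rcases lt_or_ge q 0 with hq | hq
  · obtain ⟨e'⟩ := he p q hq.ne
    exact ⟨e' ≪≫ₗ (LinearEquiv.ofTop _ (htop p q hq)).symm ≪≫ₗ e.symm⟩
  -- For `q ≥ 0` there are no linear cochains, so both spaces vanish; the constants have been
  -- divided out of the multiplet.
  · have h1 := LInf.subsingleton_linCocycles (A := F) p hq
    have h2 := LInf.subsingleton_H1 (A := T.n) p hq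
    have h3 : Subsingleton (t.Multiplet p q) := e.toEquiv.subsingleton
    exact ⟨0, 0, fun _ => Subsingleton.elim _ _, fun _ => h3.elim _ _⟩

end TateResolution

end

theorem mainTheorem3 {k : Type u} [Field k] [CharZero k] (t : Supertranslation k)
    (T : TateResolution.{u, v} t)
    (hM : ∀ p q : ℤ, Nonempty (t.Multiplet p q ≃ₗ[k] T.n.H1 p q)) :
    T.n.IsFreeLie (ShiftedDual k t.Multiplet) ∧ T.toLInf.IsFreelyGeneratedFrom 3 := by
  obtain ⟨F, hF, hex, hiso, e⟩ := TateResolution.exists_quadratic_model hM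
  -- Dualising the identification of linear cocycles with the multiplet gives the generators. For
  -- the second claim the same model is used, with a homogeneous basis of the dual of its linear
  -- cocycles as generators.
  exact ⟨LInf.isFreeLie_of_isomorphic hiso hF hex fun c n => (e (1 - c) (-n)).some.dualMap,
    F.dualLinCocycles, LInf.isFreeLie_of_isomorphic hiso hF hex fun c n =>
      (LInf.nonempty_component_equiv c n).some⟩
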